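/- **Setting.** Let $X\subseteq\mathbb R^d$ be closed and convex, and consider $\min_{x\in X}F(x)$, $F(x)=\frac1n\sum_{i=1}^n f_i(g_i(x))+r(x)$, where $g_i(x)=\mathbb E_{\zeta\sim\mathbb P_i}[g_i(x;\zeta)]\in\mathbb R^m$. Let $\|\cdot\|$ be a norm on $\mathbb R^m$ with dual norm $\|\cdot\|_*$, such that $\frac12\|\cdot\|_2^2$ is $\mu_\psi$-strongly convex and $L_\psi$-smooth with respect to $\|\cdot\|$, that is, $\mu_\psi\|v\|^2\le\|v\|_2^2\le L_\psi\|v\|^2$ (for the Euclidean norm, $\mu_\psi=L_\psi=1$). Assume: * $r:X\to(-\infty,+\infty]$ is proper, lower semicontinuous and convex. * Every $g_i$ is (coordinatewise) convex on $X$, differentiable on $X$, with $\|g_i(x)-g_i(x')\|_*\le C_g\|x-x'\|_2$ and $\|g_i(x)-g_i(x')-\nabla g_i(x')(x-x')\|_*\le\frac{L_g}{2}\|x-x'\|_2^2$ for $x,x'\in X$. * Every $f_i:\mathbb R^m\to\mathbb R$ is convex (possibly non-smooth), with $|f_i(u)-f_i(u')|\le C_f\|u-u'\|_*$, and $f_i$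 is non-decreasing in each coordinate unless $g_i$ is affine on $X$. * The first-order oracle $g_i'(x;\zeta)$ is unbiased, $\mathbb E_{\zeta\sim\mathbb P_i}[g_i'(x;\zeta)]=\nabla g_i(x)$ for $x\in X$. With $\mathcal Y_i$ the (compact, convex) closure of the domain of the convex conjugate $f_i^*$, for all $x\in X$ and $y\in\mathcal Y_1\times\dots\times\mathcal Y_n$: $\mathbb E\|g_i(x)-g_i(x;\zeta)\|_*^2\le\sigma_0^2$, $\ \mathbb E\|\nabla g_i(x)-g_i'(x;\zeta)\|_{\mathrm{op}}^2\le\sigma_1^2$ (operator norm from $\|\cdot\|_2$ to $\|\cdot\|_*$), and $\frac1n\sum_{j}\big\|\nabla g_j(x)^\top y^{(j)}-\frac1n\sum_i\nabla g_i(x)^\top y^{(i)}\big\|_2^2\le\delta^2$. **Algorithm (ALEXR with $\psi_i=\frac12\|\cdot\|_2^2$, $\theta=1$).** Let $1\le S\le n$ and $B\ge1$. Start at deterministic $x_0\in X$, $y_0\in\mathcal Y_1\times\dots\times\mathcal Y_n$, and put $x_{-1}=x_0$. In iteration $t=0,1,\dots$ draw, independently of the past, a uniformly random $\mathcal S_t\subseteq\{1,\dots,n\}$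 with $|\mathcal S_t|=S$ and, for each $i$, two independent batches $\mathcal B_t^{(i)},\tilde{\mathcal B}_t^{(i)}$ of $B$ i.i.d. samples from $\mathbb P_i$ (independent also over $i$ and of $\mathcal S_t$; only those with $i\in\mathcal S_t$ are used). Writing $g_i(x;\mathcal B)$ and $g_i'(x;\mathcal B)$ for batch averages, set $$y_{t+1}^{(i)}=\arg\max_{v\in\mathcal Y_i}\Big\{\big\langle v,\;2g_i(x_t;\mathcal B_t^{(i)})-g_i(x_{t-1};\mathcal B_t^{(i)})\big\rangle-f_i^*(v)-\tfrac\tau2\|v-y_t^{(i)}\|_2^2\Big\}\ (i\in\mathcal S_t),\qquad y_{t+1}^{(i)}=y_t^{(i)}\ (i\notin\mathcal S_t),$$ $$G_t=\frac1S\sum_{i\in\mathcal S_t}[g_i'(x_t;\tilde{\mathcal B}_t^{(i)})]^\top y_{t+1}^{(i)},\qquad x_{t+1}=\arg\min_{x\in X}\Big\{\langle G_t,x\rangle+r(x)+\tfrac\eta2\|x-x_t\|_2^2\Big\}.$$ Let $\bar x_T=\frac1T\sum_{t=0}^{T-1}x_{t+1}$, and let $\tilde y_T$ be any measurable selection with $\tilde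 y_T^{(i)}\in\arg\max_{v\in\mathcal Y_i}\{\langle v,g_i(\bar x_T)\rangle-f_i^*(v)\}$. Put $\Omega_{\mathcal Y}^0=\mathbb E\big[\sum_{i=1}^n\frac12\|\tilde y_T^{(i)}-y_0^{(i)}\|_2^2\big]$. **Theorem.** There is a constant $C>0$, depending only on $C_f,C_g,L_g,\sigma_0,\sigma_1,\delta,\mu_\psi,L_\psi$ and a bound $D$, and for all $S,B\ge1$ there is $\varepsilon_0>0$, depending only on the same constants and on $S,B$, such that for every $\varepsilon\in(0,\varepsilon_0]$ there are parameters $0<\eta\le C/\varepsilon$ and $0<\tau\le C/(B\varepsilon)$, depending only on the same constants and on $S$, $B$, $\varepsilon$, with the following property. For every problem as above with $n\ge S$ and a minimizer $x_*$ of $F$ on $X$ with $\|x_0-x_*\|_2\le D$, and every number of iterations $$T\ \ge\ C\,\max\Big\{\frac1S,\ \frac{\Omega_{\mathcal Y}^0}{BS}\Big\}\,\frac1{\varepsilon^2},$$ the algorithm with these $\eta,\tau$ satisfies $\mathbb E[F(\bar x_T)-F(x_*)]\le\varepsilon$. -/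

import Mathlib

open MeasureTheory ProbabilityTheory
open scoped ENNReal RealInnerProductSpace

noncomputable section

namespace ALEXR

/-- Euclidean space of dimension `k`. -/
abbrev Vec (k : ℕ) : Type := EuclideanSpace ℝ (Fin k)

/-- Subsets of the finite index set carry the discrete measurable structure. -/
instance instMeasurableSpaceFinsetFin (n : ℕ) : MeasurableSpace (Finset (Fin n)) := ⊤

instance instDiscreteFinsetFin (n : ℕ) : DiscreteMeasurableSpace (Finset (Fin n)) :=
  ⟨fun _ => trivial⟩

/-! ### Norms, conjugates, Bregman divergences -/

/-- The norm dual to `q`: `‖u‖_* = sup {⟪u, v⟫ : q v ≤ 1}`. -/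
def dualNorm {m : ℕ} (q : Seminorm ℝ (Vec m)) (u : Vec m) : ℝ :=
  ⨆ v : {v : Vec m // q v ≤ 1}, ⟪u, (v : Vec m)⟫

/-- The operator norm of a linear map from Euclidean space to the dual of the space normed by `q`.
It equals the operator norm of the adjoint, from the space normed by `q` to Euclidean space. -/
def opNorm {d m : ℕ} (q : Seminorm ℝ (Vec m)) (A : Vec d →L[ℝ] Vec m) : ℝ :=
  ⨆ x : {x : Vec d // ‖x‖ ≤ 1}, dualNorm q (A x)

/-- The convex conjugate `f^*`, with values in the extended reals. -/
def conj {m : ℕ} (f : Vec m → ℝ) (v : Vec m) : EReal :=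
  ⨆ u : Vec m, ((⟪v, u⟫ - f u : ℝ) : EReal)

/-- The block of the dual feasible set that belongs to `f`: the closure of the effective domain of
`f^*` (convex, and compact when `f` is Lipschitz). -/
def dualSet {m : ℕ} (f : Vec m → ℝ) : Set (Vec m) :=
  closure {v | conj f v < ⊤}

/-- The Bregman divergence `U_ψ(u, v) = ψ u - ψ v - ⟪∇ψ(v), u - v⟫`. -/
def bregman {m : ℕ} (ψ : Vec m → ℝ) (u v : Vec m) : ℝ :=
  ψ u - ψ v - ⟪gradient ψ v, u - v⟫

/-- The quadratic distance-generating function `½‖·‖₂²`. -/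
def quad {m : ℕ} (v : Vec m) : ℝ := (1 / 2) * ‖v‖ ^ 2

theorem bregman_quad {m : ℕ} (u v : Vec m) : bregman quad u v = (1 / 2) * ‖u - v‖ ^ 2 := by
  have h : HasGradientAt (quad (m := m)) v v := by
    rw [hasGradientAt_iff_hasFDerivAt]
    have h1 := ((hasStrictFDerivAt_norm_sq v).hasFDerivAt).const_mul (1 / 2 : ℝ)
    refine h1.congr_fderiv ?_
    ext w
    simp
  rw [bregman, h.gradient, norm_sub_sq_real, inner_sub_right, real_inner_self_eq_norm_sq,
    real_inner_comm]
  simp only [quad]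
  ring

/-! ### The problem -/

/-- The data of a finite-sum coupled compositional problem with `n` summands, `x` in dimension `d`
and inner functions with values in dimension `m`. Functions of `x` are only looked at on `X`. -/
structure Problem (n d m : ℕ) (Z : Type*) [MeasurableSpace Z] where
  /-- the feasible set -/
  X : Set (Vec d)
  /-- the outer functions `f_i` -/
  f : Fin n → Vec m → ℝ
  /-- the distribution of the samples of the `i`-th inner function -/
  P : Fin n → Measure Z
  /-- the zeroth-order stochastic oracle `g_i(x; ζ)` -/
  gs : Fin n → Vec d → Z → Vec m
  /-- the first-order stochastic oracle `g_i'(x; ζ)` -/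
  dgs : Fin n → Vec d → Z → Vec d →L[ℝ] Vec m
  /-- the derivative of the inner function `g_i` on `X` -/
  dg : Fin n → Vec d → Vec d →L[ℝ] Vec m
  /-- the regularizer, which may take the value `+∞` -/
  r : Vec d → EReal

variable {n d m : ℕ} {Z : Type*} [MeasurableSpace Z]

/-- The inner function `g_i(x) = E[g_i(x; ζ)]`. -/
def Problem.g (p : Problem n d m Z) (i : Fin n) (x : Vec d) : Vec m :=
  ∫ ζ, p.gs i x ζ ∂(p.P i)

/-- The objective `F(x) = (1/n) ∑ f_i(g_i(x)) + r(x)`. -/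
def Problem.F (p : Problem n d m Z) (x : Vec d) : EReal :=
  (((1 / (n : ℝ)) * ∑ i, p.f i (p.g i x) : ℝ) : EReal) + p.r x

/-- The standing assumptions, with smooth inner functions, with respect to the norm `q` on the dual
blocks. -/
structure Problem.Assumptions (p : Problem n d m Z) (q : Seminorm ℝ (Vec m))
    (Cf Cg Lg σ₀ σ₁ δ : ℝ) : Prop where
  /- the domain and the regularizer: `r` is proper, lower semicontinuous and convex on `X` -/
  convex_X : Convex ℝ p.X
  closed_X : IsClosed p.X
  r_ne_bot : ∀ x ∈ p.X, p.r x ≠ ⊥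
  r_proper : ∃ x ∈ p.X, p.r x ≠ ⊤
  r_lsc : LowerSemicontinuousOn p.r p.X
  r_convex : ∀ x ∈ p.X, ∀ z ∈ p.X, ∀ a b : ℝ, 0 < a → 0 < b → a + b = 1 →
    p.r (a • x + b • z) ≤ (a : EReal) * p.r x + (b : EReal) * p.r z
  /- the samples and the measurability of the oracles -/
  prob : ∀ i, IsProbabilityMeasure (p.P i)
  gs_meas : ∀ i, Measurable fun w : Vec d × Z => p.gs i w.1 w.2
  dgs_meas : ∀ i, Measurable fun w : Vec d × Z => p.dgs i w.1 w.2
  /- the inner functions are convex, Lipschitz and smooth on `X` -/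
  g_convex : ∀ i k, ConvexOn ℝ p.X fun x => p.g i x k
  g_lip : ∀ i, ∀ x ∈ p.X, ∀ z ∈ p.X, dualNorm q (p.g i x - p.g i z) ≤ Cg * ‖x - z‖
  g_deriv : ∀ i, ∀ x ∈ p.X, HasFDerivWithinAt (p.g i) (p.dg i x) p.X x
  g_smooth : ∀ i, ∀ x ∈ p.X, ∀ z ∈ p.X,
    dualNorm q (p.g i x - p.g i z - p.dg i z (x - z)) ≤ Lg / 2 * ‖x - z‖ ^ 2
  /- the outer functions are convex and Lipschitz, and monotone unless `g_i` is affine on `X` -/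
  f_convex : ∀ i, ConvexOn ℝ Set.univ (p.f i)
  f_lip : ∀ i u v, |p.f i u - p.f i v| ≤ Cf * dualNorm q (u - v)
  f_mono : ∀ i, (∀ u v : Vec m, (∀ k, u k ≤ v k) → p.f i u ≤ p.f i v) ∨
    ∃ A : Vec d →ᵃ[ℝ] Vec m, Set.EqOn (p.g i) A p.X
  /- the first-order oracle is unbiased, and the variances are bounded -/
  dgs_unbiased : ∀ i, ∀ x ∈ p.X, ∫ ζ, p.dgs i x ζ ∂(p.P i) = p.dg i x
  var_zero : ∀ i, ∀ x ∈ p.X,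
    ∫⁻ ζ, ENNReal.ofReal (dualNorm q (p.g i x - p.gs i x ζ) ^ 2) ∂(p.P i)
      ≤ ENNReal.ofReal (σ₀ ^ 2)
  var_one : ∀ i, ∀ x ∈ p.X,
    ∫⁻ ζ, ENNReal.ofReal (opNorm q (p.dg i x - p.dgs i x ζ) ^ 2) ∂(p.P i)
      ≤ ENNReal.ofReal (σ₁ ^ 2)
  var_block : ∀ x ∈ p.X, ∀ y : Fin n → Vec m, (∀ i, y i ∈ dualSet (p.f i)) →
    (1 / (n : ℝ)) * ∑ j, ‖(p.dg j x).adjoint (y j)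
      - (1 / (n : ℝ)) • ∑ i, (p.dg i x).adjoint (y i)‖ ^ 2 ≤ δ ^ 2

/-! ### The algorithm -/

/-- The randomness of one iteration: the sampled block set, and for each block `i` the batches
`𝓑ᵢ` and `𝓑̃ᵢ`. Only the batches of sampled blocks are used by the algorithm. -/
abbrev Sample (n B : ℕ) (Z : Type*) : Type _ :=
  Finset (Fin n) × (Fin n → Fin B → Z) × (Fin n → Fin B → Z)

/-- The law of the randomness of one iteration: the block set is uniform among the subsets of size
`S`, all entries of the batches of block `i` have law `P_i`, and everything is independent. -/
def Problem.sampleLaw (p : Problem n d m Z) (S B : ℕ) : Measure (Sample n B Z) :=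
  (uniformOn ((Finset.univ.powersetCard S : Finset (Finset (Fin n))) :
      Set (Finset (Fin n)))).prod
    ((Measure.pi fun i => Measure.pi fun _ : Fin B => p.P i).prod
      (Measure.pi fun i => Measure.pi fun _ : Fin B => p.P i))

/-- The mini-batch estimator `g_i(x; 𝓑)`. -/
def Problem.gBatch (p : Problem n d m Z) {B : ℕ} (i : Fin n) (x : Vec d) (b : Fin B → Z) :
    Vec m :=
  (1 / (B : ℝ)) • ∑ j, p.gs i x (b j)

/-- The mini-batch estimator `g_i'(x; 𝓑)`. -/
def Problem.dgBatch (p : Problem n d m Z) {B : ℕ} (i : Fin n) (x : Vec d) (b : Fin B → Z) :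
    Vec d →L[ℝ] Vec m :=
  (1 / (B : ℝ)) • ∑ j, p.dgs i x (b j)

/-- The extrapolated estimator `g_i(x; 𝓑) + θ (g_i(x; 𝓑) - g_i(x'; 𝓑))`, where `x'` is the
previous iterate. -/
def Problem.gExtra (p : Problem n d m Z) {B : ℕ} (θ : ℝ) (i : Fin n) (x xprev : Vec d)
    (b : Fin B → Z) : Vec m :=
  p.gBatch i x b + θ • (p.gBatch i x b - p.gBatch i xprev b)

/-- The stochastic gradient estimator `G = (1/S) ∑_{i ∈ s} [g_i'(x; 𝓑̃ᵢ)]ᵀ y_i`. -/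
def Problem.gradEst (p : Problem n d m Z) {B : ℕ} (S : ℕ) (s : Finset (Fin n)) (x : Vec d)
    (y : Fin n → Vec m) (b : Fin n → Fin B → Z) : Vec d :=
  (1 / (S : ℝ)) • ∑ i ∈ s, (p.dgBatch i x (b i)).adjoint (y i)

/-- `(x, y)` is a run of the algorithm with batch sizes `S` and `B`, distance-generating function
`ψ`, parameters `θ, η, τ`, and deterministic start `(x₀, y₀)`, driven by the samples `W`. In the
first iteration the previous iterate is `x₀` itself (as `0 - 1 = 0` for natural numbers). -/
structure IsRun (p : Problem n d m Z) (S B : ℕ) (ψ : Vec m → ℝ) (θ η τ : ℝ) (x₀ : Vec d)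
    (y₀ : Fin n → Vec m) {Ω : Type*} [MeasurableSpace Ω] (μ : Measure Ω)
    (W : ℕ → Ω → Sample n B Z) (x : ℕ → Ω → Vec d) (y : ℕ → Ω → Fin n → Vec m) : Prop where
  sample_meas : ∀ t, Measurable (W t)
  sample_indep : iIndepFun W μ
  sample_law : ∀ t, μ.map (W t) = p.sampleLaw S B
  x_zero : ∀ ω, x 0 ω = x₀
  y_zero : ∀ ω, y 0 ω = y₀
  y_sampled : ∀ t ω, ∀ i ∈ (W t ω).1, y (t + 1) ω i ∈ dualSet (p.f i) ∧
    IsMaxOn (fun v : Vec m =>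
      ((⟪v, p.gExtra θ i (x t ω) (x (t - 1) ω) ((W t ω).2.1 i)⟫
        - τ * bregman ψ v (y t ω i) : ℝ) : EReal) - conj (p.f i) v)
      (dualSet (p.f i)) (y (t + 1) ω i)
  y_unsampled : ∀ t ω, ∀ i ∉ (W t ω).1, y (t + 1) ω i = y t ω i
  x_step : ∀ t ω, x (t + 1) ω ∈ p.X ∧
    IsMinOn (fun z : Vec d =>
      ((⟪p.gradEst S (W t ω).1 (x t ω) (y (t + 1) ω) (W t ω).2.2, z⟫
        + η / 2 * ‖z - x t ω‖ ^ 2 : ℝ) : EReal) + p.r z)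
      p.X (x (t + 1) ω)

/-- The time average `x̄_T = (1/T) ∑_{t < T} x_{t+1}`. -/
def average {Ω : Type*} (x : ℕ → Ω → Vec d) (T : ℕ) (ω : Ω) : Vec d :=
  (1 / (T : ℝ)) • ∑ t ∈ Finset.range T, x (t + 1) ω

/-- `ỹ` is a measurable selection `ỹ_i ∈ argmax_{v ∈ 𝓨ᵢ} {⟪v, g_i(x̄)⟫ - f_i^*(v)}` at the random
point `x̄`. -/
def IsDualSelection (p : Problem n d m Z) {Ω : Type*} [MeasurableSpace Ω] (xbar : Ω → Vec d)
    (yt : Ω → Fin n → Vec m) : Prop :=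
  Measurable yt ∧ ∀ ω i, yt ω i ∈ dualSet (p.f i) ∧
    IsMaxOn (fun v : Vec m => ((⟪v, p.g i (xbar ω)⟫ : ℝ) : EReal) - conj (p.f i) v)
      (dualSet (p.f i)) (yt ω i)

/-- The radius `E[∑ᵢ U_ψ(ỹ_i, y₀_i)]`. -/
def radius {Ω : Type*} [MeasurableSpace Ω] (μ : Measure Ω) (ψ : Vec m → ℝ)
    (yt : Ω → Fin n → Vec m) (y₀ : Fin n → Vec m) : ℝ :=
  ∫ ω, ∑ i, bregman ψ (yt ω i) (y₀ i) ∂μ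

end ALEXR

end

noncomputable section

namespace ALEXR

/-! ### Quadratic proximal steps -/

section Prox

/-! By Fenchel duality `F x` is the maximum over `y` of `L(x, y) = (1/n) ∑ (⟪y i, g i x⟫ - f_i^*(y
i)) + r x`, and the algorithm is a stochastic primal-dual method for this saddle point. Let `z t` be
the virtual dual iterate in which every block is updated, sampled or not, and let `w` be the dual
selection at the average. On the dual sets `x ↦ ⟪y i, g i x⟫` is convex. Together with biconjugation
at `w` and Fenchel–Young at `z t`, this bounds `T (F x̄ - F x_*)` by the sum of the gaps `L(x (t+1),
w) - L(x_*, z t)` (`exists_gap_le`).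

These gaps are bounded pathwise, for every `w` (`sum_gap_le`). The three-point inequalities of the
proximal steps leave negative multiples of `‖x (t+1) - x t‖²` and `‖z t i - y t i‖²`. Thanks to the
extrapolation the coupling error is `⟪w - z t, Δ (t+1) - Δ t⟫` with `Δ t = g (x t) - g (x (t-1))`.
It telescopes up to products that the negative terms absorb once `32 G² ≤ η τ` (`coupling_sum_le`).

The difficulty is that `w` depends on the whole run, so nothing paired with it is centred. Every
such term is reduced to `⟪w - y 0, M⟫`, where `M` is a sum of martingale increments: the errors of
the inner estimates (`noise_sum_le`), or the sampling deviations times `z t - y t`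
(`distance_sum_le`). Young's inequality costs a multiple of `(τ/S) ‖w - y 0‖²`, which becomes the
radius, plus a multiple of `‖M‖²`. By orthogonality the expectation of `‖M‖²` is only a sum over `t`
of second moments. For the sampling part, the weights have variance at most `1/(nS)`, and the result
is cancelled by a reserved share of the negative terms (`integralLE_block_noise`).

The gradient error has second moment of order `1/S`, the inner error of order `1/B`. In expectation
the gap is at most `(1/T) (η D²/2 + 8 K² G²/η + 6 τ Ω/S) + 4 (K² s₁² + δ²)/(η S) + 25 s₀²/(B τ)`,
and `η = K₀/(S ε)`, `τ = K₀/(B ε)` make each of the five terms at most `ε/5` (`step_size_bound`).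

The iterates of a run are not assumed measurable. Proximal steps are unique and nonexpansive, so the
iterates are measurable functions of the past samples, and conditional expectations can be taken by
Fubini against the law of the fresh sample. -/

theorem nonneg_of_forall_add_mul {a b : ℝ} (h : ∀ s : ℝ, 0 < s → s < 1 → 0 ≤ a + s * b) :
    0 ≤ a := by
  refine le_of_forall_pos_le_add fun r hr => ?_
  -- This `s` lies in `(0, 1)` and satisfies `s * b ≤ r`; it replaces the limit `s → 0`.
  have hs : 0 < min (1 / 2) (r / (|b| + 1)) := by positivity
  have h1 := h _ hs (lt_of_le_of_lt (min_le_left _ _) (by norm_num))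
  have h2 : min (1 / 2) (r / (|b| + 1)) * b ≤ r := by
    calc min (1 / 2) (r / (|b| + 1)) * b ≤ min (1 / 2) (r / (|b| + 1)) * (|b| + 1) := by
          gcongr; linarith [le_abs_self b]
      _ ≤ r / (|b| + 1) * (|b| + 1) := by gcongr; exact min_le_right _ _
      _ = r := div_mul_cancel₀ _ (by positivity)
  linarith

variable {E : Type*} [NormedAddCommGroup E] [InnerProductSpace ℝ E]

/-- The three-point inequality of a proximal step. -/
theorem prox_three_point {A : Set E} {h : E → ℝ} (hh : ConvexOn ℝ A h) {τ : ℝ}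
    {c y₀ z : E} (hz : z ∈ A)
    (hmin : ∀ v ∈ A, h z + ⟪c, z⟫ + τ / 2 * ‖z - y₀‖ ^ 2 ≤ h v + ⟪c, v⟫ + τ / 2 * ‖v - y₀‖ ^ 2)
    {v : E} (hv : v ∈ A) :
    h z + ⟪c, z⟫ + τ / 2 * ‖z - y₀‖ ^ 2 + τ / 2 * ‖v - z‖ ^ 2
      ≤ h v + ⟪c, v⟫ + τ / 2 * ‖v - y₀‖ ^ 2 := by
  -- Minimality is tested at `z + s • (v - z)` and divided by `s`. As `s → 0` this leaves the
  -- variational inequality, without any derivative of `h`.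
  have key : ∀ s : ℝ, 0 < s → s < 1 →
      0 ≤ h v - h z + ⟪c, v - z⟫ + τ * ⟪z - y₀, v - z⟫ + s * (τ / 2 * ‖v - z‖ ^ 2) := by
    intro s hs0 hs1
    have hmem := hh.1 hz hv (sub_nonneg.2 hs1.le) hs0.le (by ring)
    have h1 := hmin _ hmem
    have h2 := hh.2 hz hv (sub_nonneg.2 hs1.le) hs0.le (by ring)
    have e1 : (1 - s) • z + s • v = z + s • (v - z) := by module
    rw [e1] at h1 h2
    have e2 : ‖z + s • (v - z) - y₀‖ ^ 2
        = ‖z - y₀‖ ^ 2 + 2 * s * ⟪z - y₀, v - z⟫ + s ^ 2 * ‖v - z‖ ^ 2 := by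
      rw [show z + s • (v - z) - y₀ = (z - y₀) + s • (v - z) by abel, norm_add_sq_real,
        inner_smul_right, norm_smul, Real.norm_eq_abs, mul_pow, sq_abs]
      ring
    rw [e2, inner_add_right, inner_smul_right] at h1
    simp only [smul_eq_mul] at h2
    have h3 : 0 ≤ s * (h v - h z + ⟪c, v - z⟫ + τ * ⟪z - y₀, v - z⟫
        + s * (τ / 2 * ‖v - z‖ ^ 2)) := by nlinarith
    exact nonneg_of_mul_nonneg_right h3 hs0
  have lim := nonneg_of_forall_add_mul key
  have e3 : ‖v - y₀‖ ^ 2 = ‖z - y₀‖ ^ 2 + 2 * ⟪z - y₀, v - z⟫ + ‖v - z‖ ^ 2 := by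
    rw [show v - y₀ = (z - y₀) + (v - z) by abel, norm_add_sq_real]
  rw [inner_sub_right] at lim
  rw [e3]
  linarith

/-- Points that satisfy the three-point inequality depend on the data in a nonexpansive way. -/
theorem prox_nonexpansive {h : E → ℝ} {τ : ℝ} (hτ : 0 < τ) {c y₀ z c' y₀' z' : E}
    (hz : h z + ⟪c, z⟫ + τ / 2 * ‖z - y₀‖ ^ 2 + τ / 2 * ‖z' - z‖ ^ 2
      ≤ h z' + ⟪c, z'⟫ + τ / 2 * ‖z' - y₀‖ ^ 2)
    (hz' : h z' + ⟪c', z'⟫ + τ / 2 * ‖z' - y₀'‖ ^ 2 + τ / 2 * ‖z - z'‖ ^ 2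
      ≤ h z + ⟪c', z⟫ + τ / 2 * ‖z - y₀'‖ ^ 2) :
    ‖z - z'‖ ≤ ‖(y₀ - τ⁻¹ • c) - (y₀' - τ⁻¹ • c')‖ := by
  -- Adding the two hypotheses cancels all values of `h`; what remains is a strong monotonicity
  -- estimate, to which Cauchy–Schwarz applies.
  have h1 : τ * ‖z - z'‖ ^ 2 ≤ τ * ⟪(y₀ - τ⁻¹ • c) - (y₀' - τ⁻¹ • c'), z - z'⟫ := by
    have e : τ * ⟪(y₀ - τ⁻¹ • c) - (y₀' - τ⁻¹ • c'), z - z'⟫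
        = τ * ⟪y₀ - y₀', z - z'⟫ - ⟪c - c', z - z'⟫ := by
      rw [show (y₀ - τ⁻¹ • c) - (y₀' - τ⁻¹ • c') = (y₀ - y₀') - τ⁻¹ • (c - c') by
        rw [smul_sub]; abel, inner_sub_left, inner_smul_left]
      simp only [conj_trivial]
      field_simp
    rw [e]
    have e1 : ‖z - y₀‖ ^ 2 = ‖z‖ ^ 2 - 2 * ⟪y₀, z⟫ + ‖y₀‖ ^ 2 := by
      rw [norm_sub_sq_real, real_inner_comm]
    have e2 : ‖z' - y₀‖ ^ 2 = ‖z'‖ ^ 2 - 2 * ⟪y₀, z'⟫ + ‖y₀‖ ^ 2 := by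
      rw [norm_sub_sq_real, real_inner_comm]
    have e3 : ‖z - y₀'‖ ^ 2 = ‖z‖ ^ 2 - 2 * ⟪y₀', z⟫ + ‖y₀'‖ ^ 2 := by
      rw [norm_sub_sq_real, real_inner_comm]
    have e4 : ‖z' - y₀'‖ ^ 2 = ‖z'‖ ^ 2 - 2 * ⟪y₀', z'⟫ + ‖y₀'‖ ^ 2 := by
      rw [norm_sub_sq_real, real_inner_comm]
    rw [e1, e2, norm_sub_rev z' z] at hz
    rw [e3, e4] at hz'
    simp only [inner_sub_left, inner_sub_right]
    linarith
  have h2 := le_of_mul_le_mul_left h1 hτ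
  have h3 := real_inner_le_norm ((y₀ - τ⁻¹ • c) - (y₀' - τ⁻¹ • c')) (z - z')
  rcases eq_or_lt_of_le (norm_nonneg (z - z')) with h0 | h0
  · rw [← h0]; positivity
  · exact le_of_mul_le_mul_right (by nlinarith) h0

end Prox

/-! ### Conjugates of Lipschitz convex functions -/

section Conj

variable {m : ℕ} {f : Vec m → ℝ} {K : ℝ}

theorem le_conj (f : Vec m → ℝ) (u v : Vec m) : ((⟪v, u⟫ - f u : ℝ) : EReal) ≤ conj f v :=
  le_iSup (fun u : Vec m => ((⟪v, u⟫ - f u : ℝ) : EReal)) u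

theorem conj_ne_bot (f : Vec m → ℝ) (v : Vec m) : conj f v ≠ ⊥ :=
  ne_bot_of_le_ne_bot (EReal.coe_ne_bot _) (le_conj f 0 v)

theorem coe_toReal_conj {v : Vec m} (hv : conj f v < ⊤) :
    ((conj f v).toReal : EReal) = conj f v :=
  EReal.coe_toReal hv.ne (conj_ne_bot f v)

theorem fenchel_young {v : Vec m} (hv : conj f v < ⊤) (u : Vec m) :
    ⟪v, u⟫ - (conj f v).toReal ≤ f u := by
  have := le_conj f u v
  rw [← coe_toReal_conj hv, EReal.coe_le_coe_iff] at this
  linarith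

/-- A supremum of affine functions is convex. The inequality is proved in `EReal` first, because
finiteness at the convex combination is part of the claim. -/
theorem convexOn_toReal_conj (f : Vec m → ℝ) :
    ConvexOn ℝ {v | conj f v < ⊤} fun v => (conj f v).toReal := by
  have key : ∀ v ∈ {v | conj f v < ⊤}, ∀ w ∈ {v | conj f v < ⊤}, ∀ a b : ℝ, 0 ≤ a → 0 ≤ b →
      a + b = 1 → conj f (a • v + b • w)
        ≤ ((a * (conj f v).toReal + b * (conj f w).toReal : ℝ) : EReal) := by
    intro v hv w hw a b ha hb hab
    refine iSup_le fun u => ?_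
    rw [EReal.coe_le_coe_iff, inner_add_left, inner_smul_left, inner_smul_left]
    simp only [conj_trivial]
    have h1 := fenchel_young hv u
    have h2 := fenchel_young hw u
    have h3 : f u = a * f u + b * f u := by rw [← add_mul, hab, one_mul]
    nlinarith [mul_le_mul_of_nonneg_left h1 ha, mul_le_mul_of_nonneg_left h2 hb]
  refine ⟨fun v hv w hw a b ha hb hab => ?_, fun v hv w hw a b ha hb hab => ?_⟩
  · exact lt_of_le_of_lt (key v hv w hw a b ha hb hab) (EReal.coe_lt_top _)
  · have h := key v hv w hw a b ha hb hab
    have hlt := lt_of_le_of_lt h (EReal.coe_lt_top _)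
    rw [← coe_toReal_conj hlt, EReal.coe_le_coe_iff] at h
    simpa using h

/-- If `‖v‖ > K`, then along the ray `t • v` the linear term outgrows the Lipschitz function `f`, so
the conjugate is infinite at `v`. The closed ball then also contains the closure of the domain. -/
theorem norm_le_of_mem_dualSet (hK : 0 ≤ K) (hf : ∀ u v, |f u - f v| ≤ K * ‖u - v‖) {v : Vec m}
    (hv : v ∈ dualSet f) : ‖v‖ ≤ K := by
  have hsub : {v | conj f v < ⊤} ⊆ Metric.closedBall 0 K := by
    intro v hv
    rw [mem_closedBall_zero_iff]
    by_contra! hlt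
    set c := (conj f v).toReal
    have h1 : ∀ t : ℝ, 0 ≤ t → t * (‖v‖ * (‖v‖ - K)) ≤ c + f 0 := by
      intro t ht
      have h2 := fenchel_young hv (t • v)
      have h3 := (abs_le.1 (hf (t • v) 0)).2
      rw [sub_zero, norm_smul, Real.norm_of_nonneg ht] at h3
      rw [inner_smul_right, real_inner_self_eq_norm_sq] at h2
      nlinarith
    have h0 : 0 < ‖v‖ := lt_of_le_of_lt hK hlt
    have hp : 0 < ‖v‖ * (‖v‖ - K) := mul_pos h0 (by linarith)
    have h4 := h1 ((|c + f 0| + 1) / (‖v‖ * (‖v‖ - K))) (by positivity)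
    rw [div_mul_cancel₀ _ hp.ne'] at h4
    linarith [le_abs_self (c + f 0)]
  exact mem_closedBall_zero_iff.1 (closure_minimal hsub Metric.isClosed_closedBall hv)

/-- Along `-t e_k` a monotone `f` stays below `f 0`, while `⟪v, -t e_k⟫ = -t v k` tends to infinity
when `v k < 0`. This sign is what makes `⟪v, g_i x⟫` convex in `x`. -/
theorem nonneg_of_mem_dualSet (hf : ∀ u v : Vec m, (∀ k, u k ≤ v k) → f u ≤ f v) {v : Vec m}
    (hv : v ∈ dualSet f) (k : Fin m) : 0 ≤ v k := by
  have hcl : IsClosed {v : Vec m | 0 ≤ v k} := by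
    have : Continuous fun v : Vec m => v k := by fun_prop
    exact isClosed_le continuous_const this
  refine closure_minimal (fun v hv => ?_) hcl hv
  by_contra! hlt
  replace hlt : v k < 0 := by simpa using hlt
  set c := (conj f v).toReal
  have h1 : ∀ t : ℝ, 0 ≤ t → t * (-v k) ≤ c + f 0 := by
    intro t ht
    have h2 := fenchel_young hv (-(t • EuclideanSpace.single k (1 : ℝ)))
    have h3 := hf (-(t • EuclideanSpace.single k (1 : ℝ))) 0 (fun j => by
      by_cases hj : j = k <;> simp [hj, ht])
    rw [inner_neg_right, inner_smul_right, EuclideanSpace.inner_single_right] at h2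
    simp at h2
    linarith
  have h4 := h1 ((|c + f 0| + 1) / (-v k)) (by have : 0 < -v k := by linarith
                                               positivity)
  rw [div_mul_cancel₀ _ (by linarith)] at h4
  linarith [le_abs_self (c + f 0)]

theorem lowerSemicontinuous_conj (f : Vec m → ℝ) : LowerSemicontinuous (conj f) := by
  refine lowerSemicontinuous_iSup fun u => Continuous.lowerSemicontinuous ?_
  exact continuous_coe_real_ereal.comp (by fun_prop)

theorem isCompact_dualSet (hK : 0 ≤ K) (hf : ∀ u v, |f u - f v| ≤ K * ‖u - v‖) : IsCompact (dualSet f) :=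
  (isCompact_closedBall (0 : Vec m) K).of_isClosed_subset isClosed_closure
    fun _ hv => mem_closedBall_zero_iff.2 (norm_le_of_mem_dualSet hK hf hv)

theorem exists_conj_lt_top {y : Vec m} (hy : y ∈ dualSet f) : ∃ v, conj f v < ⊤ := by
  have : (closure {v | conj f v < ⊤}).Nonempty := ⟨y, hy⟩
  exact closure_nonempty_iff.1 this

theorem mem_dualSet {v : Vec m} (hv : conj f v < ⊤) : v ∈ dualSet f := subset_closure hv

/-- A maximizer of a real function minus the conjugate lies in the effective domain. -/
theorem isMaxOn_sub_conj {ℓ : Vec m → ℝ} {y₀ y : Vec m} (hy₀ : y₀ ∈ dualSet f)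
    (hy : IsMaxOn (fun v => ((ℓ v : ℝ) : EReal) - conj f v) (dualSet f) y) :
    conj f y < ⊤ ∧ ∀ v, conj f v < ⊤ → ℓ v - (conj f v).toReal ≤ ℓ y - (conj f y).toReal := by
  -- `dualSet` is a closure and may contain points where the conjugate is infinite. There the
  -- objective is `⊥`, which loses against any point of the effective domain.
  have hlt : conj f y < ⊤ := by
    obtain ⟨v, hv⟩ := exists_conj_lt_top hy₀
    have h := hy (mem_dualSet hv)
    simp only [Set.mem_ofPred_eq] at h
    by_contra hcon
    rw [not_lt_top_iff.1 hcon, EReal.sub_top, ← coe_toReal_conj hv, ← EReal.coe_sub] at h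
    exact EReal.coe_ne_bot _ (le_bot_iff.1 h)
  refine ⟨hlt, fun v hv => ?_⟩
  have h := hy (mem_dualSet hv)
  simp only [Set.mem_ofPred_eq] at h
  rwa [← coe_toReal_conj hv, ← coe_toReal_conj hlt, ← EReal.coe_sub, ← EReal.coe_sub,
    EReal.coe_le_coe_iff] at h

/-- The negative of the objective is lower semicontinuous, and `dualSet f` is compact. -/
theorem exists_isMaxOn_sub_conj (hK : 0 ≤ K) (hf : ∀ u v, |f u - f v| ≤ K * ‖u - v‖) {y₀ : Vec m}
    (hy₀ : y₀ ∈ dualSet f) {ℓ : Vec m → ℝ} (hℓ : Continuous ℓ) :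
    ∃ y, IsMaxOn (fun v => ((ℓ v : ℝ) : EReal) - conj f v) (dualSet f) y := by
  have hl : LowerSemicontinuous fun v => conj f v + ((-ℓ v : ℝ) : EReal) := by
    refine (lowerSemicontinuous_conj f).add'
      (continuous_coe_real_ereal.comp hℓ.neg).lowerSemicontinuous fun v => ?_
    exact EReal.continuousAt_add (Or.inr (EReal.coe_ne_bot _)) (Or.inr (EReal.coe_ne_top _))
  have heq : ∀ v, ((ℓ v : ℝ) : EReal) - conj f v = -(conj f v + ((-ℓ v : ℝ) : EReal)) := by
    intro v
    rw [EReal.neg_add (Or.inr (EReal.coe_ne_top _)) (Or.inr (EReal.coe_ne_bot _)),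
      EReal.coe_neg, sub_eq_add_neg, sub_eq_add_neg, neg_neg, add_comm]
  obtain ⟨y, -, hy⟩ := (hl.lowerSemicontinuousOn (dualSet f)).exists_isMinOn ⟨y₀, hy₀⟩
    (isCompact_dualSet hK hf)
  refine ⟨y, fun v hv => ?_⟩
  simp only [Set.mem_ofPred_eq, heq]
  exact EReal.neg_le_neg_iff.2 (hy hv)

/-- The biconjugation identity at a maximizer. -/
theorem le_inner_sub_conj_of_isMaxOn (hfc : ConvexOn ℝ Set.univ f)
    (hf : ∀ u v, |f u - f v| ≤ K * ‖u - v‖) {u y : Vec m}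
    (hy : ∀ v, conj f v < ⊤ → ⟪v, u⟫ - (conj f v).toReal ≤ ⟪y, u⟫ - (conj f y).toReal) :
    f u ≤ ⟪y, u⟫ - (conj f y).toReal := by
  have hcont : Continuous f := by
    refine LipschitzWith.continuous (K := K.toNNReal) (LipschitzWith.of_dist_le_mul fun u v => ?_)
    rw [Real.dist_eq, dist_eq_norm]
    exact (hf u v).trans (mul_le_mul_of_nonneg_right (Real.le_coe_toNNReal K) (norm_nonneg _))
  refine le_of_forall_lt fun a ha => ?_
  obtain ⟨b, hab, hb⟩ := exists_between ha
  -- For `b < f u` there is an affine minorant `⟪v, ·⟫ + c` of `f` with value `b` at `u`. Its slope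
  -- has `conj f v ≤ -c`, hence competes in `hy` and contributes at least `b`.
  obtain ⟨l, c, hle, heq⟩ := hfc.exists_affine_le_of_lt (𝕜 := ℝ) (Set.mem_univ u) hb isClosed_univ
    (hcont.lowerSemicontinuous.lowerSemicontinuousOn _)
  obtain ⟨v, rfl⟩ := (InnerProductSpace.toDual ℝ (Vec m)).surjective l
  have hle' : ∀ w, ⟪v, w⟫ + c ≤ f w := fun w => by simpa using hle ⟨w, Set.mem_univ w⟩
  have heq' : ⟪v, u⟫ + c = b := by simpa using heq
  have hcv : conj f v ≤ ((-c : ℝ) : EReal) := by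
    refine iSup_le fun w => ?_
    rw [EReal.coe_le_coe_iff]
    linarith [hle' w]
  have hv := lt_of_le_of_lt hcv (EReal.coe_lt_top _)
  rw [← coe_toReal_conj hv, EReal.coe_le_coe_iff] at hcv
  linarith [hy v hv]

end Conj

end ALEXR

namespace ALEXR

/-! ### Comparison of the dual norm with the Euclidean norm -/

section Norms

variable {d m : ℕ} {q : Seminorm ℝ (Vec m)} {μψ Lψ : ℝ}

theorem norm_le_sqrt_of_seminorm_le_one (hL : 0 ≤ Lψ) (hq : ∀ v, ‖v‖ ^ 2 ≤ Lψ * q v ^ 2) {v : Vec m}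
    (hv : q v ≤ 1) : ‖v‖ ≤ √Lψ := by
  refine Real.le_sqrt_of_sq_le ((hq v).trans ?_)
  have : q v ^ 2 ≤ 1 := pow_le_one₀ (apply_nonneg q v) hv
  nlinarith

theorem inner_le_of_seminorm_le_one (hL : 0 ≤ Lψ) (hq : ∀ v, ‖v‖ ^ 2 ≤ Lψ * q v ^ 2) (u : Vec m)
    (v : {v : Vec m // q v ≤ 1}) : ⟪u, (v : Vec m)⟫ ≤ √Lψ * ‖u‖ := by
  refine (real_inner_le_norm _ _).trans ?_
  rw [mul_comm]
  exact mul_le_mul_of_nonneg_right (norm_le_sqrt_of_seminorm_le_one hL hq v.2) (norm_nonneg _)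

theorem dualNorm_le (hL : 0 ≤ Lψ) (hq : ∀ v, ‖v‖ ^ 2 ≤ Lψ * q v ^ 2) (u : Vec m) :
    dualNorm q u ≤ √Lψ * ‖u‖ := by
  have : Nonempty {v : Vec m // q v ≤ 1} := ⟨⟨0, by simp⟩⟩
  exact ciSup_le (inner_le_of_seminorm_le_one hL hq u)

/-- The multiple of `u` with Euclidean norm `√μψ` lies in the unit ball of `q`, so it is a test
vector for the supremum. The bound with `Lψ` only ensures that the real-valued supremum is over a
bounded set. -/
theorem sqrt_mul_norm_le_dualNorm (hμ : 0 < μψ) (hL : 0 ≤ Lψ)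
    (hq : ∀ v, μψ * q v ^ 2 ≤ ‖v‖ ^ 2 ∧ ‖v‖ ^ 2 ≤ Lψ * q v ^ 2) (u : Vec m) :
    √μψ * ‖u‖ ≤ dualNorm q u := by
  have hbdd : BddAbove (Set.range fun v : {v : Vec m // q v ≤ 1} => ⟪u, (v : Vec m)⟫) :=
    ⟨_, Set.forall_mem_range.2 (inner_le_of_seminorm_le_one hL (fun v => (hq v).2) u)⟩
  rcases eq_or_lt_of_le (norm_nonneg u) with h0 | h0
  · have := le_ciSup hbdd ⟨0, by simp⟩
    rw [← h0, mul_zero]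
    simpa [dualNorm] using this
  · have hmem : q ((√μψ / ‖u‖) • u) ≤ 1 := by
      rw [map_smul_eq_mul, Real.norm_of_nonneg (by positivity)]
      have h1 := (hq u).1
      have h2 : (√μψ * q u) ^ 2 ≤ ‖u‖ ^ 2 := by rwa [mul_pow, Real.sq_sqrt hμ.le]
      have h3 : √μψ * q u ≤ ‖u‖ := (sq_le_sq₀ (by positivity) h0.le).1 h2
      rw [div_mul_eq_mul_div, div_le_one h0]
      exact h3
    have := le_ciSup hbdd ⟨_, hmem⟩
    rw [inner_smul_right, real_inner_self_eq_norm_sq] at this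
    calc √μψ * ‖u‖ = √μψ / ‖u‖ * ‖u‖ ^ 2 := by field_simp
      _ ≤ _ := this

theorem sqrt_mul_norm_le_opNorm (hμ : 0 < μψ) (hL : 0 ≤ Lψ)
    (hq : ∀ v, μψ * q v ^ 2 ≤ ‖v‖ ^ 2 ∧ ‖v‖ ^ 2 ≤ Lψ * q v ^ 2) (A : Vec d →L[ℝ] Vec m) :
    √μψ * ‖A‖ ≤ opNorm q A := by
  have hbdd : BddAbove (Set.range fun x : {x : Vec d // ‖x‖ ≤ 1} => dualNorm q (A x)) := by
    refine ⟨√Lψ * ‖A‖, Set.forall_mem_range.2 fun x => ?_⟩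
    refine (dualNorm_le hL (fun v => (hq v).2) _).trans ?_
    gcongr
    exact (A.le_opNorm_of_le x.2).trans_eq (mul_one _)
  have hs : 0 < √μψ := Real.sqrt_pos.2 hμ
  have h0 : 0 ≤ opNorm q A := by
    have := le_ciSup hbdd ⟨0, by simp⟩
    refine le_trans ?_ this
    refine le_trans ?_ (sqrt_mul_norm_le_dualNorm hμ hL hq _)
    positivity
  rw [← le_div_iff₀' hs]
  refine A.opNorm_le_of_unit_norm (by positivity) fun x hx => ?_
  rw [le_div_iff₀' hs]
  exact (sqrt_mul_norm_le_dualNorm hμ hL hq _).trans (le_ciSup hbdd ⟨x, hx.le⟩)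

end Norms

/-! ### Square-integrability from a bound on the lower integral -/

section SquareIntegrable

variable {α E : Type*} {mα : MeasurableSpace α} {P : Measure α} [NormedAddCommGroup E]

theorem memLp_two_of_lintegral_sq_lt_top {f : α → E} (hf : AEStronglyMeasurable f P)
    (h : ∫⁻ a, ENNReal.ofReal (‖f a‖ ^ 2) ∂P < ⊤) : MemLp f 2 P := by
  rw [memLp_two_iff_integrable_sq_norm hf]
  refine ⟨hf.norm.pow 2, ?_⟩
  rw [hasFiniteIntegral_iff_ofReal (ae_of_all _ fun a => by positivity)]
  exact h

theorem integral_sq_le_of_lintegral_sq_le {f : α → E} (hf : AEStronglyMeasurable f P) {c : ℝ}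
    (hc : 0 ≤ c) (h : ∫⁻ a, ENNReal.ofReal (‖f a‖ ^ 2) ∂P ≤ ENNReal.ofReal c) :
    ∫ a, ‖f a‖ ^ 2 ∂P ≤ c := by
  rw [integral_eq_lintegral_of_nonneg_ae (ae_of_all _ fun a => by positivity)
    (by simpa only [Pi.pow_def] using hf.norm.pow 2)]
  exact ENNReal.toReal_le_of_le_ofReal hc h

/-- Transfers variance bounds from `q` to Euclidean norms. With lower integrals a constant can be
pulled out without knowing that the dual norm or the operator norm is measurable. -/
theorem lintegral_sq_le_of_scaled {N f : α → ℝ} {s σ : ℝ} (hs : 0 < s)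
    (hNf : ∀ a, s * f a ≤ N a) (hf : ∀ a, 0 ≤ f a)
    (h : ∫⁻ a, ENNReal.ofReal (N a ^ 2) ∂P ≤ ENNReal.ofReal (σ ^ 2)) :
    ∫⁻ a, ENNReal.ofReal (f a ^ 2) ∂P ≤ ENNReal.ofReal ((σ / s) ^ 2) := by
  calc ∫⁻ a, ENNReal.ofReal (f a ^ 2) ∂P
      ≤ ∫⁻ a, ENNReal.ofReal ((s ^ 2)⁻¹) * ENNReal.ofReal (N a ^ 2) ∂P := by
        refine lintegral_mono fun a => ?_
        rw [← ENNReal.ofReal_mul (by positivity)]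
        refine ENNReal.ofReal_le_ofReal ?_
        rw [← div_eq_inv_mul, le_div_iff₀ (by positivity)]
        calc f a ^ 2 * s ^ 2 = (s * f a) ^ 2 := by ring
          _ ≤ N a ^ 2 := by
            have := hf a
            gcongr
            exact hNf a
    _ = ENNReal.ofReal ((s ^ 2)⁻¹) * ∫⁻ a, ENNReal.ofReal (N a ^ 2) ∂P :=
        lintegral_const_mul' _ _ ENNReal.ofReal_ne_top
    _ ≤ ENNReal.ofReal ((s ^ 2)⁻¹) * ENNReal.ofReal (σ ^ 2) := by gcongr
    _ = ENNReal.ofReal ((σ / s) ^ 2) := by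
        rw [← ENNReal.ofReal_mul (by positivity)]
        congr 1
        field_simp

end SquareIntegrable

/-! ### The assumptions in Euclidean form -/

variable {n d m : ℕ} {Z : Type*} [MeasurableSpace Z]

/-- The consequences of the standing assumptions that the analysis uses, in Euclidean norms. -/
structure Problem.Regular (p : Problem n d m Z) (K G Λ s₀ s₁ δ : ℝ) : Prop where
  K_nonneg : 0 ≤ K
  G_nonneg : 0 ≤ G
  Λ_nonneg : 0 ≤ Λ
  convex_X : Convex ℝ p.X
  r_ne_bot : ∀ x ∈ p.X, p.r x ≠ ⊥
  r_proper : ∃ x ∈ p.X, p.r x ≠ ⊤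
  r_convex : ∀ x ∈ p.X, ∀ z ∈ p.X, ∀ a b : ℝ, 0 < a → 0 < b → a + b = 1 →
    p.r (a • x + b • z) ≤ (a : EReal) * p.r x + (b : EReal) * p.r z
  prob : ∀ i, IsProbabilityMeasure (p.P i)
  gs_meas : ∀ i, Measurable fun w : Vec d × Z => p.gs i w.1 w.2
  dgs_meas : ∀ i, Measurable fun w : Vec d × Z => p.dgs i w.1 w.2
  f_convex : ∀ i, ConvexOn ℝ Set.univ (p.f i)
  f_lip : ∀ i u v, |p.f i u - p.f i v| ≤ K * ‖u - v‖
  inner_convex : ∀ i, ∀ v ∈ dualSet (p.f i), ConvexOn ℝ p.X fun x => ⟪v, p.g i x⟫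
  g_lip : ∀ i, ∀ x ∈ p.X, ∀ z ∈ p.X, ‖p.g i x - p.g i z‖ ≤ G * ‖x - z‖
  g_smooth : ∀ i, ∀ x ∈ p.X, ∀ z ∈ p.X,
    ‖p.g i x - p.g i z - p.dg i z (x - z)‖ ≤ Λ / 2 * ‖x - z‖ ^ 2
  gs_memLp : ∀ i, ∀ x ∈ p.X, MemLp (fun ζ => p.gs i x ζ) 2 (p.P i)
  gs_var : ∀ i, ∀ x ∈ p.X, ∫ ζ, ‖p.g i x - p.gs i x ζ‖ ^ 2 ∂(p.P i) ≤ s₀ ^ 2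
  dgs_memLp : ∀ i, ∀ x ∈ p.X, MemLp (fun ζ => p.dgs i x ζ) 2 (p.P i)
  dgs_unbiased : ∀ i, ∀ x ∈ p.X, ∫ ζ, p.dgs i x ζ ∂(p.P i) = p.dg i x
  dgs_var : ∀ i, ∀ x ∈ p.X, ∫ ζ, ‖p.dg i x - p.dgs i x ζ‖ ^ 2 ∂(p.P i) ≤ s₁ ^ 2
  var_block : ∀ x ∈ p.X, ∀ y : Fin n → Vec m, (∀ i, y i ∈ dualSet (p.f i)) →
    (1 / (n : ℝ)) * ∑ j, ‖(p.dg j x).adjoint (y j)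
      - (1 / (n : ℝ)) • ∑ i, (p.dg i x).adjoint (y i)‖ ^ 2 ≤ δ ^ 2

instance instSecondCountableCLM (d m : ℕ) : SecondCountableTopology (Vec d →L[ℝ] Vec m) :=
  haveI : ProperSpace (Vec d →L[ℝ] Vec m) := FiniteDimensional.proper ℝ _
  inferInstance

theorem inner_eq_sum (u v : Vec m) : ⟪u, v⟫ = ∑ k, u k * v k := by
  rw [PiLp.inner_apply]
  exact Finset.sum_congr rfl fun k _ => by simp [mul_comm]

/-- From here on everything is Euclidean: quantities bounded in the dual norm are divided by `√μψ`,
while the Lipschitz constant of `f_i`, which has the dual norm on its right-hand side, is multiplied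
by `√Lψ`. -/
theorem Problem.Assumptions.regular {p : Problem n d m Z} {q : Seminorm ℝ (Vec m)}
    {Cf Cg Lg σ₀ σ₁ δ μψ Lψ : ℝ} (hCf : 0 ≤ Cf) (hCg : 0 ≤ Cg) (hLg : 0 ≤ Lg) (hμ : 0 < μψ)
    (hL : 0 ≤ Lψ) (hq : ∀ v, μψ * q v ^ 2 ≤ ‖v‖ ^ 2 ∧ ‖v‖ ^ 2 ≤ Lψ * q v ^ 2)
    (h : p.Assumptions q Cf Cg Lg σ₀ σ₁ δ) :
    p.Regular (Cf * √Lψ) (Cg / √μψ) (Lg / √μψ) (σ₀ / √μψ) (σ₁ / √μψ) δ := by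
  have hs : 0 < √μψ := Real.sqrt_pos.2 hμ
  have hdual := sqrt_mul_norm_le_dualNorm hμ hL hq
  have hop := sqrt_mul_norm_le_opNorm (d := d) hμ hL hq
  have hprob := h.prob
  have hgsm : ∀ i x, AEStronglyMeasurable (fun ζ => p.gs i x ζ) (p.P i) := fun i x =>
    ((h.gs_meas i).comp measurable_prodMk_left).aestronglyMeasurable
  have hdgsm : ∀ i x, AEStronglyMeasurable (fun ζ => p.dgs i x ζ) (p.P i) := fun i x =>
    ((h.dgs_meas i).comp measurable_prodMk_left).aestronglyMeasurable
  have hv0 : ∀ i, ∀ x ∈ p.X, ∫⁻ ζ, ENNReal.ofReal (‖p.g i x - p.gs i x ζ‖ ^ 2) ∂(p.P i)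
      ≤ ENNReal.ofReal ((σ₀ / √μψ) ^ 2) := fun i x hx =>
    lintegral_sq_le_of_scaled hs (fun ζ => hdual _) (fun ζ => norm_nonneg _) (h.var_zero i x hx)
  have hv1 : ∀ i, ∀ x ∈ p.X, ∫⁻ ζ, ENNReal.ofReal (‖p.dg i x - p.dgs i x ζ‖ ^ 2) ∂(p.P i)
      ≤ ENNReal.ofReal ((σ₁ / √μψ) ^ 2) := fun i x hx =>
    lintegral_sq_le_of_scaled hs (fun ζ => hop _) (fun ζ => norm_nonneg _) (h.var_one i x hx)
  exact
  { K_nonneg := by positivity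
    G_nonneg := by positivity
    Λ_nonneg := by positivity
    convex_X := h.convex_X
    r_ne_bot := h.r_ne_bot
    r_proper := h.r_proper
    r_convex := h.r_convex
    prob := h.prob
    gs_meas := h.gs_meas
    dgs_meas := h.dgs_meas
    f_convex := h.f_convex
    f_lip := fun i u v => by
      refine (h.f_lip i u v).trans ?_
      rw [mul_assoc]
      exact mul_le_mul_of_nonneg_left (dualNorm_le hL (fun v => (hq v).2) _) hCf
    inner_convex := fun i v hv => by
      -- For monotone `f_i`, `v` has nonnegative coordinates and weights convex components;
      -- otherwise `g_i` is affine on `X` and equality holds for every `v`.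
      rcases h.f_mono i with hm | ⟨A, hA⟩
      · refine ⟨h.convex_X, fun x hx z hz a b ha hb hab => ?_⟩
        simp only [inner_eq_sum, smul_eq_mul]
        rw [Finset.mul_sum, Finset.mul_sum, ← Finset.sum_add_distrib]
        refine Finset.sum_le_sum fun k _ => ?_
        have h1 := (h.g_convex i k).2 hx hz ha hb hab
        simp only [smul_eq_mul] at h1
        have h2 := mul_le_mul_of_nonneg_left h1 (nonneg_of_mem_dualSet hm hv k)
        linarith
      · refine ⟨h.convex_X, fun x hx z hz a b ha hb hab => le_of_eq ?_⟩
        simp only [hA hx, hA hz, hA (h.convex_X hx hz ha hb hab),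
          Convex.combo_affine_apply hab, inner_add_right, inner_smul_right, smul_eq_mul]
    g_lip := fun i x hx z hz => by
      have := (hdual _).trans (h.g_lip i x hx z hz)
      rw [div_mul_eq_mul_div, le_div_iff₀' hs]
      exact this
    g_smooth := fun i x hx z hz => by
      have := (hdual _).trans (h.g_smooth i x hx z hz)
      rw [show Lg / √μψ / 2 * ‖x - z‖ ^ 2 = (Lg / 2 * ‖x - z‖ ^ 2) / √μψ by ring,
        le_div_iff₀' hs]
      exact this
    gs_memLp := fun i x hx => by
      have h1 : MemLp (fun ζ => p.g i x - p.gs i x ζ) 2 (p.P i) :=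
        memLp_two_of_lintegral_sq_lt_top (aestronglyMeasurable_const.sub (hgsm i x))
          ((hv0 i x hx).trans_lt ENNReal.ofReal_lt_top)
      have h2 := (memLp_const (p := 2) (μ := p.P i) (p.g i x)).sub h1
      refine h2.congr_norm (hgsm i x) (ae_of_all _ fun ζ => ?_)
      simp
    gs_var := fun i x hx => integral_sq_le_of_lintegral_sq_le
      (aestronglyMeasurable_const.sub (hgsm i x)) (by positivity) (hv0 i x hx)
    dgs_memLp := fun i x hx => by
      have h1 : MemLp (fun ζ => p.dg i x - p.dgs i x ζ) 2 (p.P i) :=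
        memLp_two_of_lintegral_sq_lt_top (aestronglyMeasurable_const.sub (hdgsm i x))
          ((hv1 i x hx).trans_lt ENNReal.ofReal_lt_top)
      have h2 := (memLp_const (p := 2) (μ := p.P i) (p.dg i x)).sub h1
      refine h2.congr_norm (hdgsm i x) (ae_of_all _ fun ζ => ?_)
      simp
    dgs_unbiased := h.dgs_unbiased
    dgs_var := fun i x hx => integral_sq_le_of_lintegral_sq_le
      (aestronglyMeasurable_const.sub (hdgsm i x)) (by positivity) (hv1 i x hx)
    var_block := h.var_block }

/-! ### Directional derivatives of the inner functions on the feasible set -/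

section Gradient

variable {p : Problem n d m Z} {K G Λ s₀ s₁ δ : ℝ}

theorem Problem.Regular.norm_le (h : p.Regular K G Λ s₀ s₁ δ) {i : Fin n} {v : Vec m}
    (hv : v ∈ dualSet (p.f i)) : ‖v‖ ≤ K :=
  norm_le_of_mem_dualSet h.K_nonneg (h.f_lip i) hv

/-- Quadratic smoothness along a feasible segment takes the place of differentiation: after division
by `s` the remainder is linear in `s`. -/
theorem Problem.Regular.smooth_segment (h : p.Regular K G Λ s₀ s₁ δ) (i : Fin n) {x z : Vec d}
    (hx : x ∈ p.X) (hz : z ∈ p.X) {s : ℝ} (hs0 : 0 < s) (hs1 : s < 1) :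
    x + s • (z - x) ∈ p.X ∧
    ‖p.g i (x + s • (z - x)) - p.g i x - s • p.dg i x (z - x)‖
      ≤ s ^ 2 * (Λ / 2 * ‖z - x‖ ^ 2) := by
  have hmem : x + s • (z - x) ∈ p.X := h.convex_X.add_smul_sub_mem hx hz ⟨hs0.le, hs1.le⟩
  refine ⟨hmem, ?_⟩
  have := h.g_smooth i _ hmem x hx
  rw [add_sub_cancel_left, map_smul, norm_smul, mul_pow, Real.norm_eq_abs, sq_abs] at this
  linarith

theorem Problem.Regular.inner_dg_le (h : p.Regular K G Λ s₀ s₁ δ) {i : Fin n} {x z : Vec d}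
    (hx : x ∈ p.X) (hz : z ∈ p.X) {v : Vec m} (hv : v ∈ dualSet (p.f i)) :
    ⟪v, p.dg i x (z - x)⟫ ≤ ⟪v, p.g i z⟫ - ⟪v, p.g i x⟫ := by
  rw [← sub_nonneg]
  refine nonneg_of_forall_add_mul (b := ‖v‖ * (Λ / 2 * ‖z - x‖ ^ 2)) fun s hs0 hs1 => ?_
  obtain ⟨hmem, hsm⟩ := h.smooth_segment i hx hz hs0 hs1
  have hc := (h.inner_convex i v hv).2 hx hz (sub_nonneg.2 hs1.le) hs0.le (by ring)
  rw [show (1 - s) • x + s • z = x + s • (z - x) by module] at hc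
  simp only [smul_eq_mul] at hc
  have h1 : -⟪v, p.g i (x + s • (z - x)) - p.g i x - s • p.dg i x (z - x)⟫
      ≤ ‖v‖ * (s ^ 2 * (Λ / 2 * ‖z - x‖ ^ 2)) := by
    rw [← inner_neg_right]
    refine (real_inner_le_norm _ _).trans ?_
    rw [norm_neg]
    gcongr
  rw [inner_sub_right, inner_sub_right, inner_smul_right] at h1
  refine nonneg_of_mul_nonneg_right ?_ hs0
  nlinarith

/-- The derivative is controlled in feasible directions only, since `X` may have empty interior and
the Lipschitz bound says nothing about other directions. -/
theorem Problem.Regular.norm_dg_le (h : p.Regular K G Λ s₀ s₁ δ) (i : Fin n) {x z : Vec d}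
    (hx : x ∈ p.X) (hz : z ∈ p.X) : ‖p.dg i x (z - x)‖ ≤ G * ‖z - x‖ := by
  rw [← sub_nonneg]
  refine nonneg_of_forall_add_mul (b := Λ / 2 * ‖z - x‖ ^ 2) fun s hs0 hs1 => ?_
  obtain ⟨hmem, hsm⟩ := h.smooth_segment i hx hz hs0 hs1
  have h1 := h.g_lip i _ hmem x hx
  rw [add_sub_cancel_left, norm_smul, Real.norm_of_nonneg hs0.le] at h1
  have h2 := norm_sub_le_norm_sub_add_norm_sub
    (s • p.dg i x (z - x)) (p.g i (x + s • (z - x)) - p.g i x) 0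
  rw [sub_zero, sub_zero, norm_smul, Real.norm_of_nonneg hs0.le, norm_sub_rev] at h2
  refine nonneg_of_mul_nonneg_right ?_ hs0
  nlinarith

end Gradient

end ALEXR

namespace ALEXR

/-! ### Inequalities for one block of dual iterates -/

section Block

variable {E : Type*} [NormedAddCommGroup E] [InnerProductSpace ℝ E]

theorem inner_le_weighted {a : ℝ} (ha : 0 < a) (u v : E) :
    ⟪u, v⟫ ≤ a / 2 * ‖u‖ ^ 2 + 1 / (2 * a) * ‖v‖ ^ 2 := by
  refine (real_inner_le_norm u v).trans ?_
  rw [← sub_nonneg]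
  have : a / 2 * ‖u‖ ^ 2 + 1 / (2 * a) * ‖v‖ ^ 2 - ‖u‖ * ‖v‖
      = 1 / (2 * a) * (a * ‖u‖ - ‖v‖) ^ 2 := by
    field_simp
    ring
  rw [this]
  positivity

variable {τ : ℝ} {y z Δ e : ℕ → E}

/-- Summation by parts for the extrapolated coupling term. -/
theorem coupling_sum_le (hτ : 0 < τ) (hΔ : Δ 0 = 0)
    (hy : ∀ t, y (t + 1) = z t ∨ y (t + 1) = y t) (w : E) (T : ℕ) :
    ∑ t ∈ Finset.range (T + 1), ⟪w - z t, Δ (t + 1) - Δ t⟫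
      ≤ ⟪w - z T, Δ (T + 1)⟫ + τ / 4 * ∑ t ∈ Finset.range (T + 1), ‖z t - y t‖ ^ 2
        + 4 / τ * ∑ t ∈ Finset.range (T + 1), ‖Δ t‖ ^ 2 := by
  -- Each `‖z t - y t‖²` is charged once when `z t` is reached and once when it is left, each time
  -- with weight `τ / 8`. The last one has not been left yet, hence the shorter second sum.
  have key : ∑ t ∈ Finset.range (T + 1), ⟪w - z t, Δ (t + 1) - Δ t⟫
      ≤ ⟪w - z T, Δ (T + 1)⟫ + τ / 8 * (∑ t ∈ Finset.range (T + 1), ‖z t - y t‖ ^ 2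
        + ∑ t ∈ Finset.range T, ‖z t - y t‖ ^ 2)
        + 4 / τ * ∑ t ∈ Finset.range (T + 1), ‖Δ t‖ ^ 2 := by
    induction T with
    | zero =>
      have : 0 ≤ τ / 8 * ‖z 0 - y 0‖ ^ 2 := by positivity
      simp only [zero_add, Finset.sum_range_one, Finset.range_zero, Finset.sum_empty, hΔ, sub_zero,
        norm_zero]
      linarith
    | succ T ih =>
      rw [Finset.sum_range_succ, Finset.sum_range_succ (fun t => ‖Δ t‖ ^ 2),
        Finset.sum_range_succ (fun t => ‖z t - y t‖ ^ 2) (T + 1),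
        Finset.sum_range_succ (fun t => ‖z t - y t‖ ^ 2) T]
      rw [Finset.sum_range_succ (fun t => ‖z t - y t‖ ^ 2) T] at ih
      -- After a sampled update this difference is zero, otherwise it is `y T - z T`. This lets `z
      -- (T + 1) - z T` be controlled through `y (T + 1)`.
      have h1 : ‖y (T + 1) - z T‖ ^ 2 ≤ ‖z T - y T‖ ^ 2 := by
        rcases hy T with h | h
        · rw [h, sub_self, norm_zero, zero_pow two_ne_zero]; positivity
        · rw [h, norm_sub_rev]
      have h2 := inner_le_weighted (a := τ / 4) (by positivity) (z (T + 1) - y (T + 1)) (Δ (T + 1))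
      have h3 := inner_le_weighted (a := τ / 4) (by positivity) (y (T + 1) - z T) (Δ (T + 1))
      have h4 : 1 / (2 * (τ / 4)) = 2 / τ := by field_simp; norm_num
      rw [h4] at h2 h3
      have h5 : ⟪w - z (T + 1), Δ (T + 1 + 1) - Δ (T + 1)⟫ + ⟪w - z T, Δ (T + 1)⟫
          = ⟪w - z (T + 1), Δ (T + 1 + 1)⟫ + ⟪z (T + 1) - y (T + 1), Δ (T + 1)⟫
            + ⟪y (T + 1) - z T, Δ (T + 1)⟫ := by
        simp only [inner_sub_left, inner_sub_right]
        ring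
      have h6 : 4 / τ = 2 / τ + 2 / τ := by ring
      have h7 : τ / 4 / 2 * ‖y (T + 1) - z T‖ ^ 2 ≤ τ / 4 / 2 * ‖z T - y T‖ ^ 2 := by gcongr
      rw [h6] at ih ⊢
      linarith
  refine key.trans ?_
  have : ∑ t ∈ Finset.range T, ‖z t - y t‖ ^ 2 ≤ ∑ t ∈ Finset.range (T + 1), ‖z t - y t‖ ^ 2 := by
    rw [Finset.sum_range_succ]
    linarith [sq_nonneg ‖z T - y T‖]
  nlinarith

/-- The noise in the dual step, for a comparison point that may depend on the noise. -/
theorem noise_sum_le (hτ : 0 < τ) (w : E) (T : ℕ) :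
    ∑ t ∈ Finset.range T, ⟪w - z t, e t⟫
      ≤ τ / 2 * ‖w - y 0‖ ^ 2 + 1 / (2 * τ) * ‖∑ t ∈ Finset.range T, e t‖ ^ 2
        + ∑ t ∈ Finset.range T, ⟪y 0 - y t, e t⟫ + τ / 8 * ∑ t ∈ Finset.range T, ‖z t - y t‖ ^ 2
        + 2 / τ * ∑ t ∈ Finset.range T, ‖e t‖ ^ 2 := by
  -- Since `w` may depend on all the noise, `w - z t` is split as `(w - y 0) + (y 0 - y t) + (y t -
  -- z t)`. Only the first part contains `w`, and it does not vary with `t`, so it pairs with the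
  -- total noise. The second part precedes the noise, the third goes into Young's inequality.
  have h1 := inner_le_weighted hτ (w - y 0) (∑ t ∈ Finset.range T, e t)
  rw [inner_sum] at h1
  have h2 : ∀ t ∈ Finset.range T, ⟪w - z t, e t⟫ ≤ ⟪w - y 0, e t⟫ + ⟪y 0 - y t, e t⟫
      + (τ / 8 * ‖z t - y t‖ ^ 2 + 2 / τ * ‖e t‖ ^ 2) := by
    intro t _
    have h3 := inner_le_weighted (a := τ / 4) (by positivity) (y t - z t) (e t)
    rw [show 1 / (2 * (τ / 4)) = 2 / τ by field_simp; norm_num, norm_sub_rev] at h3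
    have h4 : ⟪w - z t, e t⟫ = ⟪w - y 0, e t⟫ + ⟪y 0 - y t, e t⟫ + ⟪y t - z t, e t⟫ := by
      simp only [inner_sub_left]
      ring
    linarith
  have h3 := Finset.sum_le_sum h2
  simp only [Finset.sum_add_distrib, ← Finset.mul_sum] at h3
  linarith

/-- Telescoping of the distances under randomized block updates. The numbers `c t` are the
deviations of the sampling weights from their mean. -/
theorem distance_sum_le (hτ : 0 < τ) {a b : ℝ} (hb : 0 < b) {c : ℕ → ℝ}
    (hy : ∀ t, (y (t + 1) = z t ∧ c t = a - b) ∨ (y (t + 1) = y t ∧ c t = a)) (w : E) (T : ℕ) :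
    a * ∑ t ∈ Finset.range T, τ / 2 * (‖w - y t‖ ^ 2 - ‖w - z t‖ ^ 2)
      ≤ 5 / 2 * τ * b * ‖w - y 0‖ ^ 2
        + τ / 2 * ∑ t ∈ Finset.range T, c t * (‖y t - y 0‖ ^ 2 - ‖z t - y 0‖ ^ 2)
        + τ / (8 * b) * ‖∑ t ∈ Finset.range T, c t • (z t - y t)‖ ^ 2 := by
  -- Write `a` as `c t` plus `b` on the steps where the block is sampled. The `b` part telescopes.
  -- In the `c t` part, expanding around `y 0` cancels `‖w - y 0‖²`, so `w` enters only linearly.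
  have key : a * ∑ t ∈ Finset.range T, τ / 2 * (‖w - y t‖ ^ 2 - ‖w - z t‖ ^ 2)
      = τ / 2 * b * (‖w - y 0‖ ^ 2 - ‖w - y T‖ ^ 2)
        + τ * ∑ t ∈ Finset.range T, ⟪w - y 0, c t • (z t - y t)⟫
        + τ / 2 * ∑ t ∈ Finset.range T, c t * (‖y t - y 0‖ ^ 2 - ‖z t - y 0‖ ^ 2) := by
    induction T with
    | zero => simp
    | succ T ih =>
      rw [Finset.sum_range_succ, mul_add, ih, Finset.sum_range_succ, Finset.sum_range_succ]
      have e1 : ∀ v : E, ‖w - v‖ ^ 2 = ‖w - y 0‖ ^ 2 - 2 * ⟪w - y 0, v - y 0⟫ + ‖v - y 0‖ ^ 2 := by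
        intro v
        rw [← norm_sub_sq_real]
        congr 2
        abel
      have e2 : ⟪w - y 0, z T - y T⟫ = ⟪w - y 0, z T - y 0⟫ - ⟪w - y 0, y T - y 0⟫ := by
        rw [← inner_sub_right]
        congr 1
        abel
      rw [inner_smul_right, e2, e1 (y T), e1 (z T), e1 (y (T + 1))]
      rcases hy T with ⟨h, hc⟩ | ⟨h, hc⟩ <;> rw [h, hc] <;> ring
  -- The weight `4 * b` costs `2 τ b ‖w - y 0‖²`, which with the telescoped `τ b / 2` gives the
  -- factor `5 / 2`. The counterpart `τ / (8 b)` fits the variance of `c`.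
  have h1 := inner_le_weighted (a := 4 * b) (by positivity) (w - y 0)
    (∑ t ∈ Finset.range T, c t • (z t - y t))
  rw [inner_sum] at h1
  rw [key]
  have h2 : 0 ≤ τ / 2 * b * ‖w - y T‖ ^ 2 := by positivity
  have h3 := mul_le_mul_of_nonneg_left h1 hτ.le
  have h4 : τ * (1 / (2 * (4 * b)) * ‖∑ t ∈ Finset.range T, c t • (z t - y t)‖ ^ 2)
      = τ / (8 * b) * ‖∑ t ∈ Finset.range T, c t • (z t - y t)‖ ^ 2 := by
    field_simp
    ring
  linarith

/-- The accumulated error of the dual steps of one block. -/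
theorem block_sum_le (hτ : 0 < τ) {a b : ℝ} (ha : 0 ≤ a) (hab : a ≤ b) (hb : 0 < b) {c : ℕ → ℝ}
    (hΔ : Δ 0 = 0)
    (hy : ∀ t, (y (t + 1) = z t ∧ c t = a - b) ∨ (y (t + 1) = y t ∧ c t = a)) (w : E) (T : ℕ) :
    a * ∑ t ∈ Finset.range (T + 1), (⟪w - z t, Δ (t + 1) - Δ t + e t⟫
        + τ / 2 * (‖w - y t‖ ^ 2 - ‖w - z t‖ ^ 2 - ‖z t - y t‖ ^ 2))
      ≤ a * ⟪w - z T, Δ (T + 1)⟫ + a * (4 / τ * ∑ t ∈ Finset.range (T + 1), ‖Δ t‖ ^ 2)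
        + 3 * τ * b * ‖w - y 0‖ ^ 2
        + (a * ∑ t ∈ Finset.range (T + 1), ⟪y 0 - y t, e t⟫
          + τ / 2 * ∑ t ∈ Finset.range (T + 1), c t * (‖y t - y 0‖ ^ 2 - ‖z t - y 0‖ ^ 2))
        + (a * (1 / (2 * τ) * ‖∑ t ∈ Finset.range (T + 1), e t‖ ^ 2)
          + a * (2 / τ * ∑ t ∈ Finset.range (T + 1), ‖e t‖ ^ 2)
          + (τ / (8 * b) * ‖∑ t ∈ Finset.range (T + 1), c t • (z t - y t)‖ ^ 2
            - a * (τ / 8 * ∑ t ∈ Finset.range (T + 1), ‖z t - y t‖ ^ 2))) := by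
  -- Budget for `-τ/2 ‖z t - y t‖²`: the coupling takes `τ/4`, the noise `τ/8`, and the last `τ/8`
  -- is kept against the sampling deviations.
  have h1 := mul_le_mul_of_nonneg_left
    (coupling_sum_le hτ hΔ (fun t => (hy t).imp And.left And.left) w T) ha
  have h2 := mul_le_mul_of_nonneg_left (noise_sum_le (y := y) (z := z) (e := e) hτ w (T + 1)) ha
  have h3 := distance_sum_le hτ hb hy w (T + 1)
  have h4 : a * (τ / 2 * ‖w - y 0‖ ^ 2) ≤ b * (τ / 2 * ‖w - y 0‖ ^ 2) := by gcongr
  have h5 : ∑ t ∈ Finset.range (T + 1), (⟪w - z t, Δ (t + 1) - Δ t + e t⟫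
        + τ / 2 * (‖w - y t‖ ^ 2 - ‖w - z t‖ ^ 2 - ‖z t - y t‖ ^ 2))
      = ∑ t ∈ Finset.range (T + 1), ⟪w - z t, Δ (t + 1) - Δ t⟫
        + ∑ t ∈ Finset.range (T + 1), ⟪w - z t, e t⟫
        + ∑ t ∈ Finset.range (T + 1), τ / 2 * (‖w - y t‖ ^ 2 - ‖w - z t‖ ^ 2)
        - τ / 2 * ∑ t ∈ Finset.range (T + 1), ‖z t - y t‖ ^ 2 := by
    rw [Finset.mul_sum, ← Finset.sum_add_distrib, ← Finset.sum_add_distrib,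
      ← Finset.sum_sub_distrib]
    refine Finset.sum_congr rfl fun t _ => ?_
    rw [inner_add_right]
    ring
  rw [h5]
  linarith

end Block

end ALEXR

namespace ALEXR

variable {n d m : ℕ} {Z : Type*} [MeasurableSpace Z]

/-! ### Dual and primal steps -/

/-- `z` is the result of the dual step of block `i` from `y₀` with the estimate `u` of the inner
function, characterized by the three-point inequality. -/
def Problem.IsDualStep (p : Problem n d m Z) (τ : ℝ) (i : Fin n) (y₀ u z : Vec m) : Prop :=
  conj (p.f i) z < ⊤ ∧ ∀ v, conj (p.f i) v < ⊤ →
    (conj (p.f i) z).toReal + ⟪-u, z⟫ + τ / 2 * ‖z - y₀‖ ^ 2 + τ / 2 * ‖v - z‖ ^ 2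
      ≤ (conj (p.f i) v).toReal + ⟪-u, v⟫ + τ / 2 * ‖v - y₀‖ ^ 2

/-- `z` is the result of the primal step from `x₀` with the gradient estimate `c`, characterized by
the three-point inequality. -/
def Problem.IsPrimalStep (p : Problem n d m Z) (η : ℝ) (x₀ c z : Vec d) : Prop :=
  (z ∈ p.X ∧ p.r z < ⊤) ∧ ∀ v, v ∈ p.X ∧ p.r v < ⊤ →
    (p.r z).toReal + ⟪c, z⟫ + η / 2 * ‖z - x₀‖ ^ 2 + η / 2 * ‖v - z‖ ^ 2
      ≤ (p.r v).toReal + ⟪c, v⟫ + η / 2 * ‖v - x₀‖ ^ 2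

variable {p : Problem n d m Z} {K G Λ s₀ s₁ δ : ℝ} {τ η : ℝ}

theorem isDualStep_of_isMaxOn {i : Fin n} {w y₀ u z : Vec m} (hw : w ∈ dualSet (p.f i))
    (hz : IsMaxOn (fun v : Vec m => ((⟪v, u⟫ - τ * bregman quad v y₀ : ℝ) : EReal) - conj (p.f i) v)
      (dualSet (p.f i)) z) : p.IsDualStep τ i y₀ u z := by
  obtain ⟨h1, h2⟩ := isMaxOn_sub_conj (ℓ := fun v => ⟪v, u⟫ - τ * bregman quad v y₀) hw hz
  refine ⟨h1, fun v hv => prox_three_point (convexOn_toReal_conj _) h1 (fun v hv => ?_) hv⟩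
  have := h2 v hv
  rw [bregman_quad, bregman_quad] at this
  rw [inner_neg_left, inner_neg_left, real_inner_comm z u, real_inner_comm v u]
  linarith

theorem Problem.Regular.exists_isDualStep (h : p.Regular K G Λ s₀ s₁ δ) (τ : ℝ) {i : Fin n}
    {w : Vec m} (hw : w ∈ dualSet (p.f i)) (y₀ u : Vec m) : ∃ z, p.IsDualStep τ i y₀ u z := by
  have hcont : Continuous fun v : Vec m => ⟪v, u⟫ - τ * bregman quad v y₀ := by
    simp only [bregman_quad]
    fun_prop
  obtain ⟨z, hz⟩ := exists_isMaxOn_sub_conj h.K_nonneg (h.f_lip i) hw hcont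
  exact ⟨z, isDualStep_of_isMaxOn hw hz⟩

/-- The step depends on its data only through `y₀ + τ⁻¹ • u`, and does so with Lipschitz constant
one. Both uniqueness and measurability of the step rest on this. -/
theorem Problem.IsDualStep.nonexpansive (hτ : 0 < τ) {i : Fin n} {y₀ u z y₀' u' z' : Vec m}
    (h : p.IsDualStep τ i y₀ u z) (h' : p.IsDualStep τ i y₀' u' z') :
    ‖z - z'‖ ≤ ‖(y₀ + τ⁻¹ • u) - (y₀' + τ⁻¹ • u')‖ := by
  have := prox_nonexpansive (h := fun v => (conj (p.f i) v).toReal) hτ (h.2 z' h'.1) (h'.2 z h.1)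
  simpa using this

theorem Problem.Regular.convexOn_r (h : p.Regular K G Λ s₀ s₁ δ) :
    ConvexOn ℝ {x | x ∈ p.X ∧ p.r x < ⊤} fun x => (p.r x).toReal := by
  have hcoe : ∀ x, x ∈ p.X ∧ p.r x < ⊤ → ((p.r x).toReal : EReal) = p.r x := fun x hx =>
    EReal.coe_toReal hx.2.ne (h.r_ne_bot x hx.1)
  have key : ∀ x, x ∈ p.X ∧ p.r x < ⊤ → ∀ z, z ∈ p.X ∧ p.r z < ⊤ → ∀ a b : ℝ, 0 < a → 0 < b →
      a + b = 1 → p.r (a • x + b • z)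
        ≤ ((a * (p.r x).toReal + b * (p.r z).toReal : ℝ) : EReal) := by
    intro x hx z hz a b ha hb hab
    rw [EReal.coe_add, EReal.coe_mul, EReal.coe_mul, hcoe x hx, hcoe z hz]
    exact h.r_convex x hx.1 z hz.1 a b ha hb hab
  rw [convexOn_iff_forall_pos]
  refine ⟨convex_iff_forall_pos.2 fun x hx z hz a b ha hb hab => ?_,
    fun x hx z hz a b ha hb hab => ?_⟩
  · exact ⟨h.convex_X hx.1 hz.1 ha.le hb.le hab,
      (key x hx z hz a b ha hb hab).trans_lt (EReal.coe_lt_top _)⟩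
  · have h1 := key x hx z hz a b ha hb hab
    have hm := h.convex_X hx.1 hz.1 ha.le hb.le hab
    rwa [← hcoe _ ⟨hm, h1.trans_lt (EReal.coe_lt_top _)⟩, EReal.coe_le_coe_iff] at h1

theorem Problem.Regular.isPrimalStep_of_isMinOn (h : p.Regular K G Λ s₀ s₁ δ) {x₀ c z : Vec d}
    (hzX : z ∈ p.X) (hz : IsMinOn (fun z : Vec d =>
      ((⟪c, z⟫ + η / 2 * ‖z - x₀‖ ^ 2 : ℝ) : EReal) + p.r z) p.X z) :
    p.IsPrimalStep η x₀ c z := by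
  have hcoe : ∀ x, x ∈ p.X ∧ p.r x < ⊤ → ((p.r x).toReal : EReal) = p.r x := fun x hx =>
    EReal.coe_toReal hx.2.ne (h.r_ne_bot x hx.1)
  have hr : p.r z < ⊤ := by
    obtain ⟨w, hw, hrw⟩ := h.r_proper
    have h1 := hz hw
    simp only [Set.mem_ofPred_eq] at h1
    by_contra hcon
    rw [not_lt_top_iff.1 hcon, EReal.coe_add_top, ← hcoe w ⟨hw, lt_top_iff_ne_top.2 hrw⟩,
      ← EReal.coe_add] at h1
    exact EReal.coe_ne_top _ (top_le_iff.1 h1)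
  refine ⟨⟨hzX, hr⟩, fun v hv => prox_three_point h.convexOn_r ⟨hzX, hr⟩ (fun v hv => ?_) hv⟩
  have h1 := hz hv.1
  simp only [Set.mem_ofPred_eq] at h1
  rw [← hcoe v hv, ← hcoe z ⟨hzX, hr⟩, ← EReal.coe_add, ← EReal.coe_add, EReal.coe_le_coe_iff] at h1
  linarith

theorem Problem.IsPrimalStep.nonexpansive (hη : 0 < η) {x₀ c z x₀' c' z' : Vec d}
    (h : p.IsPrimalStep η x₀ c z) (h' : p.IsPrimalStep η x₀' c' z') :
    ‖z - z'‖ ≤ ‖(x₀ - η⁻¹ • c) - (x₀' - η⁻¹ • c')‖ :=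
  prox_nonexpansive (h := fun v => (p.r v).toReal) hη (h.2 z' h'.1) (h'.2 z h.1)

/-! ### The optimality gap -/

/-- The duality gap between `(x, w)` and `(x', v)`. -/
def Problem.gap (p : Problem n d m Z) (x x' : Vec d) (w v : Fin n → Vec m) : ℝ :=
  1 / (n : ℝ) * ∑ i, (⟪w i, p.g i x⟫ - (conj (p.f i) (w i)).toReal
    - ⟪v i, p.g i x'⟫ + (conj (p.f i) (v i)).toReal) + ((p.r x).toReal - (p.r x').toReal)

theorem Problem.Regular.F_eq_coe (h : p.Regular K G Λ s₀ s₁ δ) {x : Vec d} (hx : x ∈ p.X)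
    (hr : p.r x < ⊤) :
    p.F x = ((1 / (n : ℝ) * ∑ i, p.f i (p.g i x) + (p.r x).toReal : ℝ) : EReal) := by
  rw [EReal.coe_add, EReal.coe_toReal hr.ne (h.r_ne_bot x hx)]
  rfl

theorem Problem.Regular.r_lt_top_of_isMinOn (h : p.Regular K G Λ s₀ s₁ δ) {x : Vec d}
    (hmin : IsMinOn p.F p.X x) : p.r x < ⊤ := by
  obtain ⟨w, hw, hrw⟩ := h.r_proper
  have h1 := hmin hw
  simp only [Set.mem_ofPred_eq] at h1
  by_contra hcon
  rw [h.F_eq_coe hw (lt_top_iff_ne_top.2 hrw), Problem.F, not_lt_top_iff.1 hcon,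
    EReal.coe_add_top] at h1
  exact EReal.coe_ne_top _ (top_le_iff.1 h1)

/-- The optimality gap of an average is bounded by the average of the duality gaps. -/
theorem Problem.Regular.exists_gap_le (h : p.Regular K G Λ s₀ s₁ δ) {xs : Vec d} (hxs : xs ∈ p.X)
    (hmin : IsMinOn p.F p.X xs) {T : ℕ} (hT : 0 < T) {x : ℕ → Vec d}
    (hx : ∀ t, x t ∈ p.X ∧ p.r (x t) < ⊤) {w : Fin n → Vec m}
    (hw : ∀ i, w i ∈ dualSet (p.f i) ∧
      IsMaxOn (fun v : Vec m =>
        ((⟪v, p.g i ((1 / (T : ℝ)) • ∑ t ∈ Finset.range T, x t)⟫ : ℝ) : EReal) - conj (p.f i) v)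
        (dualSet (p.f i)) (w i)) {v : ℕ → Fin n → Vec m}
    (hv : ∀ t i, conj (p.f i) (v t i) < ⊤) :
    ∃ a : ℝ, 0 ≤ a ∧ p.F ((1 / (T : ℝ)) • ∑ t ∈ Finset.range T, x t) - p.F xs = (a : EReal) ∧
      T * a ≤ ∑ t ∈ Finset.range T, p.gap (x t) xs w (v t) := by
  set xb := (1 / (T : ℝ)) • ∑ t ∈ Finset.range T, x t with hxb
  have hTpos : (0 : ℝ) < T := Nat.cast_pos.2 hT
  have hsum : ∑ _t ∈ Finset.range T, 1 / (T : ℝ) = 1 := by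
    rw [Finset.sum_const, Finset.card_range, nsmul_eq_mul]
    field_simp
  have hxbs : xb = ∑ t ∈ Finset.range T, (1 / (T : ℝ)) • x t := by rw [hxb, Finset.smul_sum]
  have hmem : xb ∈ p.X ∧ p.r xb < ⊤ := by
    rw [hxbs]
    exact h.convexOn_r.1.sum_mem (fun _ _ => by positivity) hsum fun t _ => hx t
  have hr : T * (p.r xb).toReal ≤ ∑ t ∈ Finset.range T, (p.r (x t)).toReal := by
    have := h.convexOn_r.map_sum_le (t := Finset.range T) (w := fun _ => 1 / (T : ℝ)) (p := x)
      (fun _ _ => by positivity) hsum fun t _ => hx t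
    rw [← hxbs] at this
    simp only [smul_eq_mul, ← Finset.mul_sum] at this
    rwa [one_div, ← div_eq_inv_mul, le_div_iff₀' hTpos] at this
  -- Jensen's inequality; `w i` is fixed along the path, so it does not matter that it was chosen
  -- from the average.
  have hg : ∀ i, T * ⟪w i, p.g i xb⟫ ≤ ∑ t ∈ Finset.range T, ⟪w i, p.g i (x t)⟫ := by
    intro i
    have := (h.inner_convex i (w i) (hw i).1).map_sum_le (t := Finset.range T)
      (w := fun _ => 1 / (T : ℝ)) (p := x) (fun _ _ => by positivity) hsum fun t _ => (hx t).1
    rw [← hxbs] at this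
    simp only [smul_eq_mul, ← Finset.mul_sum] at this
    rwa [one_div, ← div_eq_inv_mul, le_div_iff₀' hTpos] at this
  have hf : ∀ i, p.f i (p.g i xb) ≤ ⟪w i, p.g i xb⟫ - (conj (p.f i) (w i)).toReal := fun i =>
    le_inner_sub_conj_of_isMaxOn (h.f_convex i) (h.f_lip i)
      (isMaxOn_sub_conj (ℓ := fun v => ⟪v, p.g i xb⟫) (hw i).1 (hw i).2).2
  have hrs := h.r_lt_top_of_isMinOn hmin
  have hle := hmin hmem.1
  simp only [Set.mem_ofPred_eq] at hle
  rw [h.F_eq_coe hmem.1 hmem.2, h.F_eq_coe hxs hrs] at *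
  rw [EReal.coe_le_coe_iff] at hle
  refine ⟨_, sub_nonneg.2 hle, (EReal.coe_sub _ _).symm, ?_⟩
  -- At `xs` Fenchel–Young suffices, so the dual points `v t` may be arbitrary points of the
  -- effective domains.
  have e1 : ∀ t ∈ Finset.range T, 1 / (n : ℝ) * ∑ i, (⟪w i, p.g i (x t)⟫
      - (conj (p.f i) (w i)).toReal - p.f i (p.g i xs)) + ((p.r (x t)).toReal - (p.r xs).toReal)
      ≤ p.gap (x t) xs w (v t) := by
    intro t _
    unfold Problem.gap
    gcongr with i
    have := fenchel_young (hv t i) (p.g i xs)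
    linarith
  refine le_trans ?_ (Finset.sum_le_sum e1)
  rw [Finset.sum_add_distrib, ← Finset.mul_sum, Finset.sum_comm]
  have e2 : ∀ i ∈ Finset.univ, T * (p.f i (p.g i xb) - p.f i (p.g i xs))
      ≤ ∑ t ∈ Finset.range T, (⟪w i, p.g i (x t)⟫ - (conj (p.f i) (w i)).toReal
        - p.f i (p.g i xs)) := by
    intro i _
    rw [Finset.sum_sub_distrib, Finset.sum_sub_distrib, Finset.sum_const, Finset.sum_const,
      Finset.card_range, nsmul_eq_mul, nsmul_eq_mul]
    have := mul_le_mul_of_nonneg_left (hf i) hTpos.le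
    linarith [hg i]
  have e3 := mul_le_mul_of_nonneg_left (Finset.sum_le_sum e2) (show (0 : ℝ) ≤ 1 / n by positivity)
  rw [← Finset.mul_sum, Finset.sum_sub_distrib] at e3
  rw [Finset.sum_sub_distrib, Finset.sum_const, Finset.card_range, nsmul_eq_mul]
  linarith

end ALEXR

namespace ALEXR

variable {n d m : ℕ} {Z : Type*} [MeasurableSpace Z]

/-! ### Trajectories -/

/-- A trajectory of the algorithm: primal iterates `x`, dual iterates `y`, full dual steps `z`,
sampled blocks `s`, estimates `u` of the extrapolated inner functions, gradient estimates `c`. -/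
structure Problem.IsTrajectory (p : Problem n d m Z) (η τ : ℝ) (x : ℕ → Vec d)
    (y z : ℕ → Fin n → Vec m) (s : ℕ → Finset (Fin n)) (u : ℕ → Fin n → Vec m)
    (c : ℕ → Vec d) : Prop where
  x_zero : x 0 ∈ p.X
  y_zero : ∀ i, y 0 i ∈ dualSet (p.f i)
  dual_step : ∀ t i, p.IsDualStep τ i (y t i) (u t i) (z t i)
  primal_step : ∀ t, p.IsPrimalStep η (x t) (c t) (x (t + 1))
  y_sampled : ∀ t, ∀ i ∈ s t, y (t + 1) i = z t i
  y_unsampled : ∀ t, ∀ i ∉ s t, y (t + 1) i = y t i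

/-- The error of the estimates of the extrapolated inner functions. -/
def Problem.innerError (p : Problem n d m Z) (i : Fin n) (x x' : Vec d) (u : Vec m) : Vec m :=
  (2 : ℝ) • p.g i x - p.g i x' - u

/-- The gradient of the coupling term with respect to the primal variable. -/
def Problem.fullGrad (p : Problem n d m Z) (x : Vec d) (z : Fin n → Vec m) : Vec d :=
  (1 / (n : ℝ)) • ∑ i, (p.dg i x).adjoint (z i)

/-- The deviation of the sampling weight of a block from its mean. -/
def samplingDev (S : ℕ) (s : Finset (Fin n)) (i : Fin n) : ℝ :=
  1 / (n : ℝ) - if i ∈ s then 1 / (S : ℝ) else 0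

variable {p : Problem n d m Z} {K G Λ s₀ s₁ δ : ℝ} {τ η : ℝ}

section Trajectory

variable {x : ℕ → Vec d} {y z : ℕ → Fin n → Vec m} {s : ℕ → Finset (Fin n)}
  {u : ℕ → Fin n → Vec m} {c : ℕ → Vec d}

theorem Problem.IsTrajectory.x_mem (ht : p.IsTrajectory η τ x y z s u c) (t : ℕ) :
    x t ∈ p.X := by
  cases t with
  | zero => exact ht.x_zero
  | succ t => exact (ht.primal_step t).1.1

theorem Problem.IsTrajectory.z_mem (ht : p.IsTrajectory η τ x y z s u c) (t : ℕ) (i : Fin n) :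
    z t i ∈ dualSet (p.f i) :=
  mem_dualSet (ht.dual_step t i).1

theorem Problem.IsTrajectory.y_mem (ht : p.IsTrajectory η τ x y z s u c) (t : ℕ) (i : Fin n) :
    y t i ∈ dualSet (p.f i) := by
  induction t with
  | zero => exact ht.y_zero i
  | succ t ih =>
    by_cases hi : i ∈ s t
    · rw [ht.y_sampled t i hi]
      exact ht.z_mem t i
    · rwa [ht.y_unsampled t i hi]

theorem inner_fullGrad (x : Vec d) (z : Fin n → Vec m) (v : Vec d) :
    ⟪p.fullGrad x z, v⟫ = 1 / (n : ℝ) * ∑ i, ⟪z i, p.dg i x v⟫ := by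
  rw [Problem.fullGrad, inner_smul_left, sum_inner]
  simp only [conj_trivial, ContinuousLinearMap.adjoint_inner_left]

/-- Convexity linearizes the coupling from `x` to `xs`, smoothness from `x` to `x'`, and the
three-point inequality does the rest. Of the available `η/2 ‖x' - x‖²`, the smoothness error takes
`η/8` by `4 K Λ ≤ η`, the gradient error takes `η/8`, and `η/4` remains for the dual coupling. -/
theorem Problem.Regular.primal_step_le (h : p.Regular K G Λ s₀ s₁ δ) (hn : 0 < n) (hη : 0 < η)
    (hηΛ : 4 * K * Λ ≤ η) {x x' c xs : Vec d} {z : Fin n → Vec m} (hx : x ∈ p.X)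
    (hz : ∀ i, z i ∈ dualSet (p.f i)) (hx' : p.IsPrimalStep η x c x')
    (hxs : xs ∈ p.X ∧ p.r xs < ⊤) :
    1 / (n : ℝ) * ∑ i, ⟪z i, p.g i x' - p.g i xs⟫ + ((p.r x').toReal - (p.r xs).toReal)
      ≤ ⟪p.fullGrad x z - c, x - xs⟫ + 2 / η * ‖p.fullGrad x z - c‖ ^ 2
        + η / 2 * (‖x - xs‖ ^ 2 - ‖x' - xs‖ ^ 2) - η / 4 * ‖x' - x‖ ^ 2 := by
  have hnpos : (0 : ℝ) < n := Nat.cast_pos.2 hn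
  have h1 : ∀ i ∈ Finset.univ, ⟪z i, p.g i x' - p.g i xs⟫
      ≤ ⟪z i, p.dg i x (x' - xs)⟫ + K * (Λ / 2 * ‖x' - x‖ ^ 2) := by
    intro i _
    have h2 := h.inner_dg_le hx hxs.1 (hz i)
    have h3 : ⟪z i, p.g i x' - p.g i x - p.dg i x (x' - x)⟫ ≤ K * (Λ / 2 * ‖x' - x‖ ^ 2) := by
      refine (real_inner_le_norm _ _).trans ?_
      gcongr
      · exact h.K_nonneg
      · exact h.norm_le (hz i)
      · exact h.g_smooth i x' hx'.1.1 x hx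
    simp only [map_sub, inner_sub_right] at h2 h3 ⊢
    linarith
  have h2 : 1 / (n : ℝ) * ∑ i, ⟪z i, p.g i x' - p.g i xs⟫
      ≤ ⟪p.fullGrad x z, x' - xs⟫ + K * (Λ / 2 * ‖x' - x‖ ^ 2) := by
    have h3 := mul_le_mul_of_nonneg_left (Finset.sum_le_sum h1)
      (show (0 : ℝ) ≤ 1 / n by positivity)
    rw [Finset.sum_add_distrib, Finset.sum_const, Finset.card_univ, Fintype.card_fin,
      nsmul_eq_mul, mul_add, ← inner_fullGrad] at h3
    rwa [← mul_assoc (1 / (n : ℝ)) (n : ℝ), one_div_mul_cancel hnpos.ne', one_mul] at h3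
  have h3 := hx'.2 xs hxs
  have h4 := inner_le_weighted (a := η / 4) (by positivity) (x' - x) (p.fullGrad x z - c)
  rw [show 1 / (2 * (η / 4)) = 2 / η by field_simp; norm_num, real_inner_comm] at h4
  have h5 : K * (Λ / 2 * ‖x' - x‖ ^ 2) ≤ η / 8 * ‖x' - x‖ ^ 2 := by
    rw [← mul_assoc]
    gcongr
    linarith
  rw [norm_sub_rev xs x', norm_sub_rev xs x] at h3
  have h6 : ⟪p.fullGrad x z, x' - xs⟫ = ⟪p.fullGrad x z - c, x - xs⟫
      + ⟪p.fullGrad x z - c, x' - x⟫ + (⟪c, x'⟫ - ⟪c, xs⟫) := by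
    simp only [inner_sub_left, inner_sub_right]
    ring
  linarith

/-- The terms of the error bound whose expectation vanishes. -/
def Problem.martingaleTerm (p : Problem n d m Z) (S : ℕ) (τ : ℝ) (xs : Vec d) (x : ℕ → Vec d)
    (y z : ℕ → Fin n → Vec m) (s : ℕ → Finset (Fin n)) (u : ℕ → Fin n → Vec m) (c : ℕ → Vec d)
    (T : ℕ) : ℝ :=
  ∑ t ∈ Finset.range T, ⟪p.fullGrad (x t) (z t) - c t, x t - xs⟫
    + ∑ i, (1 / (n : ℝ) * ∑ t ∈ Finset.range T,
          ⟪y 0 i - y t i, p.innerError i (x t) (x (t - 1)) (u t i)⟫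
        + τ / 2 * ∑ t ∈ Finset.range T,
          samplingDev S (s t) i * (‖y t i - y 0 i‖ ^ 2 - ‖z t i - y 0 i‖ ^ 2))

/-- The quadratic terms of the error bound. -/
def Problem.quadraticTerm (p : Problem n d m Z) (S : ℕ) (η τ : ℝ) (x : ℕ → Vec d)
    (y z : ℕ → Fin n → Vec m) (s : ℕ → Finset (Fin n)) (u : ℕ → Fin n → Vec m) (c : ℕ → Vec d)
    (T : ℕ) : ℝ :=
  2 / η * ∑ t ∈ Finset.range T, ‖p.fullGrad (x t) (z t) - c t‖ ^ 2
    + ∑ i, (1 / (n : ℝ) * (1 / (2 * τ)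
          * ‖∑ t ∈ Finset.range T, p.innerError i (x t) (x (t - 1)) (u t i)‖ ^ 2)
        + 1 / (n : ℝ) * (2 / τ
          * ∑ t ∈ Finset.range T, ‖p.innerError i (x t) (x (t - 1)) (u t i)‖ ^ 2)
        + (τ / (8 * (1 / (S : ℝ)))
          * ‖∑ t ∈ Finset.range T, samplingDev S (s t) i • (z t i - y t i)‖ ^ 2
          - 1 / (n : ℝ) * (τ / 8 * ∑ t ∈ Finset.range T, ‖z t i - y t i‖ ^ 2)))

/-- The deterministic core of the analysis. It holds on every path and for every `w`, so `w` may be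
chosen with knowledge of the whole run; expectations are taken only afterwards. -/
theorem Problem.Regular.sum_gap_le (h : p.Regular K G Λ s₀ s₁ δ) {S : ℕ} (hS : 0 < S)
    (hSn : S ≤ n) (hη : 0 < η) (hτ : 0 < τ) (hηΛ : 4 * K * Λ ≤ η) (hητ : 32 * G ^ 2 ≤ η * τ)
    (ht : p.IsTrajectory η τ x y z s u c) {xs : Vec d} (hxs : xs ∈ p.X ∧ p.r xs < ⊤)
    {w : Fin n → Vec m} (hw : ∀ i, conj (p.f i) (w i) < ⊤) (T : ℕ) :
    ∑ t ∈ Finset.range (T + 1), p.gap (x (t + 1)) xs w (z t)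
      ≤ η / 2 * ‖x 0 - xs‖ ^ 2 + 8 * K ^ 2 * G ^ 2 / η + 3 * τ * (1 / S) * ∑ i, ‖w i - y 0 i‖ ^ 2
        + p.martingaleTerm S τ xs x y z s u c (T + 1)
        + p.quadraticTerm S η τ x y z s u c (T + 1) := by
  have hn : 0 < n := hS.trans_le hSn
  have hnpos : (0 : ℝ) < n := Nat.cast_pos.2 hn
  have hSpos : (0 : ℝ) < S := Nat.cast_pos.2 hS
  have hKn := h.K_nonneg
  have hGn := h.G_nonneg
  -- splitting of the duality gap
  set Δ : Fin n → ℕ → Vec m := fun i t => p.g i (x t) - p.g i (x (t - 1)) with hΔ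
  set e : Fin n → ℕ → Vec m := fun i t => p.innerError i (x t) (x (t - 1)) (u t i) with he
  have hdual : ∀ t i, ⟪w i - z t i, p.g i (x (t + 1))⟫ + (conj (p.f i) (z t i)).toReal
      - (conj (p.f i) (w i)).toReal ≤ ⟪w i - z t i, Δ i (t + 1) - Δ i t + e i t⟫
        + τ / 2 * (‖w i - y t i‖ ^ 2 - ‖w i - z t i‖ ^ 2 - ‖z t i - y t i‖ ^ 2) := by
    intro t i
    have h1 := (ht.dual_step t i).2 (w i) (hw i)
    -- Here `u t i + e i t = 2 g (x t) - g (x (t - 1))`. This is where the extrapolation turns the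
    -- mismatch with `g (x (t + 1))` into a difference of consecutive `Δ`.
    have h2 : Δ i (t + 1) - Δ i t + e i t = p.g i (x (t + 1)) - u t i := by
      simp only [hΔ, he, Problem.innerError, Nat.add_sub_cancel]
      module
    rw [h2, inner_sub_right]
    rw [inner_neg_left, inner_neg_left, real_inner_comm, real_inner_comm (w i)] at h1
    have h3 : ⟪w i - z t i, u t i⟫ = ⟪w i, u t i⟫ - ⟪z t i, u t i⟫ := inner_sub_left _ _ _
    linarith
  have hgap : ∀ t ∈ Finset.range (T + 1), p.gap (x (t + 1)) xs w (z t)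
      ≤ (⟪p.fullGrad (x t) (z t) - c t, x t - xs⟫ + 2 / η * ‖p.fullGrad (x t) (z t) - c t‖ ^ 2
        + η / 2 * (‖x t - xs‖ ^ 2 - ‖x (t + 1) - xs‖ ^ 2) - η / 4 * ‖x (t + 1) - x t‖ ^ 2)
        + ∑ i, 1 / (n : ℝ) * (⟪w i - z t i, Δ i (t + 1) - Δ i t + e i t⟫
        + τ / 2 * (‖w i - y t i‖ ^ 2 - ‖w i - z t i‖ ^ 2 - ‖z t i - y t i‖ ^ 2)) := by
    intro t _
    have h1 := h.primal_step_le hn hη hηΛ (ht.x_mem t) (ht.z_mem t) (ht.primal_step t) hxs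
    have h2 := mul_le_mul_of_nonneg_left (Finset.sum_le_sum fun i (_ : i ∈ Finset.univ) => hdual t i)
      (show (0 : ℝ) ≤ 1 / n by positivity)
    rw [← Finset.mul_sum]
    have h3 : p.gap (x (t + 1)) xs w (z t) = 1 / (n : ℝ) * ∑ i,
        (⟪w i - z t i, p.g i (x (t + 1))⟫ + (conj (p.f i) (z t i)).toReal
          - (conj (p.f i) (w i)).toReal)
        + (1 / (n : ℝ) * ∑ i, ⟪z t i, p.g i (x (t + 1)) - p.g i xs⟫
          + ((p.r (x (t + 1))).toReal - (p.r xs).toReal)) := by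
      rw [Problem.gap, ← add_assoc, ← mul_add, ← Finset.sum_add_distrib]
      congr 2
      refine Finset.sum_congr rfl fun i _ => ?_
      simp only [inner_sub_left, inner_sub_right]
      ring
    rw [h3]
    linarith
  refine (Finset.sum_le_sum hgap).trans ?_
  rw [Finset.sum_add_distrib, Finset.sum_comm]
  have hblock : ∀ i ∈ Finset.univ, ∑ t ∈ Finset.range (T + 1), 1 / (n : ℝ) *
      (⟪w i - z t i, Δ i (t + 1) - Δ i t + e i t⟫
        + τ / 2 * (‖w i - y t i‖ ^ 2 - ‖w i - z t i‖ ^ 2 - ‖z t i - y t i‖ ^ 2))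
      ≤ 1 / (n : ℝ) * (2 * K * G * ‖x (T + 1) - x T‖
          + η / 8 * ∑ t ∈ Finset.range (T + 1), ‖x (t + 1) - x t‖ ^ 2)
        + 3 * τ * (1 / S) * ‖w i - y 0 i‖ ^ 2
        + (1 / (n : ℝ) * ∑ t ∈ Finset.range (T + 1), ⟪y 0 i - y t i, e i t⟫
        + τ / 2 * ∑ t ∈ Finset.range (T + 1),
          samplingDev S (s t) i * (‖y t i - y 0 i‖ ^ 2 - ‖z t i - y 0 i‖ ^ 2))
        + (1 / (n : ℝ) * (1 / (2 * τ) * ‖∑ t ∈ Finset.range (T + 1), e i t‖ ^ 2)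
        + 1 / (n : ℝ) * (2 / τ * ∑ t ∈ Finset.range (T + 1), ‖e i t‖ ^ 2)
        + (τ / (8 * (1 / (S : ℝ)))
          * ‖∑ t ∈ Finset.range (T + 1), samplingDev S (s t) i • (z t i - y t i)‖ ^ 2
          - 1 / (n : ℝ) * (τ / 8 * ∑ t ∈ Finset.range (T + 1), ‖z t i - y t i‖ ^ 2))) := by
    intro i _
    rw [← Finset.mul_sum]
    -- The initial condition `Δ i 0 = 0` holds because `0 - 1 = 0` in `ℕ`, so the first previous
    -- iterate is `x 0` itself.
    refine (block_sum_le (a := 1 / (n : ℝ)) (b := 1 / (S : ℝ)) (c := fun t => samplingDev S (s t) i)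
      (y := fun t => y t i) (z := fun t => z t i) (Δ := Δ i) (e := e i) hτ (by positivity)
      (by gcongr) (by positivity) (by simp [hΔ]) (fun t => ?_) (w i) T).trans ?_
    · by_cases hi : i ∈ s t
      · exact Or.inl ⟨ht.y_sampled t i hi, by simp [samplingDev, hi]⟩
      · exact Or.inr ⟨ht.y_unsampled t i hi, by simp [samplingDev, hi]⟩
    · have h1 : ⟪w i - z T i, Δ i (T + 1)⟫ ≤ 2 * K * G * ‖x (T + 1) - x T‖ := by
        refine (real_inner_le_norm _ _).trans ?_
        have h2 : ‖w i - z T i‖ ≤ 2 * K := by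
          refine (norm_sub_le _ _).trans ?_
          linarith [h.norm_le (mem_dualSet (hw i)), h.norm_le (ht.z_mem T i)]
        have h3 := h.g_lip i _ (ht.x_mem (T + 1)) _ (ht.x_mem T)
        calc _ ≤ 2 * K * (G * ‖x (T + 1) - x T‖) := by gcongr; exact h3
          _ = _ := by ring
      -- The condition `32 G² ≤ η τ` says exactly `4 G² / τ ≤ η / 8`. This uses half of the `η/4`
      -- left by the primal steps.
      have h2 : 4 / τ * ∑ t ∈ Finset.range (T + 1), ‖Δ i t‖ ^ 2
          ≤ η / 8 * ∑ t ∈ Finset.range (T + 1), ‖x (t + 1) - x t‖ ^ 2 := by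
        have h3 : ∑ t ∈ Finset.range (T + 1), ‖Δ i t‖ ^ 2
            ≤ G ^ 2 * ∑ t ∈ Finset.range (T + 1), ‖x (t + 1) - x t‖ ^ 2 := by
          rw [Finset.sum_range_succ', Finset.mul_sum, Finset.sum_range_succ (fun t => _ * _)]
          have h4 : ‖Δ i 0‖ ^ 2 ≤ G ^ 2 * ‖x (T + 1) - x T‖ ^ 2 := by
            simp only [hΔ, sub_self, norm_zero, zero_pow two_ne_zero]
            positivity
          refine add_le_add (Finset.sum_le_sum fun t _ => ?_) h4
          rw [← mul_pow]
          gcongr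
          exact h.g_lip i _ (ht.x_mem (t + 1)) _ (ht.x_mem t)
        calc _ ≤ 4 / τ * (G ^ 2 * ∑ t ∈ Finset.range (T + 1), ‖x (t + 1) - x t‖ ^ 2) := by gcongr
          _ = (4 * G ^ 2 / τ) * ∑ t ∈ Finset.range (T + 1), ‖x (t + 1) - x t‖ ^ 2 := by ring
          _ ≤ _ := by
            refine mul_le_mul_of_nonneg_right ?_ (Finset.sum_nonneg fun _ _ => by positivity)
            rw [div_le_iff₀ hτ]
            linarith
      have h3 : 1 / (n : ℝ) * ⟪w i - z T i, Δ i (T + 1)⟫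
          ≤ 1 / (n : ℝ) * (2 * K * G * ‖x (T + 1) - x T‖) := by gcongr
      have h4 := mul_le_mul_of_nonneg_left h2 (show (0 : ℝ) ≤ 1 / n by positivity)
      linarith
  refine (add_le_add_right (Finset.sum_le_sum hblock) _).trans ?_
  simp only [Finset.sum_add_distrib, Finset.sum_sub_distrib, ← Finset.mul_sum, Finset.sum_const,
    Finset.card_univ, Fintype.card_fin, nsmul_eq_mul]
  have hcancel : 1 / (n : ℝ) * (2 * K * G * (n * ‖x (T + 1) - x T‖)
      + η / 8 * (n * ∑ t ∈ Finset.range (T + 1), ‖x (t + 1) - x t‖ ^ 2))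
      = 2 * K * G * ‖x (T + 1) - x T‖
        + η / 8 * ∑ t ∈ Finset.range (T + 1), ‖x (t + 1) - x t‖ ^ 2 := by
    field_simp
  have htel : ∑ t ∈ Finset.range (T + 1), ‖x t - xs‖ ^ 2
      - ∑ t ∈ Finset.range (T + 1), ‖x (t + 1) - xs‖ ^ 2
      = ‖x 0 - xs‖ ^ 2 - ‖x (T + 1) - xs‖ ^ 2 := by
    rw [← Finset.sum_sub_distrib, Finset.sum_range_sub' fun t => ‖x t - xs‖ ^ 2]
  -- The boundary term of the telescoping is paid by the other `η/8`, after completing the square.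
  have hlast : 2 * K * G * ‖x (T + 1) - x T‖ ≤ 8 * K ^ 2 * G ^ 2 / η
      + η / 8 * ∑ t ∈ Finset.range (T + 1), ‖x (t + 1) - x t‖ ^ 2 := by
    have h1 : ‖x (T + 1) - x T‖ ^ 2 ≤ ∑ t ∈ Finset.range (T + 1), ‖x (t + 1) - x t‖ ^ 2 := by
      rw [Finset.sum_range_succ]
      have : 0 ≤ ∑ t ∈ Finset.range T, ‖x (t + 1) - x t‖ ^ 2 :=
        Finset.sum_nonneg fun _ _ => by positivity
      linarith
    have h2 : 0 ≤ (4 * K * G - η / 2 * ‖x (T + 1) - x T‖) ^ 2 / (2 * η) := by positivity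
    have h3 : (4 * K * G - η / 2 * ‖x (T + 1) - x T‖) ^ 2 / (2 * η)
        = 8 * K ^ 2 * G ^ 2 / η - 2 * K * G * ‖x (T + 1) - x T‖
          + η / 8 * ‖x (T + 1) - x T‖ ^ 2 := by
      field_simp
      ring
    have h4 : η / 8 * ‖x (T + 1) - x T‖ ^ 2
        ≤ η / 8 * ∑ t ∈ Finset.range (T + 1), ‖x (t + 1) - x t‖ ^ 2 := by gcongr
    linarith
  have hpos : 0 ≤ η / 2 * ‖x (T + 1) - xs‖ ^ 2 := by positivity
  simp only [Problem.martingaleTerm, Problem.quadraticTerm, Finset.sum_add_distrib,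
    Finset.sum_sub_distrib, ← Finset.mul_sum]
  rw [hcancel, htel]
  linarith

end Trajectory

end ALEXR

namespace ALEXR

/-! ### Integration against independent variables -/

section Independence

variable {Ω α β γ : Type*} [MeasurableSpace Ω] [MeasurableSpace α] [MeasurableSpace β]
  [MeasurableSpace γ] {μ : Measure Ω} [IsProbabilityMeasure μ]

/-- Independence makes the joint law a product, so Fubini integrates out `V` with `U` frozen. This
replaces conditional expectations throughout. -/
theorem lintegral_indep {U : Ω → α} {V : Ω → β} {P : Measure β} [SFinite P] (hUV : IndepFun U V μ)
    (hU : Measurable U) (hV : Measurable V) (hP : μ.map V = P) {h : α × β → ℝ≥0∞}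
    (hh : Measurable h) :
    ∫⁻ ω, h (U ω, V ω) ∂μ = ∫⁻ ω, ∫⁻ v, h (U ω, v) ∂P ∂μ := by
  have h1 := (indepFun_iff_map_prod_eq_prod_map_map hU.aemeasurable hV.aemeasurable).1 hUV
  rw [hP] at h1
  rw [← lintegral_map (f := h) hh (hU.prodMk hV), h1, lintegral_prod _ hh.aemeasurable,
    lintegral_map (hh.lintegral_prod_right') hU]

theorem integral_indep {E : Type*} [NormedAddCommGroup E] [NormedSpace ℝ E]
    {U : Ω → α} {V : Ω → β} {P : Measure β} [SFinite P] (hUV : IndepFun U V μ)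
    (hU : Measurable U) (hV : Measurable V) (hP : μ.map V = P) {h : α × β → E}
    (hh : StronglyMeasurable h) (hint : Integrable (fun ω => h (U ω, V ω)) μ) :
    ∫ ω, h (U ω, V ω) ∂μ = ∫ ω, ∫ v, h (U ω, v) ∂P ∂μ := by
  have h1 := (indepFun_iff_map_prod_eq_prod_map_map hU.aemeasurable hV.aemeasurable).1 hUV
  rw [hP] at h1
  have hm : AEMeasurable (fun ω => (U ω, V ω)) μ := (hU.prodMk hV).aemeasurable
  have hi : Integrable h ((μ.map U).prod P) := by
    rw [← h1]
    exact (integrable_map_measure hh.aestronglyMeasurable hm).2 hint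
  rw [← integral_map (f := h) hm hh.aestronglyMeasurable, h1, integral_prod _ hi,
    integral_map hU.aemeasurable hh.integral_prod_right'.aestronglyMeasurable]

/-- If `X` is independent of `(Y, Z)` and `Y` is independent of `Z`, then `(X, Y)` is independent
of `Z`. -/
theorem indepFun_prodMk_left {X : Ω → α} {Y : Ω → β} {V : Ω → γ} (hX : Measurable X)
    (hY : Measurable Y) (hV : Measurable V) (hXYV : IndepFun X (fun ω => (Y ω, V ω)) μ)
    (hYV : IndepFun Y V μ) : IndepFun (fun ω => (X ω, Y ω)) V μ := by
  have : IsProbabilityMeasure (μ.map X) := Measure.isProbabilityMeasure_map hX.aemeasurable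
  have : IsProbabilityMeasure (μ.map Y) := Measure.isProbabilityMeasure_map hY.aemeasurable
  have : IsProbabilityMeasure (μ.map V) := Measure.isProbabilityMeasure_map hV.aemeasurable
  have h1 := (indepFun_iff_map_prod_eq_prod_map_map hX.aemeasurable
    (hY.prodMk hV).aemeasurable).1 hXYV
  have h2 := (indepFun_iff_map_prod_eq_prod_map_map hY.aemeasurable hV.aemeasurable).1 hYV
  have h3 : IndepFun X Y μ := hXYV.comp measurable_id measurable_fst
  have h4 := (indepFun_iff_map_prod_eq_prod_map_map hX.aemeasurable hY.aemeasurable).1 h3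
  rw [indepFun_iff_map_prod_eq_prod_map_map (hX.prodMk hY).aemeasurable hV.aemeasurable, h4]
  rw [h2] at h1
  have h5 := (measurePreserving_prodAssoc (μ.map X) (μ.map Y) (μ.map V)).symm
  rw [← h5.map_eq, ← h1, Measure.map_map h5.measurable (hX.prodMk (hY.prodMk hV))]
  rfl

omit [IsProbabilityMeasure μ] in
/-- Independence of two functions of `V` can be checked under the law of `V`. -/
theorem indepFun_comp_of_map {δ : Type*} [MeasurableSpace δ] {V : Ω → β} (hV : Measurable V)
    {φ : β → γ} {ψ : β → δ} (hφ : Measurable φ) (hψ : Measurable ψ)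
    (h : IndepFun φ ψ (μ.map V)) : IndepFun (fun ω => φ (V ω)) (fun ω => ψ (V ω)) μ := by
  rw [indepFun_iff_measure_inter_preimage_eq_mul] at h ⊢
  intro s t hs ht
  have := h s t hs ht
  rwa [Measure.map_apply hV ((hφ hs).inter (hψ ht)), Measure.map_apply hV (hφ hs),
    Measure.map_apply hV (hψ ht)] at this

variable {F : Type*} [NormedAddCommGroup F]

/-- A function of independent variables with uniformly bounded conditional second moments is square
integrable. -/
theorem memLp_two_of_indep {U : Ω → α} {V : Ω → β} {P : Measure β} [SFinite P]
    (hUV : IndepFun U V μ) (hU : Measurable U) (hV : Measurable V) (hP : μ.map V = P)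
    {ξ : α × β → F} (hξ : StronglyMeasurable ξ) {c : ℝ} (hc : 0 ≤ c)
    (hmem : ∀ ω, MemLp (fun v => ξ (U ω, v)) 2 P)
    (hle : ∀ᵐ ω ∂μ, ∫ v, ‖ξ (U ω, v)‖ ^ 2 ∂P ≤ c) :
    MemLp (fun ω => ξ (U ω, V ω)) 2 μ ∧ ∫ ω, ‖ξ (U ω, V ω)‖ ^ 2 ∂μ ≤ c := by
  have hm : AEStronglyMeasurable (fun ω => ξ (U ω, V ω)) μ :=
    (hξ.comp_measurable (hU.prodMk hV)).aestronglyMeasurable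
  -- Lower integrals come first, because square integrability is itself part of the conclusion.
  have h1 : ∫⁻ ω, ENNReal.ofReal (‖ξ (U ω, V ω)‖ ^ 2) ∂μ ≤ ENNReal.ofReal c := by
    rw [lintegral_indep (h := fun w => ENNReal.ofReal (‖ξ w‖ ^ 2)) hUV hU hV hP
      (hξ.norm.measurable.pow_const 2).ennreal_ofReal]
    calc _ ≤ ∫⁻ _ω, ENNReal.ofReal c ∂μ := by
          refine lintegral_mono_ae (hle.mono fun ω hω => ?_)
          rw [← ofReal_integral_eq_lintegral_ofReal ((hmem ω).integrable_norm_pow two_ne_zero)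
            (ae_of_all _ fun v => by positivity)]
          exact ENNReal.ofReal_le_ofReal hω
      _ = ENNReal.ofReal c := by simp
  exact ⟨memLp_two_of_lintegral_sq_lt_top hm (h1.trans_lt ENNReal.ofReal_lt_top),
    integral_sq_le_of_lintegral_sq_le hm hc h1⟩

variable [InnerProductSpace ℝ F]

omit [IsProbabilityMeasure μ] in
theorem integrable_inner_of_memLp_two {f g : Ω → F} (hf : MemLp f 2 μ) (hg : MemLp g 2 μ) :
    Integrable (fun ω => ⟪f ω, g ω⟫) μ := by
  refine ((hf.integrable_norm_pow two_ne_zero).add (hg.integrable_norm_pow two_ne_zero)).mono'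
    (hf.1.inner hg.1) (ae_of_all _ fun ω => ?_)
  rw [Real.norm_eq_abs]
  refine (abs_real_inner_le_norm _ _).trans ?_
  simp only [Pi.add_apply]
  nlinarith [sq_nonneg (‖f ω‖ - ‖g ω‖), sq_nonneg (‖f ω‖), sq_nonneg (‖g ω‖)]

variable [CompleteSpace F]

/-- A conditionally centred variable is orthogonal to functions of the conditioning variable. -/
theorem integral_inner_eq_zero_of_indep {U : Ω → α} {V : Ω → β} {P : Measure β} [SFinite P]
    (hUV : IndepFun U V μ) (hU : Measurable U) (hV : Measurable V) (hP : μ.map V = P)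
    {ξ : α × β → F} (hξ : StronglyMeasurable ξ) {u : α → F} (hu : StronglyMeasurable u)
    (hmem : MemLp (fun ω => ξ (U ω, V ω)) 2 μ) (humem : MemLp (fun ω => u (U ω)) 2 μ)
    (hint : ∀ ω, Integrable (fun v => ξ (U ω, v)) P) (hzero : ∀ ω, ∫ v, ξ (U ω, v) ∂P = 0) :
    ∫ ω, ⟪ξ (U ω, V ω), u (U ω)⟫ ∂μ = 0 := by
  rw [integral_indep (h := fun w => ⟪ξ w, u w.1⟫) hUV hU hV hP
    (hξ.inner (hu.comp_measurable measurable_fst)) (integrable_inner_of_memLp_two hmem humem)]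
  refine integral_eq_zero_of_ae (ae_of_all _ fun ω => ?_)
  have : ∫ v, ⟪ξ (U ω, v), u (U ω)⟫ ∂P = ⟪∫ v, ξ (U ω, v) ∂P, u (U ω)⟫ := by
    simp only [real_inner_comm (u (U ω))]
    exact integral_inner (hint ω) (u (U ω))
  simp only [this, hzero, inner_zero_left, Pi.zero_apply]

end Independence

/-! ### Sums of independent centred variables -/

section PiVariance

variable {ι : Type*} [Fintype ι] {A : ι → Type*} [∀ i, MeasurableSpace (A i)]
  {P : ∀ i, Measure (A i)} [∀ i, IsProbabilityMeasure (P i)]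
  {F : Type*} [NormedAddCommGroup F]

theorem memLp_eval (i : ι) {φ : A i → F} (hφ : MemLp φ 2 (P i)) :
    MemLp (fun b : ∀ i, A i => φ (b i)) 2 (Measure.pi P) :=
  hφ.comp_measurePreserving (measurePreserving_eval P i)

variable [InnerProductSpace ℝ F] [CompleteSpace F] [MeasurableSpace F] [BorelSpace F]

/-- In the expanded square the cross terms vanish: distinct coordinates are independent and centred.
-/
theorem integral_norm_sum_sq_pi {φ : ∀ i, A i → F} (hφ : ∀ i, MemLp (φ i) 2 (P i))
    (hzero : ∀ i, ∫ a, φ i a ∂(P i) = 0) (s : Finset ι) :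
    ∫ b, ‖∑ i ∈ s, φ i (b i)‖ ^ 2 ∂(Measure.pi P) = ∑ i ∈ s, ∫ a, ‖φ i a‖ ^ 2 ∂(P i) := by
  classical
  have hint : ∀ i j, Integrable (fun b : ∀ i, A i => ⟪φ i (b i), φ j (b j)⟫) (Measure.pi P) :=
    fun i j => integrable_inner_of_memLp_two (memLp_eval i (hφ i)) (memLp_eval j (hφ j))
  have hcross : ∀ i j, i ≠ j → ∫ b, ⟪φ i (b i), φ j (b j)⟫ ∂(Measure.pi P) = 0 := by
    intro i j hij
    have hind := (iIndepFun_pi (μ := P) (X := φ)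
      (fun i => (hφ i).1.aemeasurable)).indepFun hij
    have h1 : ∫ b, ⟪φ i (b i), φ j (b j)⟫ ∂(Measure.pi P)
        = ⟪∫ b, φ i (b i) ∂(Measure.pi P), ∫ b, φ j (b j) ∂(Measure.pi P)⟫ :=
      hind.integral_bilin ((memLp_eval i (hφ i)).integrable one_le_two)
        ((memLp_eval j (hφ j)).integrable one_le_two) (innerSL ℝ)
    rw [h1, integral_comp_eval (f := φ i) (hφ i).1, hzero, inner_zero_left]
  simp only [← real_inner_self_eq_norm_sq, sum_inner, inner_sum]
  rw [integral_finsetSum _ fun i _ => integrable_finsetSum _ fun j _ => hint _ _]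
  refine Finset.sum_congr rfl fun i hi => ?_
  rw [integral_finsetSum _ fun j _ => hint _ _, Finset.sum_eq_single i]
  · exact integral_comp_eval (f := fun a => ⟪φ i a, φ i a⟫) ((hφ i).1.inner (hφ i).1)
  · exact fun j _ hj => hcross _ _ (fun h => by simp_all)
  · exact fun h => absurd hi h

end PiVariance

/-! ### Sampling without replacement -/

section Sampling

variable {n S : ℕ}

theorem integral_uniformOn_powersetCard {E : Type*} [NormedAddCommGroup E] [NormedSpace ℝ E]
    [CompleteSpace E] (f : Finset (Fin n) → E) :
    ∫ s, f s ∂(uniformOn ((Finset.univ.powersetCard S : Finset (Finset (Fin n))) :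
      Set (Finset (Fin n)))) = ((n.choose S : ℝ))⁻¹ • ∑ s ∈ Finset.univ.powersetCard S, f s := by
  rw [uniformOn, ProbabilityTheory.cond, integral_smul_measure, Measure.count_apply_finset,
    Finset.card_powersetCard, Finset.card_univ, Fintype.card_fin,
    setIntegral_finset _ Integrable.of_finite]
  simp [Measure.real, ENNReal.toReal_inv]

/-- The count is `(n - 1).choose (S - 1)`; in this form it is the inclusion probability `S / n`
times the number of all sets. -/
theorem card_filter_mem_powersetCard (hS : 0 < S) (i : Fin n) :
    (((Finset.univ.powersetCard S).filter (i ∈ ·) : Finset (Finset (Fin n))).card : ℝ)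
      = S / n * n.choose S := by
  have h1 := Finset.card_filter_powersetCard_subset {i} (Finset.univ : Finset (Fin n)) S
    (Finset.subset_univ _) (by simpa [Nat.one_le_iff_ne_zero] using hS.ne')
  simp only [Finset.singleton_subset_iff, Finset.card_univ, Fintype.card_fin,
    Finset.card_singleton] at h1
  rw [h1]
  have hn : 0 < n := i.pos
  obtain ⟨k, rfl⟩ := Nat.exists_eq_add_of_lt hn
  obtain ⟨l, rfl⟩ := Nat.exists_eq_add_of_lt hS
  simp only [zero_add, Nat.add_sub_cancel]
  have h2 := Nat.add_one_mul_choose_eq k l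
  have h3 : ((k + 1 : ℕ) : ℝ) * (k.choose l) = ((k + 1).choose (l + 1)) * ((l + 1 : ℕ) : ℝ) := by
    exact_mod_cast h2
  rw [div_mul_eq_mul_div, eq_div_iff (by positivity)]
  linarith

/-- The variance bound needs only that the count is nonnegative and the same for all pairs; its
value is never used. -/
theorem exists_card_filter_pair_powersetCard (n S : ℕ) :
    ∃ c : ℝ, 0 ≤ c ∧ ∀ i j : Fin n, i ≠ j →
      (((Finset.univ.powersetCard S).filter fun s => i ∈ s ∧ j ∈ s :
        Finset (Finset (Fin n))).card : ℝ) = c := by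
  by_cases hS : 2 ≤ S
  · refine ⟨((n - 2).choose (S - 2) : ℕ), by positivity, fun i j hij => ?_⟩
    have h1 := Finset.card_filter_powersetCard_subset {i, j} (Finset.univ : Finset (Fin n)) S
      (Finset.subset_univ _) (by rwa [Finset.card_pair hij])
    simp only [Finset.insert_subset_iff, Finset.singleton_subset_iff, Finset.card_univ,
      Fintype.card_fin, Finset.card_pair hij] at h1
    exact_mod_cast h1
  · refine ⟨0, le_rfl, fun i j hij => ?_⟩
    rw [Nat.cast_eq_zero, Finset.card_eq_zero, Finset.filter_eq_empty_iff]
    intro s hs h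
    rw [Finset.mem_powersetCard] at hs
    have h1 : ({i, j} : Finset (Fin n)) ⊆ s := by
      simp [Finset.insert_subset_iff, h.1, h.2]
    have h2 := Finset.card_le_card h1
    rw [Finset.card_pair hij] at h2
    omega

variable {F : Type*} [NormedAddCommGroup F] [InnerProductSpace ℝ F]

/-- All off-diagonal products carry the same coefficient `c`, and `∑ b = 0` turns them into `-c ‖b
i‖²`, which is dropped. Sampling without replacement is thus no worse than independent sampling. -/
theorem sum_powersetCard_norm_sq_le (hS : 0 < S) {b : Fin n → F} (hb : ∑ i, b i = 0) :
    ∑ s ∈ Finset.univ.powersetCard S, ‖∑ i ∈ s, b i‖ ^ 2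
      ≤ S / n * n.choose S * ∑ i, ‖b i‖ ^ 2 := by
  obtain ⟨c, hc, hpair⟩ := exists_card_filter_pair_powersetCard n S
  have h1 : ∀ s : Finset (Fin n), ‖∑ i ∈ s, b i‖ ^ 2
      = ∑ i, ∑ j, if i ∈ s ∧ j ∈ s then ⟪b i, b j⟫ else 0 := by
    intro s
    rw [← real_inner_self_eq_norm_sq, sum_inner]
    simp only [inner_sum, ite_and]
    rw [← Finset.sum_filter_add_sum_filter_not Finset.univ (· ∈ s)]
    simp only [Finset.filter_mem_eq_inter, Finset.univ_inter]
    rw [Finset.sum_eq_zero (s := Finset.univ.filter (· ∉ s)) fun i hi => by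
      simp [(Finset.mem_filter.1 hi).2], add_zero]
    refine Finset.sum_congr rfl fun i hi => ?_
    simp [hi, Finset.sum_ite_mem]
  simp only [h1]
  rw [Finset.sum_comm]
  have h2 : ∀ i ∈ Finset.univ, ∑ s ∈ Finset.univ.powersetCard S,
      ∑ j, (if i ∈ s ∧ j ∈ s then ⟪b i, b j⟫ else 0)
      = (S / n * n.choose S - c) * ‖b i‖ ^ 2 + c * ⟪b i, ∑ j, b j⟫ := by
    intro i _
    rw [Finset.sum_comm, inner_sum, Finset.mul_sum,
      ← Finset.add_sum_erase _ _ (Finset.mem_univ i),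
      ← Finset.add_sum_erase (a := i) Finset.univ (fun j => c * ⟪b i, b j⟫) (Finset.mem_univ i),
      ← add_assoc]
    congr 1
    · simp only [and_self]
      rw [← Finset.sum_filter, Finset.sum_const, nsmul_eq_mul,
        card_filter_mem_powersetCard hS, real_inner_self_eq_norm_sq]
      ring
    · refine Finset.sum_congr rfl fun j hj => ?_
      rw [← Finset.sum_filter, Finset.sum_const, nsmul_eq_mul,
        hpair i j (Finset.ne_of_mem_erase hj).symm]
  rw [Finset.sum_congr rfl h2, hb]
  simp only [inner_zero_right, mul_zero, add_zero, ← Finset.mul_sum]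
  refine mul_le_mul_of_nonneg_right (by linarith) (Finset.sum_nonneg fun _ _ => by positivity)

theorem isProbabilityMeasure_uniformOn_powersetCard (hSn : S ≤ n) :
    IsProbabilityMeasure (uniformOn ((Finset.univ.powersetCard S : Finset (Finset (Fin n))) :
      Set (Finset (Fin n)))) := by
  refine isProbabilityMeasure_uniformOn (Finset.finite_toSet _) ?_
  rw [Finset.coe_nonempty, Finset.powersetCard_nonempty]
  simpa using hSn

theorem sum_samplingDev (hS : 0 < S) (hSn : S ≤ n) (i : Fin n) :
    ∑ s ∈ Finset.univ.powersetCard S, samplingDev S s i = 0 := by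
  have hn : (0 : ℝ) < n := Nat.cast_pos.2 (hS.trans_le hSn)
  have hSp : (0 : ℝ) < S := Nat.cast_pos.2 hS
  simp only [samplingDev]
  rw [Finset.sum_sub_distrib, ← Finset.sum_filter, Finset.sum_const, Finset.sum_const,
    nsmul_eq_mul, nsmul_eq_mul, card_filter_mem_powersetCard hS, Finset.card_powersetCard,
    Finset.card_univ, Fintype.card_fin]
  field_simp
  ring

/-- The variance of the weight is `1/(n S) - 1/n²`; the negative part is dropped. -/
theorem sum_samplingDev_sq_le (hS : 0 < S) (hSn : S ≤ n) (i : Fin n) :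
    ∑ s ∈ Finset.univ.powersetCard S, samplingDev S s i ^ 2
      ≤ n.choose S * (1 / n * (1 / S)) := by
  have hn : (0 : ℝ) < n := Nat.cast_pos.2 (hS.trans_le hSn)
  have hSp : (0 : ℝ) < S := Nat.cast_pos.2 hS
  have h1 : ∀ s : Finset (Fin n), samplingDev S s i ^ 2
      = 2 / n * samplingDev S s i - 1 / n ^ 2 + if i ∈ s then 1 / (S : ℝ) ^ 2 else 0 := by
    intro s
    by_cases hi : i ∈ s
    · simp only [samplingDev, hi, if_true]
      ring
    · simp only [samplingDev, hi, if_false]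
      ring
  simp only [h1]
  rw [Finset.sum_add_distrib, Finset.sum_sub_distrib, ← Finset.mul_sum, sum_samplingDev hS hSn,
    ← Finset.sum_filter, Finset.sum_const, Finset.sum_const, nsmul_eq_mul, nsmul_eq_mul,
    card_filter_mem_powersetCard hS, Finset.card_powersetCard, Finset.card_univ, Fintype.card_fin]
  have h2 : (0 : ℝ) ≤ n.choose S * (1 / n ^ 2) := by positivity
  have h3 : (S : ℝ) / n * n.choose S * (1 / (S : ℝ) ^ 2) = n.choose S * (1 / n * (1 / S)) := by
    field_simp
  linarith

/-- Since `s` has exactly `S` elements, the mean can be subtracted inside the sampled average. Hence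
only the deviations between blocks matter, and these are what `δ` bounds. -/
theorem sum_samplingDev_smul_eq (hS : 0 < S) (hSn : S ≤ n) {s : Finset (Fin n)} (hs : s.card = S)
    (a : Fin n → F) :
    ∑ i, samplingDev S s i • a i
      = -((1 / (S : ℝ)) • ∑ i ∈ s, (a i - (1 / (n : ℝ)) • ∑ j, a j)) := by
  have hn : (0 : ℝ) < n := Nat.cast_pos.2 (hS.trans_le hSn)
  have hSp : (0 : ℝ) < S := Nat.cast_pos.2 hS
  simp only [samplingDev, sub_smul, ite_smul, zero_smul]
  rw [Finset.sum_sub_distrib, Finset.sum_sub_distrib, Finset.sum_const, hs, ← Finset.smul_sum,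
    Finset.sum_ite_mem, Finset.univ_inter, ← Finset.smul_sum, ← Nat.cast_smul_eq_nsmul ℝ S,
    smul_sub, smul_smul (1 / (S : ℝ)), one_div_mul_cancel hSp.ne', one_smul]
  abel

theorem sum_powersetCard_samplingDev_norm_sq_le (hS : 0 < S) (hSn : S ≤ n) (a : Fin n → F) :
    ∑ s ∈ Finset.univ.powersetCard S, ‖∑ i, samplingDev S s i • a i‖ ^ 2
      ≤ n.choose S * (1 / S * (1 / n * ∑ i, ‖a i - (1 / (n : ℝ)) • ∑ j, a j‖ ^ 2)) := by
  have hn : (0 : ℝ) < n := Nat.cast_pos.2 (hS.trans_le hSn)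
  have hSp : (0 : ℝ) < S := Nat.cast_pos.2 hS
  have hb : ∑ i, (a i - (1 / (n : ℝ)) • ∑ j, a j) = 0 := by
    rw [Finset.sum_sub_distrib, Finset.sum_const, Finset.card_univ, Fintype.card_fin,
      ← Nat.cast_smul_eq_nsmul ℝ n, smul_smul, mul_one_div_cancel hn.ne', one_smul, sub_self]
  have h1 := sum_powersetCard_norm_sq_le (n := n) hS hb
  have h2 : ∀ s ∈ (Finset.univ : Finset (Fin n)).powersetCard S,
      ‖∑ i, samplingDev S s i • a i‖ ^ 2
        = 1 / (S : ℝ) ^ 2 * ‖∑ i ∈ s, (a i - (1 / (n : ℝ)) • ∑ j, a j)‖ ^ 2 := by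
    intro s hs
    rw [sum_samplingDev_smul_eq hS hSn (Finset.mem_powersetCard.1 hs).2, norm_neg, norm_smul,
      mul_pow, Real.norm_of_nonneg (by positivity), one_div_pow]
  rw [Finset.sum_congr rfl h2, ← Finset.mul_sum]
  calc _ ≤ 1 / (S : ℝ) ^ 2 * (S / n * n.choose S
        * ∑ i, ‖a i - (1 / (n : ℝ)) • ∑ j, a j‖ ^ 2) := by gcongr
    _ = _ := by field_simp

end Sampling

end ALEXR

namespace ALEXR

/-! ### The past of a sequence of random variables -/

section Past

variable {Ω β : Type*} [mΩ : MeasurableSpace Ω] [MeasurableSpace β] {μ : Measure Ω}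

/-- The σ-algebra generated by the variables before time `t`. -/
@[reducible]
def past (W : ℕ → Ω → β) (t : ℕ) : MeasurableSpace Ω :=
  ⨆ k ∈ Set.Iio t, MeasurableSpace.comap (W k) inferInstance

theorem past_le {W : ℕ → Ω → β} (hW : ∀ t, Measurable (W t)) (t : ℕ) : past W t ≤ mΩ :=
  iSup₂_le fun k _ => (hW k).comap_le

omit mΩ in
theorem past_mono (W : ℕ → Ω → β) {s t : ℕ} (hst : s ≤ t) : past W s ≤ past W t :=
  biSup_mono fun _ hk => lt_of_lt_of_le hk hst

omit mΩ in
theorem measurable_past (W : ℕ → Ω → β) {s t : ℕ} (hst : s < t) : Measurable[past W t] (W s) := by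
  rw [measurable_iff_comap_le]
  exact le_biSup (fun k => MeasurableSpace.comap (W k) inferInstance) (Set.mem_Iio.2 hst)

theorem indep_past {W : ℕ → Ω → β} (hW : ∀ t, Measurable (W t)) (hind : iIndepFun W μ) (t : ℕ) :
    Indep (past W t) (MeasurableSpace.comap (W t) inferInstance) μ := by
  have h1 := indep_iSup_of_disjoint (fun k => (hW k).comap_le) hind.iIndep
    (S := Set.Iio t) (T := {t}) (by simp)
  simpa only [Set.mem_singleton_iff, iSup_iSup_eq_left] using h1

theorem indepFun_of_measurable_past {α : Type*} [MeasurableSpace α] {W : ℕ → Ω → β}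
    (hW : ∀ t, Measurable (W t)) (hind : iIndepFun W μ) {t : ℕ} {U : Ω → α}
    (hU : Measurable[past W t] U) : IndepFun U (W t) μ := by
  rw [IndepFun_iff_Indep]
  exact indep_of_indep_of_le_left (indep_past hW hind t) hU.comap_le

end Past

variable {n d m : ℕ} {Z : Type*} [MeasurableSpace Z] {p : Problem n d m Z}
  {K G Λ s₀ s₁ δ : ℝ} {τ η : ℝ}

/-! ### Proximal maps -/

/-- The proximal map of the dual block `i`. -/
def Problem.dualProx (p : Problem n d m Z) (τ : ℝ) (i : Fin n) (w : Vec m) : Vec m :=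
  Classical.epsilon fun z => p.IsDualStep τ i w 0 z

/-- A step with estimate `u` from `y` and a step with estimate `0` from `y + τ⁻¹ • u` have the same
argument in the nonexpansive bound, so they coincide. -/
theorem Problem.Regular.isDualStep_dualProx (h : p.Regular K G Λ s₀ s₁ δ) (hτ : 0 < τ) {i : Fin n}
    {w : Vec m} (hw : w ∈ dualSet (p.f i)) (y u : Vec m) :
    p.IsDualStep τ i y u (p.dualProx τ i (y + τ⁻¹ • u)) := by
  obtain ⟨z, hz⟩ := h.exists_isDualStep τ hw y u
  have h1 : p.IsDualStep τ i (y + τ⁻¹ • u) 0 (p.dualProx τ i (y + τ⁻¹ • u)) :=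
    Classical.epsilon_spec (h.exists_isDualStep τ hw (y + τ⁻¹ • u) 0)
  have h2 := hz.nonexpansive hτ h1
  rw [smul_zero, add_zero, sub_self, norm_zero, norm_le_zero_iff, sub_eq_zero] at h2
  rwa [← h2]

theorem Problem.Regular.measurable_dualProx (h : p.Regular K G Λ s₀ s₁ δ) (hτ : 0 < τ) {i : Fin n}
    {w : Vec m} (hw : w ∈ dualSet (p.f i)) : Measurable (p.dualProx τ i) := by
  have hlip : LipschitzWith 1 (p.dualProx τ i) := by
    refine LipschitzWith.of_dist_le_mul fun a b => ?_
    have ha := h.isDualStep_dualProx hτ hw a 0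
    have hb := h.isDualStep_dualProx hτ hw b 0
    have := ha.nonexpansive hτ hb
    simp only [smul_zero, add_zero] at this
    simpa [dist_eq_norm] using this
  exact hlip.continuous.measurable

/-- `Regular` does not provide minimizers for arbitrary data, since it drops closedness of `X` and
semicontinuity of `r`. The step is therefore a Lipschitz map on the set of arguments where it
exists, and this map is extended to the whole space. -/
theorem exists_measurable_primalProx (p : Problem n d m Z) (hη : 0 < η) :
    ∃ Φ : Vec d → Vec d, Measurable Φ ∧
      ∀ x c z, p.IsPrimalStep η x c z → z = Φ (x - η⁻¹ • c) := by
  classical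
  set A : Set (Vec d) := {w | ∃ x c z, p.IsPrimalStep η x c z ∧ w = x - η⁻¹ • c}
  have hex : ∀ w : Vec d, ∃ z, w ∈ A → ∃ x c, p.IsPrimalStep η x c z ∧ w = x - η⁻¹ • c := by
    intro w
    by_cases hw : w ∈ A
    · obtain ⟨x, c, z, hz, e⟩ := hw
      exact ⟨z, fun _ => ⟨x, c, hz, e⟩⟩
    · exact ⟨0, fun h => absurd h hw⟩
  choose φ hφ using hex
  have hlip : LipschitzOnWith 1 φ A := by
    refine LipschitzOnWith.of_dist_le_mul fun a ha b hb => ?_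
    obtain ⟨x, c, hz, e⟩ := hφ a ha
    obtain ⟨x', c', hz', e'⟩ := hφ b hb
    have := hz.nonexpansive hη hz'
    rw [← e, ← e'] at this
    simpa [dist_eq_norm] using this
  obtain ⟨Φ, hΦ, heq⟩ := hlip.extend_finite_dimension
  refine ⟨Φ, hΦ.continuous.measurable, fun x c z hz => ?_⟩
  have hmem : x - η⁻¹ • c ∈ A := ⟨x, c, z, hz, rfl⟩
  rw [← heq hmem]
  obtain ⟨x', c', hz', e'⟩ := hφ _ hmem
  have := hz.nonexpansive hη hz'
  rwa [← e', sub_self, norm_zero, norm_le_zero_iff, sub_eq_zero] at this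

/-! ### Measurability of the estimators -/

/-- The mean of the first-order oracle. It agrees with the derivative on the feasible set. -/
def Problem.meanDeriv (p : Problem n d m Z) (i : Fin n) (x : Vec d) : Vec d →L[ℝ] Vec m :=
  ∫ ζ, p.dgs i x ζ ∂(p.P i)

section Measurability

theorem Problem.Regular.measurable_g (h : p.Regular K G Λ s₀ s₁ δ) (i : Fin n) :
    Measurable (p.g i) := by
  have := h.prob i
  exact (h.gs_meas i).stronglyMeasurable.integral_prod_right'.measurable

theorem Problem.Regular.measurable_meanDeriv (h : p.Regular K G Λ s₀ s₁ δ) (i : Fin n) :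
    Measurable (p.meanDeriv i) := by
  have := h.prob i
  exact (h.dgs_meas i).stronglyMeasurable.integral_prod_right'.measurable

variable {Ω : Type*} [MeasurableSpace Ω] {B : ℕ} {X X' : Ω → Vec d} {b : Ω → Fin B → Z}

theorem measurable_smul_fun {E : Type*} [NormedAddCommGroup E] [NormedSpace ℝ E]
    [MeasurableSpace E] [BorelSpace E] {f : Ω → E} (hf : Measurable f) (c : ℝ) :
    Measurable fun ω => c • f ω :=
  hf.const_smul c

theorem measurable_adjoint_apply {A : Ω → Vec d →L[ℝ] Vec m} {v : Ω → Vec m} (hA : Measurable A)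
    (hv : Measurable v) : Measurable fun ω => (A ω).adjoint (v ω) := by
  have ha : Continuous fun A : Vec d →L[ℝ] Vec m => A.adjoint := LinearIsometryEquiv.continuous _
  have hc : Continuous fun w : (Vec d →L[ℝ] Vec m) × Vec m => w.1.adjoint w.2 :=
    (ha.comp continuous_fst).clm_apply continuous_snd
  have hm : Measurable fun w : (Vec d →L[ℝ] Vec m) × Vec m => w.1.adjoint w.2 := hc.measurable
  have h1 := hm.comp (hA.prodMk hv)
  exact h1

theorem Problem.Regular.measurable_gBatch (h : p.Regular K G Λ s₀ s₁ δ) (i : Fin n)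
    (hX : Measurable X) (hb : Measurable b) : Measurable fun ω => p.gBatch i (X ω) (b ω) := by
  unfold Problem.gBatch
  refine measurable_smul_fun (Finset.measurable_fun_sum _ fun j _ => ?_) _
  exact (h.gs_meas i).comp (hX.prodMk ((measurable_pi_apply j).comp hb))

theorem Problem.Regular.measurable_dgBatch (h : p.Regular K G Λ s₀ s₁ δ) (i : Fin n)
    (hX : Measurable X) (hb : Measurable b) : Measurable fun ω => p.dgBatch i (X ω) (b ω) := by
  unfold Problem.dgBatch
  have h1 : ∀ j, Measurable fun ω => p.dgs i (X ω) (b ω j) := fun j =>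
    (h.dgs_meas i).comp (hX.prodMk ((measurable_pi_apply j).comp hb))
  have h2 : Measurable fun ω => ∑ j, p.dgs i (X ω) (b ω j) :=
    Finset.measurable_fun_sum _ fun j _ => h1 j
  exact h2.const_smul (1 / (B : ℝ))

theorem Problem.Regular.measurable_gExtra (h : p.Regular K G Λ s₀ s₁ δ) (i : Fin n)
    (hX : Measurable X) (hX' : Measurable X') (hb : Measurable b) :
    Measurable fun ω => p.gExtra 1 i (X ω) (X' ω) (b ω) := by
  unfold Problem.gExtra
  exact (h.measurable_gBatch i hX hb).add
    (measurable_smul_fun ((h.measurable_gBatch i hX hb).sub (h.measurable_gBatch i hX' hb)) _)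

theorem measurable_sum_mem {E : Type*} [NormedAddCommGroup E] [MeasurableSpace E] [BorelSpace E]
    [SecondCountableTopology E] {s : Ω → Finset (Fin n)} (hs : Measurable s) {a : Fin n → Ω → E}
    (ha : ∀ i, Measurable (a i)) : Measurable fun ω => ∑ i ∈ s ω, a i ω := by
  have h1 : (fun ω => ∑ i ∈ s ω, a i ω) = fun ω => ∑ i, if i ∈ s ω then a i ω else 0 := by
    funext ω
    rw [Finset.sum_ite_mem, Finset.univ_inter]
  rw [h1]
  refine Finset.measurable_fun_sum _ fun i _ => Measurable.ite ?_ (ha i) measurable_const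
  exact hs (MeasurableSet.of_discrete (s := {s : Finset (Fin n) | i ∈ s}))

theorem measurable_samplingDev (S : ℕ) {s : Ω → Finset (Fin n)} (hs : Measurable s) (i : Fin n) :
    Measurable fun ω => samplingDev S (s ω) i :=
  (Measurable.of_discrete (f := fun s : Finset (Fin n) => samplingDev S s i)).comp hs

theorem Problem.Regular.measurable_gradEst (h : p.Regular K G Λ s₀ s₁ δ) (S : ℕ)
    {s : Ω → Finset (Fin n)} {y : Ω → Fin n → Vec m} {b : Ω → Fin n → Fin B → Z}
    (hs : Measurable s) (hX : Measurable X) (hy : Measurable y) (hb : Measurable b) :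
    Measurable fun ω => p.gradEst S (s ω) (X ω) (y ω) (b ω) := by
  unfold Problem.gradEst
  refine measurable_smul_fun (measurable_sum_mem hs fun i => ?_) _
  exact measurable_adjoint_apply (h.measurable_dgBatch i hX ((measurable_pi_apply i).comp hb))
    ((measurable_pi_apply i).comp hy)

end Measurability

/-! ### Runs as trajectories -/

section Run

variable {S B : ℕ} {x₀ : Vec d} {y₀ : Fin n → Vec m} {Ω : Type*} [mΩ : MeasurableSpace Ω]
  {μ : Measure Ω} {W : ℕ → Ω → Sample n B Z} {x : ℕ → Ω → Vec d} {y : ℕ → Ω → Fin n → Vec m}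

/-- The full dual step: the update of every block, sampled or not. -/
def Problem.fullDual (p : Problem n d m Z) (τ : ℝ) {B : ℕ} (x x' : Vec d) (y : Fin n → Vec m)
    (b : Fin n → Fin B → Z) (i : Fin n) : Vec m :=
  p.dualProx τ i (y i + τ⁻¹ • p.gExtra 1 i x x' (b i))

/-- The virtual dual step is defined for every block by the proximal map. On sampled blocks
uniqueness identifies it with the maximizer that the run has chosen. -/
theorem Problem.Regular.isTrajectory (h : p.Regular K G Λ s₀ s₁ δ) (hτ : 0 < τ)
    (hx₀ : x₀ ∈ p.X) (hy₀ : ∀ i, y₀ i ∈ dualSet (p.f i))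
    (hrun : IsRun p S B quad 1 η τ x₀ y₀ μ W x y) (ω : Ω) :
    p.IsTrajectory η τ (fun t => x t ω) (fun t => y t ω)
      (fun t => p.fullDual τ (x t ω) (x (t - 1) ω) (y t ω) (W t ω).2.1) (fun t => (W t ω).1)
      (fun t i => p.gExtra 1 i (x t ω) (x (t - 1) ω) ((W t ω).2.1 i))
      (fun t => p.gradEst S (W t ω).1 (x t ω) (y (t + 1) ω) (W t ω).2.2) where
  x_zero := by rwa [hrun.x_zero]
  y_zero i := by
    rw [hrun.y_zero]
    exact hy₀ i
  dual_step t i := h.isDualStep_dualProx hτ (hy₀ i) _ _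
  primal_step t := h.isPrimalStep_of_isMinOn (hrun.x_step t ω).1 (hrun.x_step t ω).2
  y_sampled t i hi := by
    have h1 := isDualStep_of_isMaxOn (hy₀ i) (hrun.y_sampled t ω i hi).2
    have h2 := h1.nonexpansive hτ (h.isDualStep_dualProx hτ (hy₀ i) (y t ω i)
      (p.gExtra 1 i (x t ω) (x (t - 1) ω) ((W t ω).2.1 i)))
    rwa [sub_self, norm_zero, norm_le_zero_iff, sub_eq_zero] at h2
  y_unsampled t i hi := hrun.y_unsampled t ω i hi

theorem Problem.Regular.measurable_fullDual (h : p.Regular K G Λ s₀ s₁ δ) (hτ : 0 < τ)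
    (hy₀ : ∀ i, y₀ i ∈ dualSet (p.f i)) {Ω : Type*} [MeasurableSpace Ω] {X X' : Ω → Vec d}
    {Y : Ω → Fin n → Vec m} {b : Ω → Fin n → Fin B → Z} (hX : Measurable X) (hX' : Measurable X')
    (hY : Measurable Y) (hb : Measurable b) :
    Measurable fun ω => p.fullDual τ (X ω) (X' ω) (Y ω) (b ω) := by
  refine measurable_pi_lambda _ fun i => ?_
  refine (h.measurable_dualProx hτ (hy₀ i)).comp ?_
  exact ((measurable_pi_apply i).comp hY).add
    (measurable_smul_fun (h.measurable_gExtra i hX hX' ((measurable_pi_apply i).comp hb)) _)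

/-- A run specifies its iterates only by optimality. Uniqueness of the proximal steps makes them
measurable functions of the earlier samples; the previous iterate is carried along because the
extrapolation uses it. -/
theorem Problem.Regular.measurable_past_iterates (h : p.Regular K G Λ s₀ s₁ δ) (hτ : 0 < τ)
    (hη : 0 < η) (hx₀ : x₀ ∈ p.X) (hy₀ : ∀ i, y₀ i ∈ dualSet (p.f i))
    (hrun : IsRun p S B quad 1 η τ x₀ y₀ μ W x y) (t : ℕ) :
    Measurable[past W t] (x t) ∧ Measurable[past W t] (x (t - 1)) ∧ Measurable[past W t] (y t) := by
  obtain ⟨Φ, hΦ, hstep⟩ := exists_measurable_primalProx p hη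
  have htraj := h.isTrajectory hτ hx₀ hy₀ hrun
  induction t with
  | zero =>
    rw [show x 0 = fun _ => x₀ from funext hrun.x_zero,
      show y 0 = fun _ => y₀ from funext hrun.y_zero]
    exact ⟨measurable_const, measurable_const, measurable_const⟩
  | succ t ih =>
    have hle := past_mono W (Nat.le_succ t)
    have hX : Measurable[past W (t + 1)] (x t) := ih.1.mono hle le_rfl
    have hX' : Measurable[past W (t + 1)] (x (t - 1)) := ih.2.1.mono hle le_rfl
    have hY : Measurable[past W (t + 1)] (y t) := ih.2.2.mono hle le_rfl
    have hW : Measurable[past W (t + 1)] (W t) := measurable_past W (Nat.lt_succ_self t)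
    -- Taking the σ-algebra of the past as the ambient one makes the general measurability lemmas
    -- apply to it.
    let _ : MeasurableSpace Ω := past W (t + 1)
    have hs : Measurable fun ω => (W t ω).1 := measurable_fst.comp hW
    have hb : Measurable fun ω => (W t ω).2.1 := (measurable_fst.comp measurable_snd).comp hW
    have hb' : Measurable fun ω => (W t ω).2.2 := (measurable_snd.comp measurable_snd).comp hW
    have hz := h.measurable_fullDual hτ hy₀ hX hX' hY hb
    have hy1 : Measurable (y (t + 1)) := by
      refine measurable_pi_iff.2 fun i => ?_
      have h1 : (fun ω => y (t + 1) ω i) = fun ω => if i ∈ (W t ω).1 then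
          p.fullDual τ (x t ω) (x (t - 1) ω) (y t ω) (W t ω).2.1 i else y t ω i := by
        funext ω
        split_ifs with hi
        · exact (htraj ω).y_sampled t i hi
        · exact (htraj ω).y_unsampled t i hi
      rw [h1]
      exact Measurable.ite (hs (MeasurableSet.of_discrete (s := {s : Finset (Fin n) | i ∈ s})))
        ((measurable_pi_apply i).comp hz) ((measurable_pi_apply i).comp hY)
    refine ⟨?_, hX, hy1⟩
    have h1 : x (t + 1) = fun ω => Φ (x t ω
        - η⁻¹ • p.gradEst S (W t ω).1 (x t ω) (y (t + 1) ω) (W t ω).2.2) :=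
      funext fun ω => hstep _ _ _ ((htraj ω).primal_step t)
    rw [h1]
    exact hΦ.comp (hX.sub (measurable_smul_fun (h.measurable_gradEst S hs hX hy1 hb') _))

end Run

end ALEXR

namespace ALEXR

/-! ### The law of one iteration -/

section Law

variable {n d m : ℕ} {Z : Type*} [MeasurableSpace Z] {p : Problem n d m Z}
  {K G Λ s₀ s₁ δ : ℝ} {τ η : ℝ} {S B : ℕ}

/-- This is `indepFun_prodMk_left` for identity maps into `Ω` with three different σ-algebras; a
join is the pullback of the product σ-algebra along the diagonal. -/
theorem indep_sup_left {Ω : Type*} [mΩ : MeasurableSpace Ω] {μ : Measure Ω} [IsProbabilityMeasure μ]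
    {m₁ m₂ m₃ : MeasurableSpace Ω} (h₁ : m₁ ≤ mΩ) (h₂ : m₂ ≤ mΩ) (h₃ : m₃ ≤ mΩ)
    (h : Indep m₁ (m₂ ⊔ m₃) μ) (h' : Indep m₂ m₃ μ) : Indep (m₁ ⊔ m₂) m₃ μ := by
  have e : ∀ a b : MeasurableSpace Ω, (a.prod b).comap (fun ω => (ω, ω)) = a ⊔ b := by
    intro a b
    unfold MeasurableSpace.prod
    rw [MeasurableSpace.comap_sup, MeasurableSpace.comap_comp, MeasurableSpace.comap_comp]
    exact congrArg₂ _ MeasurableSpace.comap_id MeasurableSpace.comap_id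
  have h1 := @indepFun_prodMk_left Ω Ω Ω Ω mΩ m₁ m₂ m₃ μ _ id id id
    (measurable_id'' h₁) (measurable_id'' h₂) (measurable_id'' h₃)
    (by
      refine (@IndepFun_iff_Indep Ω Ω (Ω × Ω) mΩ m₁ (m₂.prod m₃) _ _ μ).2 ?_
      rw [MeasurableSpace.comap_id]
      exact (e m₂ m₃).symm ▸ h)
    (by
      refine (@IndepFun_iff_Indep Ω Ω Ω mΩ m₂ m₃ _ _ μ).2 ?_
      rwa [MeasurableSpace.comap_id, MeasurableSpace.comap_id])
  have h2 := (@IndepFun_iff_Indep Ω (Ω × Ω) Ω mΩ (m₁.prod m₂) m₃ _ _ μ).1 h1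
  rw [MeasurableSpace.comap_id] at h2
  exact (e m₁ m₂) ▸ h2

/-- The σ-algebra of everything that determines the full dual step at time `t`. -/
@[reducible]
def pastDual {Ω : Type*} (W : ℕ → Ω → Sample n B Z) (t : ℕ) : MeasurableSpace Ω :=
  past W t ⊔ MeasurableSpace.comap (fun ω => (W t ω).2.1) inferInstance

/-- The σ-algebra of everything that precedes the sampling of the gradient at time `t`. -/
@[reducible]
def pastGrad {Ω : Type*} (W : ℕ → Ω → Sample n B Z) (t : ℕ) : MeasurableSpace Ω :=
  pastDual W t ⊔ MeasurableSpace.comap (fun ω => (W t ω).1) inferInstance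

variable {Ω : Type*} [mΩ : MeasurableSpace Ω] {μ : Measure Ω} [IsProbabilityMeasure μ]
  {W : ℕ → Ω → Sample n B Z}

theorem pastDual_le (hW : ∀ t, Measurable (W t)) (t : ℕ) : pastDual W t ≤ mΩ :=
  sup_le (past_le hW t) (((measurable_fst.comp measurable_snd).comp (hW t)).comap_le)

theorem pastGrad_le (hW : ∀ t, Measurable (W t)) (t : ℕ) : pastGrad W t ≤ mΩ :=
  sup_le (pastDual_le hW t) ((measurable_fst.comp (hW t)).comap_le)

omit mΩ in
theorem measurable_pastDual (W : ℕ → Ω → Sample n B Z) (t : ℕ) :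
    Measurable[pastDual W t] fun ω => (W t ω).2.1 :=
  measurable_iff_comap_le.2 le_sup_right

omit mΩ in
theorem measurable_pastGrad (W : ℕ → Ω → Sample n B Z) (t : ℕ) :
    Measurable[pastGrad W t] fun ω => (W t ω).1 :=
  measurable_iff_comap_le.2 le_sup_right

/-- The law of the sampled block set. -/
def blockLaw (n S : ℕ) : Measure (Finset (Fin n)) :=
  uniformOn ((Finset.univ.powersetCard S : Finset (Finset (Fin n))) : Set (Finset (Fin n)))

/-- The law of the batches. -/
def Problem.batchLaw (p : Problem n d m Z) (B : ℕ) : Measure (Fin n → Fin B → Z) :=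
  Measure.pi fun i => Measure.pi fun _ : Fin B => p.P i

theorem isProbabilityMeasure_blockLaw (hSn : S ≤ n) : IsProbabilityMeasure (blockLaw n S) :=
  isProbabilityMeasure_uniformOn_powersetCard hSn

theorem Problem.Regular.isProbabilityMeasure_batchLaw (h : p.Regular K G Λ s₀ s₁ δ) (B : ℕ) :
    IsProbabilityMeasure (p.batchLaw B) := by
  have := h.prob
  unfold Problem.batchLaw
  infer_instance

omit [IsProbabilityMeasure μ] in
theorem Problem.Regular.map_block (h : p.Regular K G Λ s₀ s₁ δ) (hSn : S ≤ n)
    {w : Ω → Sample n B Z} (hw : Measurable w) (hlaw : μ.map w = p.sampleLaw S B) :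
    μ.map (fun ω => (w ω).1) = blockLaw n S := by
  have := h.prob
  have := isProbabilityMeasure_blockLaw hSn
  have := h.isProbabilityMeasure_batchLaw B
  have h3 := Measure.map_map (μ := μ) (g := Prod.fst) measurable_fst hw
  rw [hlaw] at h3
  exact h3.symm.trans (measurePreserving_fst (μ := blockLaw n S)
    (ν := (p.batchLaw B).prod (p.batchLaw B))).map_eq

omit [IsProbabilityMeasure μ] in
theorem Problem.Regular.map_snd (h : p.Regular K G Λ s₀ s₁ δ) (hSn : S ≤ n)
    {w : Ω → Sample n B Z} (hw : Measurable w) (hlaw : μ.map w = p.sampleLaw S B) :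
    μ.map (fun ω => (w ω).2) = (p.batchLaw B).prod (p.batchLaw B) := by
  have := h.prob
  have := isProbabilityMeasure_blockLaw hSn
  have := h.isProbabilityMeasure_batchLaw B
  have h3 := Measure.map_map (μ := μ) (g := Prod.snd) measurable_snd hw
  rw [hlaw] at h3
  exact h3.symm.trans (measurePreserving_snd (μ := blockLaw n S)
    (ν := (p.batchLaw B).prod (p.batchLaw B))).map_eq

omit [IsProbabilityMeasure μ] in
theorem Problem.Regular.map_inner_batch (h : p.Regular K G Λ s₀ s₁ δ) (hSn : S ≤ n)
    {w : Ω → Sample n B Z} (hw : Measurable w) (hlaw : μ.map w = p.sampleLaw S B) (i : Fin n) :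
    μ.map (fun ω => (w ω).2.1 i) = Measure.pi fun _ : Fin B => p.P i := by
  have := h.prob
  have h1 : Measurable fun v : (Fin n → Fin B → Z) × (Fin n → Fin B → Z) => v.1 i :=
    (measurable_pi_apply i).comp measurable_fst
  have := h.isProbabilityMeasure_batchLaw B
  have h2 := (measurePreserving_eval (fun i => Measure.pi fun _ : Fin B => p.P i) i).comp
    (measurePreserving_fst (μ := p.batchLaw B) (ν := p.batchLaw B))
  have h3 := Measure.map_map (μ := μ) h1 (measurable_snd.comp hw)
  rw [show μ.map (Prod.snd ∘ w) = _ from h.map_snd hSn hw hlaw] at h3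
  exact h3.symm.trans h2.map_eq

omit [IsProbabilityMeasure μ] in
theorem Problem.Regular.map_outer_batch (h : p.Regular K G Λ s₀ s₁ δ) (hSn : S ≤ n)
    {w : Ω → Sample n B Z} (hw : Measurable w) (hlaw : μ.map w = p.sampleLaw S B) :
    μ.map (fun ω => (w ω).2.2) = p.batchLaw B := by
  have := h.prob
  have := h.isProbabilityMeasure_batchLaw B
  have h3 := Measure.map_map (μ := μ) (measurable_snd (α := Fin n → Fin B → Z)
    (β := Fin n → Fin B → Z)) (measurable_snd.comp hw)
  rw [show μ.map (Prod.snd ∘ w) = _ from h.map_snd hSn hw hlaw] at h3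
  exact h3.symm.trans measurePreserving_snd.map_eq

omit [IsProbabilityMeasure μ] in
theorem Problem.Regular.indepFun_batches_block (h : p.Regular K G Λ s₀ s₁ δ) (hSn : S ≤ n)
    {w : Ω → Sample n B Z} (hw : Measurable w) (hlaw : μ.map w = p.sampleLaw S B) :
    IndepFun (fun ω => (w ω).2) (fun ω => (w ω).1) μ := by
  have := h.prob
  have := isProbabilityMeasure_blockLaw hSn
  refine (indepFun_comp_of_map hw measurable_fst measurable_snd ?_).symm
  rw [hlaw]
  have := h.isProbabilityMeasure_batchLaw B
  exact indepFun_prod (μ := blockLaw n S) (ν := (p.batchLaw B).prod (p.batchLaw B))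
    measurable_id measurable_id

omit [IsProbabilityMeasure μ] in
theorem Problem.Regular.indepFun_inner_outer (h : p.Regular K G Λ s₀ s₁ δ) (hSn : S ≤ n)
    {w : Ω → Sample n B Z} (hw : Measurable w) (hlaw : μ.map w = p.sampleLaw S B) :
    IndepFun (fun ω => (w ω).2.1) (fun ω => (w ω).2.2) μ := by
  have := h.prob
  have := h.isProbabilityMeasure_batchLaw B
  refine indepFun_comp_of_map (measurable_snd.comp hw) measurable_fst measurable_snd ?_
  have h1 := h.map_snd hSn hw hlaw
  change IndepFun _ _ (μ.map fun ω => (w ω).2)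
  rw [h1]
  exact indepFun_prod measurable_id measurable_id

omit mΩ in
theorem comap_sup_comap_le {α β γ : Type*} [MeasurableSpace α] [MeasurableSpace β]
    [MeasurableSpace γ] {w : Ω → α} {f : α → β} {g : α → γ} (hf : Measurable f)
    (hg : Measurable g) :
    MeasurableSpace.comap (fun ω => f (w ω)) inferInstance
      ⊔ MeasurableSpace.comap (fun ω => g (w ω)) inferInstance
      ≤ MeasurableSpace.comap w inferInstance :=
  sup_le (by
    rw [← measurable_iff_comap_le]
    exact hf.comp (comap_measurable w)) (by
    rw [← measurable_iff_comap_le]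
    exact hg.comp (comap_measurable w))

/-- The sampled block set is independent of everything that determines the full dual step. -/
theorem Problem.Regular.indep_pastDual_block (h : p.Regular K G Λ s₀ s₁ δ) (hSn : S ≤ n)
    (hW : ∀ t, Measurable (W t)) (hind : iIndepFun W μ)
    (hlaw : ∀ t, μ.map (W t) = p.sampleLaw S B) (t : ℕ) :
    Indep (pastDual W t) (MeasurableSpace.comap (fun ω => (W t ω).1) inferInstance) μ := by
  have hb : Measurable fun ω => (W t ω).2.1 := (measurable_fst.comp measurable_snd).comp (hW t)
  have hs : Measurable fun ω => (W t ω).1 := measurable_fst.comp (hW t)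
  refine indep_sup_left (past_le hW t) hb.comap_le hs.comap_le ?_ ?_
  · exact indep_of_indep_of_le_right (indep_past hW hind t)
      (comap_sup_comap_le (measurable_fst.comp measurable_snd) measurable_fst)
  · exact (h.indepFun_batches_block hSn (hW t) (hlaw t)).comp measurable_fst measurable_id

/-- The batches for the gradient are independent of everything before. -/
theorem Problem.Regular.indep_pastGrad_batch (h : p.Regular K G Λ s₀ s₁ δ) (hSn : S ≤ n)
    (hW : ∀ t, Measurable (W t)) (hind : iIndepFun W μ)
    (hlaw : ∀ t, μ.map (W t) = p.sampleLaw S B) (t : ℕ) :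
    Indep (pastGrad W t) (MeasurableSpace.comap (fun ω => (W t ω).2.2) inferInstance) μ := by
  have hb : Measurable fun ω => (W t ω).2.1 := (measurable_fst.comp measurable_snd).comp (hW t)
  have hb' : Measurable fun ω => (W t ω).2.2 := (measurable_snd.comp measurable_snd).comp (hW t)
  have hs : Measurable fun ω => (W t ω).1 := measurable_fst.comp (hW t)
  have h0 := indep_past hW hind t
  unfold pastGrad pastDual
  rw [sup_assoc]
  -- The past is split off first; what remains is independence inside a single sample, of the block
  -- set and the inner batches from the outer batches.
  refine indep_sup_left (past_le hW t) (sup_le hb.comap_le hs.comap_le) hb'.comap_le ?_ ?_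
  · refine indep_of_indep_of_le_right h0 (sup_le ?_ ?_)
    · exact comap_sup_comap_le (measurable_fst.comp measurable_snd) measurable_fst
    · exact measurable_iff_comap_le.1
        ((measurable_snd.comp measurable_snd).comp (comap_measurable (W t)))
  · rw [sup_comm]
    refine indep_sup_left hs.comap_le hb.comap_le hb'.comap_le ?_ ?_
    · refine indep_of_indep_of_le_right
        ((h.indepFun_batches_block hSn (hW t) (hlaw t)).symm) ?_
      exact comap_sup_comap_le (w := fun ω => (W t ω).2) measurable_fst measurable_snd
    · exact h.indepFun_inner_outer hSn (hW t) (hlaw t)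

end Law

end ALEXR

namespace ALEXR

/-! ### Moments of the estimation errors -/

section BatchMean

variable {A F : Type*} [MeasurableSpace A] {P : Measure A} [IsProbabilityMeasure P]
  [NormedAddCommGroup F] [InnerProductSpace ℝ F] [CompleteSpace F] [MeasurableSpace F]
  [BorelSpace F] {B : ℕ}

omit [CompleteSpace F] [MeasurableSpace F] [BorelSpace F] in
theorem memLp_batchMean {φ : A → F} (hφ : MemLp φ 2 P) :
    MemLp (fun b : Fin B → A => (1 / (B : ℝ)) • ∑ j, φ (b j)) 2 (Measure.pi fun _ => P) := by
  have h1 : ∀ j ∈ Finset.univ, MemLp (fun b : Fin B → A => φ (b j)) 2 (Measure.pi fun _ => P) :=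
    fun j _ => memLp_eval (P := fun _ : Fin B => P) j hφ
  have h2 : MemLp (fun b : Fin B → A => ∑ j, φ (b j)) 2 (Measure.pi fun _ => P) :=
    memLp_finsetSum _ h1
  exact h2.const_smul (1 / (B : ℝ))

omit [CompleteSpace F] [MeasurableSpace F] [BorelSpace F] in
theorem integral_batchMean {φ : A → F} (hφ : MemLp φ 2 P) (hzero : ∫ a, φ a ∂P = 0) :
    ∫ b : Fin B → A, (1 / (B : ℝ)) • ∑ j, φ (b j) ∂(Measure.pi fun _ => P) = 0 := by
  rw [integral_smul, integral_finsetSum _ fun j _ =>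
    (memLp_eval (P := fun _ : Fin B => P) j hφ).integrable one_le_two,
    Finset.sum_eq_zero, smul_zero]
  intro j _
  rw [integral_comp_eval (μ := fun _ : Fin B => P) hφ.1, hzero]

theorem integral_batchMean_norm_sq_le (hB : 0 < B) {φ : A → F} (hφ : MemLp φ 2 P)
    (hzero : ∫ a, φ a ∂P = 0) {c : ℝ} (hc : ∫ a, ‖φ a‖ ^ 2 ∂P ≤ c) :
    ∫ b : Fin B → A, ‖(1 / (B : ℝ)) • ∑ j, φ (b j)‖ ^ 2 ∂(Measure.pi fun _ => P) ≤ c / B := by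
  have hBp : (0 : ℝ) < B := Nat.cast_pos.2 hB
  simp only [norm_smul, mul_pow, norm_div, norm_one, RCLike.norm_natCast]
  rw [integral_const_mul, integral_norm_sum_sq_pi (P := fun _ : Fin B => P) (fun _ => hφ)
    (fun _ => hzero), Finset.sum_const, Finset.card_univ, Fintype.card_fin, nsmul_eq_mul]
  calc (1 / (B : ℝ)) ^ 2 * (B * ∫ a, ‖φ a‖ ^ 2 ∂P) = (∫ a, ‖φ a‖ ^ 2 ∂P) / B := by
        field_simp
    _ ≤ c / B := by gcongr

end BatchMean

variable {n d m : ℕ} {Z : Type*} [MeasurableSpace Z] {p : Problem n d m Z}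
  {K G Λ s₀ s₁ δ : ℝ} {S B : ℕ}

/-! ### Errors of the extrapolated inner estimates -/

section InnerError

/-- The error of a single sample of the extrapolated inner function. -/
def Problem.sampleError (p : Problem n d m Z) (i : Fin n) (x x' : Vec d) (ζ : Z) : Vec m :=
  (2 : ℝ) • (p.g i x - p.gs i x ζ) - (p.g i x' - p.gs i x' ζ)

/-- Both evaluations in the extrapolation use the same batch, so the error is a mean of independent
single-sample errors and gains the factor `1/B`. -/
theorem innerError_gExtra (hB : 0 < B) (i : Fin n) (x x' : Vec d) (b : Fin B → Z) :
    p.innerError i x x' (p.gExtra 1 i x x' b)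
      = (1 / (B : ℝ)) • ∑ j, p.sampleError i x x' (b j) := by
  have hBp : (B : ℝ) ≠ 0 := Nat.cast_ne_zero.2 hB.ne'
  have hmean : ∀ v : Vec m, (1 / (B : ℝ)) • ∑ _j : Fin B, v = v := fun v => by
    rw [Finset.sum_const, Finset.card_univ, Fintype.card_fin, ← Nat.cast_smul_eq_nsmul ℝ,
      smul_smul, one_div_mul_cancel hBp, one_smul]
  simp only [Problem.innerError, Problem.gExtra, Problem.gBatch, Problem.sampleError,
    Finset.sum_sub_distrib, ← Finset.smul_sum, smul_sub, hmean]
  rw [smul_comm (1 / (B : ℝ)) (2 : ℝ) (∑ _j : Fin B, p.g i x),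
    smul_comm (1 / (B : ℝ)) (2 : ℝ) (∑ j : Fin B, p.gs i x (b j)), hmean]
  module

variable (h : p.Regular K G Λ s₀ s₁ δ) {i : Fin n} {x x' : Vec d}
include h

theorem Problem.Regular.memLp_sampleError (hx : x ∈ p.X) (hx' : x' ∈ p.X) :
    MemLp (p.sampleError i x x') 2 (p.P i) := by
  have := h.prob i
  exact (((memLp_const _).sub (h.gs_memLp i x hx)).const_smul (2 : ℝ)).sub
    ((memLp_const _).sub (h.gs_memLp i x' hx'))

theorem Problem.Regular.integral_sampleError (hx : x ∈ p.X) (hx' : x' ∈ p.X) :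
    ∫ ζ, p.sampleError i x x' ζ ∂(p.P i) = 0 := by
  have := h.prob i
  have h1 : ∀ x ∈ p.X, Integrable (fun ζ => p.g i x - p.gs i x ζ) (p.P i) := fun x hx =>
    (integrable_const _).sub ((h.gs_memLp i x hx).integrable one_le_two)
  have h2 : ∀ x ∈ p.X, ∫ ζ, (p.g i x - p.gs i x ζ) ∂(p.P i) = 0 := fun x hx => by
    rw [integral_sub (integrable_const _) ((h.gs_memLp i x hx).integrable one_le_two)]
    simp [Problem.g]
  have h3 : Integrable (fun ζ => (2 : ℝ) • (p.g i x - p.gs i x ζ)) (p.P i) := 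
    (h1 x hx).smul (2 : ℝ)
  unfold Problem.sampleError
  rw [integral_sub h3 (h1 x' hx'), integral_smul, h2 x hx, h2 x' hx']
  simp

/-- The constant is `8 + 2`, from `(2 a + b)² ≤ 8 a² + 2 b²`. -/
theorem Problem.Regular.integral_sampleError_norm_sq_le (hx : x ∈ p.X) (hx' : x' ∈ p.X) :
    ∫ ζ, ‖p.sampleError i x x' ζ‖ ^ 2 ∂(p.P i) ≤ 10 * s₀ ^ 2 := by
  have := h.prob i
  have h1 : ∀ x ∈ p.X, Integrable (fun ζ => ‖p.g i x - p.gs i x ζ‖ ^ 2) (p.P i) := fun x hx =>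
    ((memLp_const (p.g i x)).sub (h.gs_memLp i x hx)).integrable_norm_pow two_ne_zero
  have h2 : ∫ ζ, ‖p.sampleError i x x' ζ‖ ^ 2 ∂(p.P i)
      ≤ ∫ ζ, (8 * ‖p.g i x - p.gs i x ζ‖ ^ 2 + 2 * ‖p.g i x' - p.gs i x' ζ‖ ^ 2) ∂(p.P i) := by
    refine integral_mono ((h.memLp_sampleError hx hx').integrable_norm_pow two_ne_zero)
      (((h1 x hx).const_mul 8).add ((h1 x' hx').const_mul 2)) fun ζ => ?_
    have h3 := norm_sub_le ((2 : ℝ) • (p.g i x - p.gs i x ζ)) (p.g i x' - p.gs i x' ζ)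
    rw [norm_smul, Real.norm_of_nonneg zero_le_two] at h3
    have h4 : ‖p.sampleError i x x' ζ‖ ^ 2
        ≤ (2 * ‖p.g i x - p.gs i x ζ‖ + ‖p.g i x' - p.gs i x' ζ‖) ^ 2 := by
      gcongr
      exact h3
    show ‖p.sampleError i x x' ζ‖ ^ 2 ≤ _
    nlinarith [sq_nonneg (2 * ‖p.g i x - p.gs i x ζ‖ - ‖p.g i x' - p.gs i x' ζ‖)]
  rw [integral_add ((h1 x hx).const_mul 8) ((h1 x' hx').const_mul 2), integral_const_mul,
    integral_const_mul] at h2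
  linarith [h.gs_var i x hx, h.gs_var i x' hx']

end InnerError

/-! ### Errors of the gradient estimates: oracle noise and block sampling -/

section GradientError

theorem adjoint_sub_apply (A A' : Vec d →L[ℝ] Vec m) (v : Vec m) :
    (A - A').adjoint v = A.adjoint v - A'.adjoint v := by
  rw [map_sub]
  rfl

/-- The error of a single sample of the gradient of block `i`. -/
def Problem.sampleGradError (p : Problem n d m Z) (i : Fin n) (x : Vec d) (v : Vec m) (ζ : Z) :
    Vec d :=
  (p.meanDeriv i x).adjoint v - (p.dgs i x ζ).adjoint v

/-- The error of the gradient estimate that is due to the first-order oracle. -/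
def Problem.oracleError (p : Problem n d m Z) (S : ℕ) (s : Finset (Fin n)) (x : Vec d)
    (z : Fin n → Vec m) (b : Fin n → Fin B → Z) : Vec d :=
  (1 / (S : ℝ)) • ∑ i ∈ s, (1 / (B : ℝ)) • ∑ j, p.sampleGradError i x (z i) (b i j)

/-- The error of the gradient estimate that is due to the sampling of blocks. -/
def Problem.blockError (p : Problem n d m Z) (S : ℕ) (s : Finset (Fin n)) (x : Vec d)
    (z : Fin n → Vec m) : Vec d :=
  ∑ i, samplingDev S s i • (p.meanDeriv i x).adjoint (z i)

theorem adjoint_dgBatch (i : Fin n) (x : Vec d) (b : Fin B → Z) (v : Vec m) :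
    (p.dgBatch i x b).adjoint v = (1 / (B : ℝ)) • ∑ j, (p.dgs i x (b j)).adjoint v := by
  rw [Problem.dgBatch, map_smulₛₗ, map_sum]
  simp

variable (h : p.Regular K G Λ s₀ s₁ δ)
include h

theorem Problem.Regular.meanDeriv_eq {x : Vec d} (hx : x ∈ p.X) (i : Fin n) :
    p.meanDeriv i x = p.dg i x :=
  h.dgs_unbiased i x hx

/-- Insert the sampled average of exact block gradients: the first difference is centred given the
full dual step, the second given also the block set. The errors are written with `meanDeriv`, which
is measurable, whereas `dg` need not be. -/
theorem Problem.Regular.fullGrad_sub_gradEst (hB : 0 < B) {s : Finset (Fin n)} {x : Vec d}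
    (hx : x ∈ p.X) {y z : Fin n → Vec m} (hy : ∀ i ∈ s, y i = z i) (b : Fin n → Fin B → Z) :
    p.fullGrad x z - p.gradEst S s x y b = p.blockError S s x z + p.oracleError S s x z b := by
  have hBp : (B : ℝ) ≠ 0 := Nat.cast_ne_zero.2 hB.ne'
  have h1 : p.blockError S s x z
      = p.fullGrad x z - (1 / (S : ℝ)) • ∑ i ∈ s, (p.meanDeriv i x).adjoint (z i) := by
    simp only [Problem.blockError, samplingDev, sub_smul, ite_smul, zero_smul]
    rw [Finset.sum_sub_distrib, Finset.sum_ite_mem, Finset.univ_inter, ← Finset.smul_sum,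
      ← Finset.smul_sum]
    simp only [Problem.fullGrad, h.meanDeriv_eq hx]
  have h2 : p.oracleError S s x z b = (1 / (S : ℝ)) • ∑ i ∈ s, (p.meanDeriv i x).adjoint (z i)
      - p.gradEst S s x y b := by
    rw [Problem.oracleError, Problem.gradEst, ← smul_sub, ← Finset.sum_sub_distrib]
    congr 1
    refine Finset.sum_congr rfl fun i hi => ?_
    rw [hy i hi, adjoint_dgBatch]
    simp only [Problem.sampleGradError]
    rw [Finset.sum_sub_distrib, smul_sub, Finset.sum_const, Finset.card_univ, Fintype.card_fin,
      ← Nat.cast_smul_eq_nsmul ℝ, smul_smul, one_div_mul_cancel hBp, one_smul]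
  rw [h1, h2]
  abel

theorem Problem.Regular.memLp_sampleGradError {i : Fin n} {x : Vec d} (hx : x ∈ p.X) (v : Vec m) :
    MemLp (p.sampleGradError i x v) 2 (p.P i) := by
  have := h.prob i
  have h1 := (memLp_const (p := 2) (μ := p.P i) (p.meanDeriv i x)).sub (h.dgs_memLp i x hx)
  refine (h1.norm.const_mul ‖v‖).mono' ?_ (ae_of_all _ fun ζ => ?_)
  · have h2 : Measurable fun ζ => (p.dgs i x ζ).adjoint v :=
      measurable_adjoint_apply ((h.dgs_meas i).comp measurable_prodMk_left) measurable_const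
    exact (measurable_const.sub h2).aestronglyMeasurable
  · rw [Problem.sampleGradError, ← adjoint_sub_apply, mul_comm]
    refine (ContinuousLinearMap.le_opNorm _ _).trans_eq ?_
    rw [LinearIsometryEquiv.norm_map]
    rfl

/-- Testing against an arbitrary `w` moves the adjoint away from the random operator, so
unbiasedness can be applied to evaluations. -/
theorem Problem.Regular.integral_sampleGradError {i : Fin n} {x : Vec d} (hx : x ∈ p.X)
    (v : Vec m) : ∫ ζ, p.sampleGradError i x v ζ ∂(p.P i) = 0 := by
  have := h.prob i
  have h1 : Integrable (fun ζ => p.dgs i x ζ) (p.P i) :=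
    (h.dgs_memLp i x hx).integrable one_le_two
  have h2 := (h.memLp_sampleGradError hx v (i := i)).integrable one_le_two
  refine ext_inner_left ℝ fun w => ?_
  rw [← integral_inner h2, inner_zero_right]
  have h3 : ∀ ζ, ⟪w, p.sampleGradError i x v ζ⟫ = ⟪v, p.meanDeriv i x w⟫ - ⟪v, p.dgs i x ζ w⟫ := by
    intro ζ
    rw [Problem.sampleGradError, inner_sub_right, ContinuousLinearMap.adjoint_inner_right,
      ContinuousLinearMap.adjoint_inner_right, real_inner_comm, real_inner_comm v]
  have h4 : Integrable (fun ζ => p.dgs i x ζ w) (p.P i) := h1.apply_continuousLinearMap w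
  simp only [h3]
  rw [integral_sub (integrable_const _) (h4.const_inner v), integral_inner h4,
    ← ContinuousLinearMap.integral_apply h1]
  simp [Problem.meanDeriv]

theorem Problem.Regular.integral_sampleGradError_norm_sq_le {i : Fin n} {x : Vec d} (hx : x ∈ p.X)
    {v : Vec m} (hv : v ∈ dualSet (p.f i)) :
    ∫ ζ, ‖p.sampleGradError i x v ζ‖ ^ 2 ∂(p.P i) ≤ K ^ 2 * s₁ ^ 2 := by
  have := h.prob i
  have h1 := (memLp_const (p := 2) (μ := p.P i) (p.dg i x)).sub (h.dgs_memLp i x hx)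
  have h2 : ∫ ζ, ‖p.sampleGradError i x v ζ‖ ^ 2 ∂(p.P i)
      ≤ ∫ ζ, K ^ 2 * ‖p.dg i x - p.dgs i x ζ‖ ^ 2 ∂(p.P i) := by
    refine integral_mono ((h.memLp_sampleGradError hx v).integrable_norm_pow two_ne_zero)
      ((h1.integrable_norm_pow two_ne_zero).const_mul _) fun ζ => ?_
    show ‖p.sampleGradError i x v ζ‖ ^ 2 ≤ K ^ 2 * ‖p.dg i x - p.dgs i x ζ‖ ^ 2
    rw [Problem.sampleGradError, ← adjoint_sub_apply, ← mul_pow, h.meanDeriv_eq hx, mul_comm]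
    gcongr
    refine (ContinuousLinearMap.le_opNorm _ _).trans ?_
    rw [LinearIsometryEquiv.norm_map]
    gcongr
    exact h.norm_le hv
  rw [integral_const_mul] at h2
  exact h2.trans (mul_le_mul_of_nonneg_left (h.dgs_var i x hx) (sq_nonneg _))

theorem Problem.Regular.memLp_oracleError (s : Finset (Fin n)) {x : Vec d} (hx : x ∈ p.X)
    (z : Fin n → Vec m) : MemLp (fun b => p.oracleError S s x z b) 2 (p.batchLaw B) := by
  have := h.prob
  have h1 : ∀ i ∈ s, MemLp (fun b : Fin n → Fin B → Z =>
      (1 / (B : ℝ)) • ∑ j, p.sampleGradError i x (z i) (b i j)) 2 (p.batchLaw B) := fun i _ =>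
    memLp_eval (P := fun i => Measure.pi fun _ : Fin B => p.P i) i
      (memLp_batchMean (h.memLp_sampleGradError hx (z i)))
  have h2 : MemLp (fun b : Fin n → Fin B → Z =>
      ∑ i ∈ s, (1 / (B : ℝ)) • ∑ j, p.sampleGradError i x (z i) (b i j)) 2 (p.batchLaw B) :=
    memLp_finsetSum _ h1
  exact h2.const_smul (1 / (S : ℝ))

theorem Problem.Regular.integral_oracleError (s : Finset (Fin n)) {x : Vec d} (hx : x ∈ p.X)
    (z : Fin n → Vec m) : ∫ b, p.oracleError S s x z b ∂(p.batchLaw B) = 0 := by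
  have := h.prob
  have h1 := fun i => memLp_batchMean (B := B) (h.memLp_sampleGradError (i := i) hx (z i))
  unfold Problem.oracleError Problem.batchLaw
  rw [integral_smul, integral_finsetSum _ fun i _ =>
    (memLp_eval (P := fun i => Measure.pi fun _ : Fin B => p.P i) i (h1 i)).integrable one_le_two,
    Finset.sum_eq_zero, smul_zero]
  intro i _
  rw [integral_comp_eval (μ := fun i => Measure.pi fun _ : Fin B => p.P i) (h1 i).1,
    integral_batchMean (h.memLp_sampleGradError hx (z i)) (h.integral_sampleGradError hx (z i))]

/-- A mean of `S` independent centred terms. The further factor `1/B` is not needed and is bounded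
by one. -/
theorem Problem.Regular.integral_oracleError_norm_sq_le (hS : 0 < S) (hB : 0 < B)
    {s : Finset (Fin n)} (hs : s.card = S) {x : Vec d} (hx : x ∈ p.X)
    {z : Fin n → Vec m} (hz : ∀ i, z i ∈ dualSet (p.f i)) :
    ∫ b, ‖p.oracleError S s x z b‖ ^ 2 ∂(p.batchLaw B) ≤ K ^ 2 * s₁ ^ 2 / S := by
  have := h.prob
  have hSp : (0 : ℝ) < S := Nat.cast_pos.2 hS
  have hBp : (1 : ℝ) ≤ B := Nat.one_le_cast.2 hB
  have h1 := fun i => memLp_batchMean (B := B) (h.memLp_sampleGradError (i := i) hx (z i))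
  unfold Problem.oracleError Problem.batchLaw
  simp only [norm_smul (1 / (S : ℝ)), mul_pow, norm_div, norm_one, RCLike.norm_natCast]
  rw [integral_const_mul, integral_norm_sum_sq_pi
    (P := fun i => Measure.pi fun _ : Fin B => p.P i) h1 fun i =>
      integral_batchMean (h.memLp_sampleGradError hx (z i)) (h.integral_sampleGradError hx (z i))]
  have h2 : ∀ i ∈ s, ∫ b : Fin B → Z, ‖(1 / (B : ℝ)) • ∑ j, p.sampleGradError i x (z i) (b j)‖ ^ 2
      ∂(Measure.pi fun _ => p.P i) ≤ K ^ 2 * s₁ ^ 2 := fun i _ => by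
    refine (integral_batchMean_norm_sq_le hB (h.memLp_sampleGradError hx (z i))
      (h.integral_sampleGradError hx (z i))
      (h.integral_sampleGradError_norm_sq_le hx (hz i))).trans ?_
    exact div_le_self (by positivity) hBp
  have h3 := mul_le_mul_of_nonneg_left (Finset.sum_le_sum h2) (sq_nonneg (1 / (S : ℝ)))
  refine h3.trans_eq ?_
  rw [Finset.sum_const, hs, nsmul_eq_mul]
  field_simp

/-- Sampling without replacement averages the deviations between block gradients, whose mean square
is at most `δ²`. -/
theorem Problem.Regular.integral_blockError_norm_sq_le (hS : 0 < S) (hSn : S ≤ n) {x : Vec d}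
    (hx : x ∈ p.X) {z : Fin n → Vec m} (hz : ∀ i, z i ∈ dualSet (p.f i)) :
    ∫ s, ‖p.blockError S s x z‖ ^ 2 ∂(blockLaw n S) ≤ δ ^ 2 / S := by
  have hSp : (0 : ℝ) < S := Nat.cast_pos.2 hS
  have hch : (0 : ℝ) < n.choose S := Nat.cast_pos.2 (Nat.choose_pos hSn)
  unfold blockLaw Problem.blockError
  rw [integral_uniformOn_powersetCard, smul_eq_mul, inv_mul_le_iff₀ hch]
  refine (sum_powersetCard_samplingDev_norm_sq_le hS hSn _).trans ?_
  simp only [h.meanDeriv_eq hx]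
  have h1 := h.var_block x hx z hz
  calc _ ≤ (n.choose S : ℝ) * (1 / S * δ ^ 2) := by gcongr
    _ = _ := by ring

end GradientError

theorem integral_samplingDev (hS : 0 < S) (hSn : S ≤ n) (i : Fin n) :
    ∫ s, samplingDev S s i ∂(blockLaw n S) = 0 := by
  rw [blockLaw, integral_uniformOn_powersetCard, sum_samplingDev hS hSn, smul_zero]

theorem integral_samplingDev_sq_le (hS : 0 < S) (hSn : S ≤ n) (i : Fin n) :
    ∫ s, samplingDev S s i ^ 2 ∂(blockLaw n S) ≤ 1 / n * (1 / S) := by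
  have hch : (0 : ℝ) < n.choose S := Nat.cast_pos.2 (Nat.choose_pos hSn)
  rw [blockLaw, integral_uniformOn_powersetCard, smul_eq_mul, inv_mul_le_iff₀ hch]
  exact sum_samplingDev_sq_le hS hSn i

theorem integral_blockError (hS : 0 < S) (hSn : S ≤ n) (x : Vec d) (z : Fin n → Vec m) :
    ∫ s, p.blockError S s x z ∂(blockLaw n S) = 0 := by
  have := isProbabilityMeasure_blockLaw hSn
  unfold Problem.blockError
  rw [integral_finsetSum _ fun i _ => Integrable.of_finite, Finset.sum_eq_zero]
  intro i _
  rw [integral_smul_const, integral_samplingDev hS hSn, zero_smul]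

end ALEXR

namespace ALEXR

/-! ### Expectations along a run -/

section RunMoments

variable {n d m : ℕ} {Z : Type*} [MeasurableSpace Z] {p : Problem n d m Z}
  {K G Λ s₀ s₁ δ : ℝ} {S B : ℕ} {η τ : ℝ} {x₀ : Vec d} {y₀ : Fin n → Vec m}

/-- A run of the algorithm on a problem with regular data and admissible parameters. -/
structure RegularRun (p : Problem n d m Z) (K G Λ s₀ s₁ δ : ℝ) (S B : ℕ) (η τ : ℝ) (x₀ : Vec d)
    (y₀ : Fin n → Vec m) {Ω : Type*} [MeasurableSpace Ω] (μ : Measure Ω)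
    (W : ℕ → Ω → Sample n B Z) (x : ℕ → Ω → Vec d) (y : ℕ → Ω → Fin n → Vec m) : Prop where
  regular : p.Regular K G Λ s₀ s₁ δ
  run : IsRun p S B quad 1 η τ x₀ y₀ μ W x y
  S_pos : 0 < S
  S_le : S ≤ n
  B_pos : 0 < B
  η_pos : 0 < η
  τ_pos : 0 < τ
  x₀_mem : x₀ ∈ p.X
  y₀_mem : ∀ i, y₀ i ∈ dualSet (p.f i)

variable {Ω : Type*} [mΩ : MeasurableSpace Ω] {μ : Measure Ω} [IsProbabilityMeasure μ]
  {W : ℕ → Ω → Sample n B Z} {x : ℕ → Ω → Vec d} {y : ℕ → Ω → Fin n → Vec m}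

/-- The full dual step at time `t`. -/
abbrev Problem.dualIter (p : Problem n d m Z) (τ : ℝ) (W : ℕ → Ω → Sample n B Z)
    (x : ℕ → Ω → Vec d) (y : ℕ → Ω → Fin n → Vec m) (t : ℕ) (ω : Ω) : Fin n → Vec m :=
  p.fullDual τ (x t ω) (x (t - 1) ω) (y t ω) (W t ω).2.1

/-- The error of the estimate of the extrapolated inner function `i` at time `t`. -/
abbrev Problem.innerErr (p : Problem n d m Z) (W : ℕ → Ω → Sample n B Z) (x : ℕ → Ω → Vec d)
    (i : Fin n) (t : ℕ) (ω : Ω) : Vec m :=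
  p.innerError i (x t ω) (x (t - 1) ω) (p.gExtra 1 i (x t ω) (x (t - 1) ω) ((W t ω).2.1 i))

/-- The error of the gradient estimate at time `t`. -/
abbrev Problem.gradErr (p : Problem n d m Z) (S : ℕ) (τ : ℝ) (W : ℕ → Ω → Sample n B Z)
    (x : ℕ → Ω → Vec d) (y : ℕ → Ω → Fin n → Vec m) (t : ℕ) (ω : Ω) : Vec d :=
  p.fullGrad (x t ω) (p.dualIter τ W x y t ω)
    - p.gradEst S (W t ω).1 (x t ω) (y (t + 1) ω) (W t ω).2.2

namespace RegularRun

variable (hr : RegularRun p K G Λ s₀ s₁ δ S B η τ x₀ y₀ μ W x y)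
include hr

omit [IsProbabilityMeasure μ] in
theorem isTrajectory (ω : Ω) :
    p.IsTrajectory η τ (fun t => x t ω) (fun t => y t ω)
      (fun t => p.dualIter τ W x y t ω) (fun t => (W t ω).1)
      (fun t i => p.gExtra 1 i (x t ω) (x (t - 1) ω) ((W t ω).2.1 i))
      (fun t => p.gradEst S (W t ω).1 (x t ω) (y (t + 1) ω) (W t ω).2.2) :=
  hr.regular.isTrajectory hr.τ_pos hr.x₀_mem hr.y₀_mem hr.run ω

omit [IsProbabilityMeasure μ] in
theorem x_mem (t : ℕ) (ω : Ω) : x t ω ∈ p.X :=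
  (hr.isTrajectory ω).x_mem t

omit [IsProbabilityMeasure μ] in
theorem z_mem (t : ℕ) (ω : Ω) (i : Fin n) : p.dualIter τ W x y t ω i ∈ dualSet (p.f i) :=
  (hr.isTrajectory ω).z_mem t i

omit [IsProbabilityMeasure μ] in
theorem y_mem (t : ℕ) (ω : Ω) (i : Fin n) : y t ω i ∈ dualSet (p.f i) :=
  (hr.isTrajectory ω).y_mem t i

omit [IsProbabilityMeasure μ] in
theorem measurable_iterates (t : ℕ) :
    Measurable[past W t] (x t) ∧ Measurable[past W t] (x (t - 1)) ∧ Measurable[past W t] (y t) :=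
  hr.regular.measurable_past_iterates hr.τ_pos hr.η_pos hr.x₀_mem hr.y₀_mem hr.run t

omit [IsProbabilityMeasure μ] in
theorem measurable_dualIter (t : ℕ) : Measurable[pastDual W t] (p.dualIter τ W x y t) := by
  obtain ⟨h1, h2, h3⟩ := hr.measurable_iterates t
  have hle : past W t ≤ pastDual W t := le_sup_left
  have hm : Measurable fun w : Vec d × Vec d × (Fin n → Vec m) × (Fin n → Fin B → Z) =>
      p.fullDual τ w.1 w.2.1 w.2.2.1 w.2.2.2 :=
    hr.regular.measurable_fullDual hr.τ_pos hr.y₀_mem measurable_fst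
      (measurable_fst.comp measurable_snd)
      (measurable_fst.comp (measurable_snd.comp measurable_snd))
      (measurable_snd.comp (measurable_snd.comp measurable_snd))
  have hU : Measurable[pastDual W t] fun ω => (x t ω, x (t - 1) ω, y t ω, (W t ω).2.1) :=
    (h1.mono hle le_rfl).prodMk ((h2.mono hle le_rfl).prodMk
      ((h3.mono hle le_rfl).prodMk (measurable_pastDual W t)))
  have h4 := hm.comp hU
  exact h4

omit [IsProbabilityMeasure μ] in
theorem measurable_innerError (i : Fin n) :
    Measurable fun w : Vec d × Vec d × (Fin B → Z) =>
      p.innerError i w.1 w.2.1 (p.gExtra 1 i w.1 w.2.1 w.2.2) := by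
  have h1 : Measurable fun w : Vec d × Vec d × (Fin B → Z) => p.g i w.1 :=
    (hr.regular.measurable_g i).comp measurable_fst
  have h2 : Measurable fun w : Vec d × Vec d × (Fin B → Z) => p.g i w.2.1 :=
    (hr.regular.measurable_g i).comp (measurable_fst.comp measurable_snd)
  exact ((measurable_smul_fun h1 2).sub h2).sub (hr.regular.measurable_gExtra i measurable_fst
    (measurable_fst.comp measurable_snd) (measurable_snd.comp measurable_snd))

omit [IsProbabilityMeasure μ] in
theorem measurable_innerErr (i : Fin n) (t : ℕ) :
    Measurable[pastDual W t] (p.innerErr W x i t) := by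
  obtain ⟨h1, h2, -⟩ := hr.measurable_iterates t
  have hle : past W t ≤ pastDual W t := le_sup_left
  have hb : Measurable[pastDual W t] fun ω => (W t ω).2.1 i :=
    (measurable_pi_apply i).comp (measurable_pastDual W t)
  have hU : Measurable[pastDual W t] fun ω => (x t ω, x (t - 1) ω, (W t ω).2.1 i) :=
    (h1.mono hle le_rfl).prodMk ((h2.mono hle le_rfl).prodMk hb)
  have h4 := (hr.measurable_innerError i).comp hU
  exact h4

omit [IsProbabilityMeasure μ] in
theorem indepFun_batch {A : Type*} [MeasurableSpace A] {U : Ω → A} {t : ℕ}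
    (hU : Measurable[past W t] U) (i : Fin n) : IndepFun U (fun ω => (W t ω).2.1 i) μ :=
  (indepFun_of_measurable_past hr.run.sample_meas hr.run.sample_indep hU).comp measurable_id
    ((measurable_pi_apply i).comp (measurable_fst.comp measurable_snd))

omit [IsProbabilityMeasure μ] in
theorem measurable_batch (t : ℕ) (i : Fin n) : Measurable fun ω => (W t ω).2.1 i :=
  (measurable_pi_apply i).comp
    ((measurable_fst.comp measurable_snd).comp (hr.run.sample_meas t))

omit [IsProbabilityMeasure μ] in
theorem innerError_moments (i : Fin n) {a b : Vec d} (ha : a ∈ p.X) (hb : b ∈ p.X) :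
    MemLp (fun v : Fin B → Z => p.innerError i a b (p.gExtra 1 i a b v)) 2
        (Measure.pi fun _ => p.P i) ∧
      ∫ v : Fin B → Z, p.innerError i a b (p.gExtra 1 i a b v) ∂(Measure.pi fun _ => p.P i) = 0 ∧
      ∫ v : Fin B → Z, ‖p.innerError i a b (p.gExtra 1 i a b v)‖ ^ 2 ∂(Measure.pi fun _ => p.P i)
        ≤ 10 * s₀ ^ 2 / B := by
  have := hr.regular.prob i
  simp only [innerError_gExtra hr.B_pos]
  have h1 := hr.regular.memLp_sampleError (i := i) ha hb
  have h2 := hr.regular.integral_sampleError (i := i) ha hb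
  exact ⟨memLp_batchMean h1, integral_batchMean h1 h2, integral_batchMean_norm_sq_le hr.B_pos h1 h2
    (hr.regular.integral_sampleError_norm_sq_le ha hb)⟩

theorem memLp_innerErr (i : Fin n) (t : ℕ) :
    MemLp (p.innerErr W x i t) 2 μ ∧ ∫ ω, ‖p.innerErr W x i t ω‖ ^ 2 ∂μ ≤ 10 * s₀ ^ 2 / B := by
  have := hr.regular.prob i
  obtain ⟨h1, h2, -⟩ := hr.measurable_iterates t
  have hU : Measurable[past W t] fun ω => (x t ω, x (t - 1) ω) := h1.prodMk h2
  have hξ : Measurable fun w : (Vec d × Vec d) × (Fin B → Z) =>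
      p.innerError i w.1.1 w.1.2 (p.gExtra 1 i w.1.1 w.1.2 w.2) := by
    have h3 : Measurable fun w : (Vec d × Vec d) × (Fin B → Z) => (w.1.1, w.1.2, w.2) :=
      (measurable_fst.comp measurable_fst).prodMk
        ((measurable_snd.comp measurable_fst).prodMk measurable_snd)
    have h4 := (hr.measurable_innerError i).comp h3
    exact h4
  have h5 := memLp_two_of_indep (hr.indepFun_batch hU i)
    (hU.mono (past_le hr.run.sample_meas t) le_rfl) (hr.measurable_batch t i)
    (hr.regular.map_inner_batch hr.S_le (hr.run.sample_meas t) (hr.run.sample_law t) i)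
    hξ.stronglyMeasurable (by positivity)
    (fun ω => (hr.innerError_moments i (hr.x_mem t ω) (hr.x_mem (t - 1) ω)).1)
    (ae_of_all _ fun ω => (hr.innerError_moments i (hr.x_mem t ω) (hr.x_mem (t - 1) ω)).2.2)
  exact h5

theorem integral_inner_innerErr (i : Fin n) (t : ℕ) {u : Ω → Vec m}
    (hu : Measurable[past W t] u) (hu2 : MemLp u 2 μ) :
    ∫ ω, ⟪p.innerErr W x i t ω, u ω⟫ ∂μ = 0 := by
  have := hr.regular.prob i
  obtain ⟨h1, h2, -⟩ := hr.measurable_iterates t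
  have hU : Measurable[past W t] fun ω => (x t ω, x (t - 1) ω, u ω) := h1.prodMk (h2.prodMk hu)
  have hξ : Measurable fun w : (Vec d × Vec d × Vec m) × (Fin B → Z) =>
      p.innerError i w.1.1 w.1.2.1 (p.gExtra 1 i w.1.1 w.1.2.1 w.2) := by
    have h3 : Measurable fun w : (Vec d × Vec d × Vec m) × (Fin B → Z) =>
        (w.1.1, w.1.2.1, w.2) :=
      (measurable_fst.comp measurable_fst).prodMk
        ((measurable_fst.comp (measurable_snd.comp measurable_fst)).prodMk measurable_snd)
    have h4 := (hr.measurable_innerError i).comp h3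
    exact h4
  have hproj : Measurable fun w : Vec d × Vec d × Vec m => w.2.2 :=
    measurable_snd.comp measurable_snd
  have hmom := fun ω => hr.innerError_moments i (hr.x_mem t ω) (hr.x_mem (t - 1) ω)
  have h5 := integral_inner_eq_zero_of_indep (hr.indepFun_batch hU i)
    (hU.mono (past_le hr.run.sample_meas t) le_rfl) (hr.measurable_batch t i)
    (hr.regular.map_inner_batch hr.S_le (hr.run.sample_meas t) (hr.run.sample_law t) i)
    hξ.stronglyMeasurable hproj.stronglyMeasurable (hr.memLp_innerErr i t).1 hu2
    (fun ω => (hmom ω).1.integrable one_le_two) (fun ω => (hmom ω).2.1)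
  exact h5

omit [IsProbabilityMeasure μ] in
theorem measurable_block (t : ℕ) : Measurable fun ω => (W t ω).1 :=
  measurable_fst.comp (hr.run.sample_meas t)

theorem indepFun_block {A : Type*} [MeasurableSpace A] {U : Ω → A} {t : ℕ}
    (hU : Measurable[pastDual W t] U) : IndepFun U (fun ω => (W t ω).1) μ := by
  rw [IndepFun_iff_Indep]
  exact indep_of_indep_of_le_left (hr.regular.indep_pastDual_block hr.S_le hr.run.sample_meas
    hr.run.sample_indep hr.run.sample_law t) hU.comap_le

theorem indepFun_outer {A : Type*} [MeasurableSpace A] {U : Ω → A} {t : ℕ}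
    (hU : Measurable[pastGrad W t] U) : IndepFun U (fun ω => (W t ω).2.2) μ := by
  rw [IndepFun_iff_Indep]
  exact indep_of_indep_of_le_left (hr.regular.indep_pastGrad_batch hr.S_le hr.run.sample_meas
    hr.run.sample_indep hr.run.sample_law t) hU.comap_le

omit [IsProbabilityMeasure μ] in
theorem integral_block (t : ℕ) (f : Finset (Fin n) → ℝ) :
    ∫ ω, f (W t ω).1 ∂μ = ∫ s, f s ∂(blockLaw n S) := by
  rw [← hr.regular.map_block hr.S_le (hr.run.sample_meas t) (hr.run.sample_law t)]
  exact (integral_map (hr.measurable_block t).aemeasurable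
    (Measurable.of_discrete (f := f)).aestronglyMeasurable).symm

-- A run fixes only the law of its samples, so the size of the block set is known almost surely, not
-- everywhere.
omit [IsProbabilityMeasure μ] in
theorem ae_card_block (t : ℕ) : ∀ᵐ ω ∂μ, ((W t ω).1).card = S := by
  have h1 : ∀ᵐ s ∂(blockLaw n S), s.card = S := by
    have h2 : ∀ᵐ s ∂(blockLaw n S), s ∈ ((Finset.univ.powersetCard S :
        Finset (Finset (Fin n))) : Set (Finset (Fin n))) :=
      ae_cond_mem (MeasurableSet.of_discrete)
    filter_upwards [h2] with s hs
    exact (Finset.mem_powersetCard.1 (Finset.mem_coe.1 hs)).2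
  rw [← hr.regular.map_block hr.S_le (hr.run.sample_meas t) (hr.run.sample_law t)] at h1
  exact ae_of_ae_map (hr.measurable_block t).aemeasurable h1

/-- The full dual step is taken in every block, hence does not depend on which blocks are sampled.
So functions of it are independent of the sampling weight. -/
theorem integral_samplingDev_mul {t : ℕ} (i : Fin n) {H : Ω → ℝ} (hH : Measurable[pastDual W t] H) :
    ∫ ω, samplingDev S (W t ω).1 i * H ω ∂μ = 0 := by
  have h1 : IndepFun (fun ω => samplingDev S (W t ω).1 i) H μ :=
    ((hr.indepFun_block hH).comp measurable_id
      (Measurable.of_discrete (f := fun s : Finset (Fin n) => samplingDev S s i))).symm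
  rw [h1.integral_fun_mul_eq_mul_integral
    (measurable_samplingDev S (hr.measurable_block t) i).aestronglyMeasurable
    (hH.mono (pastDual_le hr.run.sample_meas t) le_rfl).aestronglyMeasurable,
    hr.integral_block t fun s => samplingDev S s i, integral_samplingDev hr.S_pos hr.S_le, zero_mul]

theorem integral_samplingDev_sq_mul_le {t : ℕ} (i : Fin n) {H : Ω → ℝ}
    (hH : Measurable[pastDual W t] H) (hH0 : ∀ ω, 0 ≤ H ω) :
    ∫ ω, samplingDev S (W t ω).1 i ^ 2 * H ω ∂μ ≤ 1 / n * (1 / S) * ∫ ω, H ω ∂μ := by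
  have h1 : IndepFun (fun ω => samplingDev S (W t ω).1 i ^ 2) H μ :=
    ((hr.indepFun_block hH).comp measurable_id
      (Measurable.of_discrete (f := fun s : Finset (Fin n) => samplingDev S s i ^ 2))).symm
  rw [h1.integral_fun_mul_eq_mul_integral
    ((measurable_samplingDev S (hr.measurable_block t) i).pow_const 2).aestronglyMeasurable
    (hH.mono (pastDual_le hr.run.sample_meas t) le_rfl).aestronglyMeasurable,
    hr.integral_block t fun s => samplingDev S s i ^ 2]
  exact mul_le_mul_of_nonneg_right (integral_samplingDev_sq_le hr.S_pos hr.S_le i)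
    (integral_nonneg hH0)

omit [IsProbabilityMeasure μ] in
theorem measurable_meanDeriv_adjoint (i : Fin n) {α : Type*} [MeasurableSpace α] {X : α → Vec d}
    {Y : α → Fin n → Vec m} (hX : Measurable X) (hY : Measurable Y) :
    Measurable fun a => (p.meanDeriv i (X a)).adjoint (Y a i) :=
  measurable_adjoint_apply ((hr.regular.measurable_meanDeriv i).comp hX)
    ((measurable_pi_apply i).comp hY)

omit [IsProbabilityMeasure μ] in
theorem measurable_blockError :
    Measurable fun w : (Vec d × (Fin n → Vec m)) × Finset (Fin n) =>
      p.blockError S w.2 w.1.1 w.1.2 := by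
  unfold Problem.blockError
  refine Finset.measurable_fun_sum _ fun i _ => ?_
  exact (measurable_samplingDev S measurable_snd i).smul (hr.measurable_meanDeriv_adjoint i
    (measurable_fst.comp measurable_fst) (measurable_snd.comp measurable_fst))

omit [IsProbabilityMeasure μ] in
theorem measurable_oracleError :
    Measurable fun w : (Vec d × (Fin n → Vec m) × Finset (Fin n)) × (Fin n → Fin B → Z) =>
      p.oracleError S w.1.2.2 w.1.1 w.1.2.1 w.2 := by
  unfold Problem.oracleError Problem.sampleGradError
  refine measurable_smul_fun (measurable_sum_mem
    (measurable_snd.comp (measurable_snd.comp measurable_fst)) fun i => ?_) _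
  refine measurable_smul_fun (Finset.measurable_fun_sum _ fun j _ => ?_) _
  have hx : Measurable fun w : (Vec d × (Fin n → Vec m) × Finset (Fin n)) × (Fin n → Fin B → Z) =>
      w.1.1 := measurable_fst.comp measurable_fst
  have hz : Measurable fun w : (Vec d × (Fin n → Vec m) × Finset (Fin n)) × (Fin n → Fin B → Z) =>
      w.1.2.1 := measurable_fst.comp (measurable_snd.comp measurable_fst)
  have hb : Measurable fun w : (Vec d × (Fin n → Vec m) × Finset (Fin n)) × (Fin n → Fin B → Z) =>
      w.2 i j := (measurable_pi_apply j).comp ((measurable_pi_apply i).comp measurable_snd)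
  exact (hr.measurable_meanDeriv_adjoint i hx hz).sub
    (measurable_adjoint_apply ((hr.regular.dgs_meas i).comp (hx.prodMk hb))
      ((measurable_pi_apply i).comp hz))

omit [IsProbabilityMeasure μ] in
theorem gradErr_eq (t : ℕ) (ω : Ω) :
    p.gradErr S τ W x y t ω = p.blockError S (W t ω).1 (x t ω) (p.dualIter τ W x y t ω)
      + p.oracleError S (W t ω).1 (x t ω) (p.dualIter τ W x y t ω) (W t ω).2.2 :=
  hr.regular.fullGrad_sub_gradEst hr.B_pos (hr.x_mem t ω) ((hr.isTrajectory ω).y_sampled t) _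

omit [IsProbabilityMeasure μ] in
theorem measurable_dualPair (t : ℕ) :
    Measurable[pastDual W t] fun ω => (x t ω, p.dualIter τ W x y t ω) :=
  ((hr.measurable_iterates t).1.mono le_sup_left le_rfl).prodMk (hr.measurable_dualIter t)

omit [IsProbabilityMeasure μ] in
theorem measurable_gradTriple (t : ℕ) :
    Measurable[pastGrad W t] fun ω => (x t ω, p.dualIter τ W x y t ω, (W t ω).1) :=
  ((hr.measurable_iterates t).1.mono (le_sup_left.trans le_sup_left) le_rfl).prodMk
    (((hr.measurable_dualIter t).mono le_sup_left le_rfl).prodMk (measurable_pastGrad W t))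

theorem memLp_blockError (t : ℕ) :
    MemLp (fun ω => p.blockError S (W t ω).1 (x t ω) (p.dualIter τ W x y t ω)) 2 μ ∧
      ∫ ω, ‖p.blockError S (W t ω).1 (x t ω) (p.dualIter τ W x y t ω)‖ ^ 2 ∂μ ≤ δ ^ 2 / S := by
  have := isProbabilityMeasure_blockLaw hr.S_le
  have hU := hr.measurable_dualPair t
  exact memLp_two_of_indep (hr.indepFun_block hU)
    (hU.mono (pastDual_le hr.run.sample_meas t) le_rfl) (hr.measurable_block t)
    (hr.regular.map_block hr.S_le (hr.run.sample_meas t) (hr.run.sample_law t))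
    hr.measurable_blockError.stronglyMeasurable (by positivity) (fun ω => MemLp.of_discrete)
    (ae_of_all _ fun ω => hr.regular.integral_blockError_norm_sq_le hr.S_pos hr.S_le
      (hr.x_mem t ω) (hr.z_mem t ω))

theorem memLp_oracleError (t : ℕ) :
    MemLp (fun ω => p.oracleError S (W t ω).1 (x t ω) (p.dualIter τ W x y t ω) (W t ω).2.2) 2 μ ∧
      ∫ ω, ‖p.oracleError S (W t ω).1 (x t ω) (p.dualIter τ W x y t ω) (W t ω).2.2‖ ^ 2 ∂μ
        ≤ K ^ 2 * s₁ ^ 2 / S := by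
  have := hr.regular.isProbabilityMeasure_batchLaw B
  have hU := hr.measurable_gradTriple t
  have hV : Measurable fun ω => (W t ω).2.2 :=
    (measurable_snd.comp measurable_snd).comp (hr.run.sample_meas t)
  refine memLp_two_of_indep (hr.indepFun_outer hU)
    (hU.mono (pastGrad_le hr.run.sample_meas t) le_rfl) hV
    (hr.regular.map_outer_batch hr.S_le (hr.run.sample_meas t) (hr.run.sample_law t))
    hr.measurable_oracleError.stronglyMeasurable (by positivity)
    (fun ω => hr.regular.memLp_oracleError _ (hr.x_mem t ω) _) ?_
  filter_upwards [hr.ae_card_block t] with ω hω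
  exact hr.regular.integral_oracleError_norm_sq_le hr.S_pos hr.B_pos hω (hr.x_mem t ω)
    (hr.z_mem t ω)

theorem memLp_gradErr (t : ℕ) :
    MemLp (p.gradErr S τ W x y t) 2 μ ∧
      ∫ ω, ‖p.gradErr S τ W x y t ω‖ ^ 2 ∂μ ≤ 2 * (K ^ 2 * s₁ ^ 2 + δ ^ 2) / S := by
  obtain ⟨h1, h1'⟩ := hr.memLp_blockError t
  obtain ⟨h2, h2'⟩ := hr.memLp_oracleError t
  rw [show p.gradErr S τ W x y t = _ from funext (hr.gradErr_eq t)]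
  refine ⟨h1.add h2, ?_⟩
  have h3 := h1.integrable_norm_pow two_ne_zero
  have h4 := h2.integrable_norm_pow two_ne_zero
  refine (integral_mono ((h1.add h2).integrable_norm_pow two_ne_zero)
    ((h3.const_mul 2).add (h4.const_mul 2)) fun ω => ?_).trans ?_
  · simp only [Pi.add_apply]
    rw [← mul_add]
    refine (pow_le_pow_left₀ (norm_nonneg _) (norm_add_le _ _) 2).trans ?_
    exact add_sq_le
  · simp only [Pi.add_apply]
    rw [integral_add (h3.const_mul 2) (h4.const_mul 2), integral_const_mul, integral_const_mul]
    rw [mul_div_assoc, add_div]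
    linarith

/-- Conditioning in two stages: the block error is centred given `pastDual`, the oracle error given
`pastGrad`, and `x t` is measurable for both. -/
theorem integral_inner_gradErr (t : ℕ) {xs : Vec d} (hx : MemLp (fun ω => x t ω - xs) 2 μ) :
    ∫ ω, ⟪p.gradErr S τ W x y t ω, x t ω - xs⟫ ∂μ = 0 := by
  have := hr.regular.isProbabilityMeasure_batchLaw B
  have := isProbabilityMeasure_blockLaw hr.S_le
  have hU := hr.measurable_dualPair t
  have hU' := hr.measurable_gradTriple t
  have hV : Measurable fun ω => (W t ω).2.2 :=
    (measurable_snd.comp measurable_snd).comp (hr.run.sample_meas t)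
  have hp : Measurable fun w : Vec d × (Fin n → Vec m) => w.1 - xs := measurable_fst.sub_const _
  have hp' : Measurable fun w : Vec d × (Fin n → Vec m) × Finset (Fin n) => w.1 - xs :=
    measurable_fst.sub_const _
  obtain ⟨m1, -⟩ := hr.memLp_blockError t
  obtain ⟨m2, -⟩ := hr.memLp_oracleError t
  have h1 := integral_inner_eq_zero_of_indep (hr.indepFun_block hU)
    (hU.mono (pastDual_le hr.run.sample_meas t) le_rfl) (hr.measurable_block t)
    (hr.regular.map_block hr.S_le (hr.run.sample_meas t) (hr.run.sample_law t))
    hr.measurable_blockError.stronglyMeasurable hp.stronglyMeasurable m1 hx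
    (fun ω => Integrable.of_finite) (fun ω => integral_blockError hr.S_pos hr.S_le _ _)
  have h2 := integral_inner_eq_zero_of_indep (hr.indepFun_outer hU')
    (hU'.mono (pastGrad_le hr.run.sample_meas t) le_rfl) hV
    (hr.regular.map_outer_batch hr.S_le (hr.run.sample_meas t) (hr.run.sample_law t))
    hr.measurable_oracleError.stronglyMeasurable hp'.stronglyMeasurable m2 hx
    (fun ω => (hr.regular.memLp_oracleError _ (hr.x_mem t ω) _).integrable one_le_two)
    (fun ω => hr.regular.integral_oracleError _ (hr.x_mem t ω) _)
  simp only [hr.gradErr_eq, inner_add_left]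
  rw [integral_add (integrable_inner_of_memLp_two m1 hx) (integrable_inner_of_memLp_two m2 hx)]
  simp only at h1 h2
  rw [h1, h2, add_zero]

end RegularRun

end RunMoments

end ALEXR

namespace ALEXR

/-! ### Bounds on integrals -/

section IntegralLE

variable {Ω : Type*} [MeasurableSpace Ω] {μ : Measure Ω}

/-- `f` is integrable with integral at most `c`. -/
def IntegralLE (μ : Measure Ω) (f : Ω → ℝ) (c : ℝ) : Prop :=
  Integrable f μ ∧ ∫ ω, f ω ∂μ ≤ c

theorem IntegralLE.add {f g : Ω → ℝ} {a b : ℝ} (hf : IntegralLE μ f a) (hg : IntegralLE μ g b) :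
    IntegralLE μ (fun ω => f ω + g ω) (a + b) :=
  ⟨hf.1.add hg.1, (integral_add hf.1 hg.1).trans_le (add_le_add hf.2 hg.2)⟩

theorem IntegralLE.const_mul {f : Ω → ℝ} {a c : ℝ} (hf : IntegralLE μ f a) (hc : 0 ≤ c) :
    IntegralLE μ (fun ω => c * f ω) (c * a) :=
  ⟨hf.1.const_mul c, (integral_const_mul c f).trans_le (mul_le_mul_of_nonneg_left hf.2 hc)⟩

theorem IntegralLE.sum {ι : Type*} {s : Finset ι} {f : ι → Ω → ℝ} {a : ι → ℝ}
    (hf : ∀ i ∈ s, IntegralLE μ (f i) (a i)) :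
    IntegralLE μ (fun ω => ∑ i ∈ s, f i ω) (∑ i ∈ s, a i) :=
  ⟨integrable_finsetSum s fun i hi => (hf i hi).1,
    (integral_finsetSum s fun i hi => (hf i hi).1).trans_le
      (Finset.sum_le_sum fun i hi => (hf i hi).2)⟩

theorem IntegralLE.mono {f : Ω → ℝ} {a b : ℝ} (hf : IntegralLE μ f a) (hab : a ≤ b) :
    IntegralLE μ f b :=
  ⟨hf.1, hf.2.trans hab⟩

/-- Orthogonal increments: the second moment of the sum is the sum of the second moments. -/
theorem integral_norm_sum_range_sq {F : Type*} [NormedAddCommGroup F] [InnerProductSpace ℝ F]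
    {D : ℕ → Ω → F} (hD : ∀ t, MemLp (D t) 2 μ)
    (horth : ∀ t, ∫ ω, ⟪D t ω, ∑ k ∈ Finset.range t, D k ω⟫ ∂μ = 0) (T : ℕ) :
    ∫ ω, ‖∑ t ∈ Finset.range T, D t ω‖ ^ 2 ∂μ = ∑ t ∈ Finset.range T, ∫ ω, ‖D t ω‖ ^ 2 ∂μ := by
  have hM : ∀ T, MemLp (fun ω => ∑ t ∈ Finset.range T, D t ω) 2 μ := fun T =>
    memLp_finsetSum _ fun t _ => hD t
  induction T with
  | zero => simp
  | succ T ih =>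
    have h1 : ∀ ω, ‖∑ t ∈ Finset.range (T + 1), D t ω‖ ^ 2
        = ‖∑ t ∈ Finset.range T, D t ω‖ ^ 2
          + (2 * ⟪D T ω, ∑ t ∈ Finset.range T, D t ω⟫ + ‖D T ω‖ ^ 2) := by
      intro ω
      rw [Finset.sum_range_succ, norm_add_sq_real, real_inner_comm]
      ring
    have i1 := (hM T).integrable_norm_pow two_ne_zero
    have i2 := (integrable_inner_of_memLp_two (hD T) (hM T)).const_mul 2
    have i3 := (hD T).integrable_norm_pow two_ne_zero
    have i4 : Integrable (fun ω => 2 * ⟪D T ω, ∑ t ∈ Finset.range T, D t ω⟫ + ‖D T ω‖ ^ 2) μ :=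
      i2.add i3
    simp only [h1]
    rw [integral_add i1 i4, integral_add i2 i3, integral_const_mul, horth, ih,
      Finset.sum_range_succ]
    ring

end IntegralLE

variable {n d m : ℕ} {Z : Type*} [MeasurableSpace Z] {p : Problem n d m Z}
  {K G Λ s₀ s₁ δ : ℝ} {S B : ℕ} {η τ : ℝ} {x₀ : Vec d} {y₀ : Fin n → Vec m}

/-! ### Growth of the primal iterates -/

theorem mean_le_of_forall_le (hn : 0 < n) {a : Fin n → ℝ} {c : ℝ} (h : ∀ i, a i ≤ c) :
    1 / (n : ℝ) * ∑ i, a i ≤ c := by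
  have hnp : (0 : ℝ) < n := Nat.cast_pos.2 hn
  have h1 := Finset.sum_le_card_nsmul Finset.univ a c fun i _ => h i
  rw [Finset.card_univ, Fintype.card_fin, nsmul_eq_mul] at h1
  rwa [one_div, inv_mul_le_iff₀ hnp]

/-- Needed only for square integrability of the iterates, as `X` may be unbounded; the growth factor
does not enter the rate. No subgradient of `r` is used: minimality of `xs` and the Lipschitz bound
for the composite part give `r xs - r x' ≤ K G ‖x' - xs‖`. -/
theorem Problem.Regular.norm_primal_step_sq_le (h : p.Regular K G Λ s₀ s₁ δ) (hn : 0 < n)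
    (hη : 0 < η) {x x' c xs : Vec d} {z : Fin n → Vec m} (hx : x ∈ p.X)
    (hz : ∀ i, z i ∈ dualSet (p.f i)) (hx' : p.IsPrimalStep η x c x')
    (hxs : xs ∈ p.X) (hmin : IsMinOn p.F p.X xs) :
    ‖x' - xs‖ ^ 2
      ≤ 4 * ‖x - xs‖ ^ 2 + (12 * (K * G) ^ 2 + 8 * ‖p.fullGrad x z - c‖ ^ 2) / η ^ 2 := by
  have hrs := h.r_lt_top_of_isMinOn hmin
  have hr : (p.r xs).toReal - (p.r x').toReal ≤ K * G * ‖x' - xs‖ := by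
    have h1 := hmin hx'.1.1
    simp only [Set.mem_ofPred_eq] at h1
    rw [h.F_eq_coe hxs hrs, h.F_eq_coe hx'.1.1 hx'.1.2, EReal.coe_le_coe_iff] at h1
    have h2 := mean_le_of_forall_le hn (a := fun i => p.f i (p.g i x') - p.f i (p.g i xs))
      (c := K * G * ‖x' - xs‖) fun i => by
        refine (le_abs_self _).trans ((h.f_lip i _ _).trans ?_)
        rw [mul_assoc]
        exact mul_le_mul_of_nonneg_left (h.g_lip i _ hx'.1.1 _ hxs) h.K_nonneg
    rw [Finset.sum_sub_distrib, mul_sub] at h2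
    linarith
  have hgrad : ∀ w ∈ p.X, |⟪p.fullGrad x z, w - x⟫| ≤ K * G * ‖w - x‖ := by
    intro w hw
    have hi : ∀ i, |⟪z i, p.dg i x (w - x)⟫| ≤ K * G * ‖w - x‖ := fun i => by
      refine (abs_real_inner_le_norm _ _).trans ?_
      rw [mul_assoc]
      exact mul_le_mul (h.norm_le (hz i)) (h.norm_dg_le i hx hw) (norm_nonneg _) h.K_nonneg
    rw [inner_fullGrad, abs_le, neg_le, ← mul_neg, ← Finset.sum_neg_distrib]
    exact ⟨mean_le_of_forall_le hn fun i => (neg_le_abs _).trans (hi i),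
      mean_le_of_forall_le hn fun i => (le_abs_self _).trans (hi i)⟩
  have h1 := hx'.2 xs ⟨hxs, hrs⟩
  have h2 := (abs_le.1 (hgrad xs hxs)).2
  have h3 := (abs_le.1 (hgrad x' hx'.1.1)).1
  have h4 := real_inner_le_norm (p.fullGrad x z - c) (x' - xs)
  have h5 : ⟪c, xs⟫ - ⟪c, x'⟫ = ⟪p.fullGrad x z, xs - x⟫ - ⟪p.fullGrad x z, x' - x⟫
      + ⟪p.fullGrad x z - c, x' - xs⟫ := by
    simp only [inner_sub_left, inner_sub_right]
    ring
  rw [norm_sub_rev xs x', norm_sub_rev xs x] at h1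
  rw [norm_sub_rev xs x] at h2
  set A := ‖x - xs‖
  set a := ‖x' - x‖
  set b := ‖x' - xs‖
  set ε := ‖p.fullGrad x z - c‖
  set M := K * G
  have h6 : η / 2 * a ^ 2 + η / 2 * b ^ 2 ≤ η / 2 * A ^ 2 + M * A + M * a + (M + ε) * b := by
    linarith
  have e1 : M * A ≤ η / 2 * A ^ 2 + M ^ 2 / (2 * η) := by
    have : 0 ≤ (η * A - M) ^ 2 / (2 * η) := by positivity
    rw [show (η * A - M) ^ 2 / (2 * η) = η / 2 * A ^ 2 - M * A + M ^ 2 / (2 * η) by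
      field_simp
      ring] at this
    linarith
  have e2 : M * a ≤ η / 2 * a ^ 2 + M ^ 2 / (2 * η) := by
    have : 0 ≤ (η * a - M) ^ 2 / (2 * η) := by positivity
    rw [show (η * a - M) ^ 2 / (2 * η) = η / 2 * a ^ 2 - M * a + M ^ 2 / (2 * η) by
      field_simp
      ring] at this
    linarith
  have e3 : (M + ε) * b ≤ η / 4 * b ^ 2 + (2 * M ^ 2 + 2 * ε ^ 2) / η := by
    have : 0 ≤ (η / 2 * b - (M + ε)) ^ 2 / η + (M - ε) ^ 2 / η := by positivity
    rw [show (η / 2 * b - (M + ε)) ^ 2 / η + (M - ε) ^ 2 / η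
        = η / 4 * b ^ 2 - (M + ε) * b + (2 * M ^ 2 + 2 * ε ^ 2) / η by
      field_simp
      ring] at this
    linarith
  have e4 : η / 4 * b ^ 2 ≤ η / 4 * (4 * A ^ 2 + (12 * M ^ 2 + 8 * ε ^ 2) / η ^ 2) := by
    rw [show η / 4 * (4 * A ^ 2 + (12 * M ^ 2 + 8 * ε ^ 2) / η ^ 2)
        = η * A ^ 2 + M ^ 2 / (2 * η) + M ^ 2 / (2 * η) + (2 * M ^ 2 + 2 * ε ^ 2) / η by
      field_simp
      ring]
    linarith
  exact le_of_mul_le_mul_left e4 (by positivity)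

theorem abs_samplingDev_le (s : Finset (Fin n)) (i : Fin n) : |samplingDev S s i| ≤ 2 := by
  have h1 : ∀ k : ℕ, 0 ≤ 1 / (k : ℝ) ∧ 1 / (k : ℝ) ≤ 1 := fun k =>
    ⟨by positivity, by
      rcases Nat.eq_zero_or_pos k with rfl | hk
      · simp
      · exact div_le_one_of_le₀ (Nat.one_le_cast.2 hk) (by positivity)⟩
  have h2 := h1 n
  have h3 := h1 S
  unfold samplingDev
  rw [abs_le]
  split_ifs <;> constructor <;> linarith

/-! ### Expectations of the error terms -/

section Expectations

variable {Ω : Type*} [mΩ : MeasurableSpace Ω] {μ : Measure Ω} [IsProbabilityMeasure μ]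
  {W : ℕ → Ω → Sample n B Z} {x : ℕ → Ω → Vec d} {y : ℕ → Ω → Fin n → Vec m}

omit mΩ in
theorem pastDual_le_past (W : ℕ → Ω → Sample n B Z) {k t : ℕ} (hk : k < t) :
    pastDual W k ≤ past W t :=
  sup_le (past_mono W hk.le) (measurable_iff_comap_le.1
    ((measurable_fst.comp measurable_snd).comp (measurable_past W hk)))

namespace RegularRun

variable (hr : RegularRun p K G Λ s₀ s₁ δ S B η τ x₀ y₀ μ W x y)
include hr

theorem memLp_x_sub {xs : Vec d} (hxs : xs ∈ p.X) (hmin : IsMinOn p.F p.X xs) (t : ℕ) :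
    MemLp (fun ω => x t ω - xs) 2 μ := by
  have hm : ∀ t, AEStronglyMeasurable (fun ω => x t ω - xs) μ := fun t =>
    (((hr.measurable_iterates t).1.mono (past_le hr.run.sample_meas t) le_rfl).sub_const
      xs).aestronglyMeasurable
  induction t with
  | zero =>
    simp only [hr.run.x_zero]
    exact memLp_const _
  | succ t ih =>
    rw [memLp_two_iff_integrable_sq_norm (hm (t + 1))]
    have h1 := ih.integrable_norm_pow two_ne_zero
    have h2 := (hr.memLp_gradErr t).1.integrable_norm_pow two_ne_zero
    refine ((h1.const_mul 4).add (((integrable_const (12 * (K * G) ^ 2)).add (h2.const_mul 8)).div_const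
      (η ^ 2))).mono' ((hm (t + 1)).norm.pow 2) (ae_of_all _ fun ω => ?_)
    rw [Real.norm_of_nonneg (by positivity)]
    exact hr.regular.norm_primal_step_sq_le (hr.S_pos.trans_le hr.S_le) hr.η_pos (hr.x_mem t ω)
      (hr.z_mem t ω) ((hr.isTrajectory ω).primal_step t) hxs hmin

omit [IsProbabilityMeasure μ] in
theorem measurable_dual_block (t : ℕ) (i : Fin n) :
    Measurable[past W t] (fun ω => y t ω i) ∧
      Measurable[pastDual W t] (fun ω => p.dualIter τ W x y t ω i) :=
  ⟨(measurable_pi_apply i).comp (hr.measurable_iterates t).2.2,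
    (measurable_pi_apply i).comp (hr.measurable_dualIter t)⟩

omit [IsProbabilityMeasure μ] in
theorem norm_sub_le_of_mem {i : Fin n} {v w : Vec m} (hv : v ∈ dualSet (p.f i))
    (hw : w ∈ dualSet (p.f i)) : ‖v - w‖ ≤ 2 * K := by
  have := norm_sub_le v w
  linarith [hr.regular.norm_le hv, hr.regular.norm_le hw]

theorem integralLE_samplingDev_mul {t : ℕ} (i : Fin n) {H : Ω → ℝ}
    (hH : Measurable[pastDual W t] H) {c : ℝ} (hc : ∀ ω, |H ω| ≤ c) :
    IntegralLE μ (fun ω => samplingDev S (W t ω).1 i * H ω) 0 := by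
  refine ⟨?_, (hr.integral_samplingDev_mul i hH).le⟩
  have hm : AEStronglyMeasurable H μ :=
    (hH.mono (pastDual_le hr.run.sample_meas t) le_rfl).aestronglyMeasurable
  have hs : AEStronglyMeasurable (fun ω => samplingDev S (W t ω).1 i) μ :=
    (measurable_samplingDev S (hr.measurable_block t) i).aestronglyMeasurable
  refine (integrable_const (2 * c)).mono' (hs.mul hm) (ae_of_all _ fun ω => ?_)
  rw [Real.norm_eq_abs, abs_mul]
  exact mul_le_mul (abs_samplingDev_le _ i) (hc ω) (abs_nonneg _) zero_le_two

omit [IsProbabilityMeasure μ] in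
theorem measurable_sub_norm_sq (t : ℕ) (i : Fin n) : Measurable[pastDual W t]
    fun ω => ‖y t ω i - y₀ i‖ ^ 2 - ‖p.dualIter τ W x y t ω i - y₀ i‖ ^ 2 := by
  obtain ⟨m1, m2⟩ := hr.measurable_dual_block t i
  have hc : Continuous fun w : Vec m × Vec m => ‖w.1 - y₀ i‖ ^ 2 - ‖w.2 - y₀ i‖ ^ 2 := by
    fun_prop
  have hU : Measurable[pastDual W t] fun ω => (y t ω i, p.dualIter τ W x y t ω i) :=
    (m1.mono le_sup_left le_rfl).prodMk m2
  have h1 := hc.measurable.comp hU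
  exact h1

/-- Each summand pairs a centred error with something determined before it: `x t - xs`, `y 0 - y t`,
or the full dual step. None of them contains the comparison point `w`. -/
theorem integralLE_martingaleTerm {xs : Vec d} (hxs : xs ∈ p.X) (hmin : IsMinOn p.F p.X xs)
    (T : ℕ) :
    IntegralLE μ (fun ω => p.martingaleTerm S τ xs (fun t => x t ω) (fun t => y t ω)
      (fun t => p.dualIter τ W x y t ω) (fun t => (W t ω).1)
      (fun t i => p.gExtra 1 i (x t ω) (x (t - 1) ω) ((W t ω).2.1 i))
      (fun t => p.gradEst S (W t ω).1 (x t ω) (y (t + 1) ω) (W t ω).2.2) T) 0 := by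
  have hτ := hr.τ_pos
  have h1 : ∀ t, IntegralLE μ (fun ω => ⟪p.gradErr S τ W x y t ω, x t ω - xs⟫) 0 := fun t =>
    ⟨integrable_inner_of_memLp_two (hr.memLp_gradErr t).1 (hr.memLp_x_sub hxs hmin t),
      (hr.integral_inner_gradErr t (hr.memLp_x_sub hxs hmin t)).le⟩
  have h2 : ∀ i t, IntegralLE μ (fun ω => ⟪y₀ i - y t ω i, p.innerErr W x i t ω⟫) 0 := by
    intro i t
    have hu : Measurable[past W t] fun ω => y₀ i - y t ω i :=
      (hr.measurable_dual_block t i).1.const_sub _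
    have hu2 : MemLp (fun ω => y₀ i - y t ω i) 2 μ :=
      MemLp.of_bound (hu.mono (past_le hr.run.sample_meas t) le_rfl).aestronglyMeasurable (2 * K)
        (ae_of_all _ fun ω => hr.norm_sub_le_of_mem (hr.y₀_mem i) (hr.y_mem t ω i))
    refine ⟨integrable_inner_of_memLp_two hu2 (hr.memLp_innerErr i t).1, ?_⟩
    simp only [real_inner_comm]
    exact (hr.integral_inner_innerErr i t hu hu2).le
  have h3 : ∀ i t, IntegralLE μ (fun ω => samplingDev S (W t ω).1 i
      * (‖y t ω i - y₀ i‖ ^ 2 - ‖p.dualIter τ W x y t ω i - y₀ i‖ ^ 2)) 0 := by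
    intro i t
    refine hr.integralLE_samplingDev_mul i (hr.measurable_sub_norm_sq t i) (c := (2 * K) ^ 2)
      fun ω => ?_
    have b1 := pow_le_pow_left₀ (norm_nonneg _)
      (hr.norm_sub_le_of_mem (hr.y_mem t ω i) (hr.y₀_mem i)) 2
    have b2 := pow_le_pow_left₀ (norm_nonneg _)
      (hr.norm_sub_le_of_mem (hr.z_mem t ω i) (hr.y₀_mem i)) 2
    rw [abs_le]
    constructor <;>
      linarith [sq_nonneg ‖y t ω i - y₀ i‖, sq_nonneg ‖p.dualIter τ W x y t ω i - y₀ i‖]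
  have h4 := (IntegralLE.sum fun t (_ : t ∈ Finset.range T) => h1 t).add
    (IntegralLE.sum fun i (_ : i ∈ Finset.univ) =>
      ((IntegralLE.sum fun t (_ : t ∈ Finset.range T) => h2 i t).const_mul
        (show (0 : ℝ) ≤ 1 / n by positivity)).add
      ((IntegralLE.sum fun t (_ : t ∈ Finset.range T) => h3 i t).const_mul
        (show (0 : ℝ) ≤ τ / 2 by positivity)))
  simp only [Finset.sum_const_zero, mul_zero, add_zero] at h4
  simp only [Problem.martingaleTerm, hr.run.y_zero]
  exact h4

/-- Successive errors are orthogonal, so the second moment of the sum grows like `T` and not like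
`T²`. -/
theorem integralLE_norm_sum_innerErr_sq (i : Fin n) (T : ℕ) :
    IntegralLE μ (fun ω => ‖∑ t ∈ Finset.range T, p.innerErr W x i t ω‖ ^ 2)
      (T * (10 * s₀ ^ 2 / B)) := by
  have hM : ∀ T, MemLp (fun ω => ∑ t ∈ Finset.range T, p.innerErr W x i t ω) 2 μ := fun T =>
    memLp_finsetSum _ fun t _ => (hr.memLp_innerErr i t).1
  have hmeas : ∀ t, Measurable[past W t] fun ω => ∑ k ∈ Finset.range t, p.innerErr W x i k ω :=
    fun t => Finset.measurable_fun_sum _ fun k hk => (hr.measurable_innerErr i k).mono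
      (pastDual_le_past W (Finset.mem_range.1 hk)) le_rfl
  refine ⟨(hM T).integrable_norm_pow two_ne_zero, ?_⟩
  rw [integral_norm_sum_range_sq (fun t => (hr.memLp_innerErr i t).1)
    (fun t => hr.integral_inner_innerErr i t (hmeas t) (hM t))]
  refine (Finset.sum_le_sum fun t _ => (hr.memLp_innerErr i t).2).trans_eq ?_
  rw [Finset.sum_const, Finset.card_range, nsmul_eq_mul]

/-- By orthogonality the first term has mean at most `(τ S / 8) (1/(n S)) ∑ E‖z t - y t‖²`. This
equals `τ/(8 n) ∑ E‖z t - y t‖²`, precisely the reserved negative term. -/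
theorem integralLE_block_noise (i : Fin n) (T : ℕ) :
    IntegralLE μ (fun ω => τ / (8 * (1 / (S : ℝ)))
          * ‖∑ t ∈ Finset.range T,
              samplingDev S (W t ω).1 i • (p.dualIter τ W x y t ω i - y t ω i)‖ ^ 2
          - 1 / (n : ℝ) * (τ / 8 * ∑ t ∈ Finset.range T,
              ‖p.dualIter τ W x y t ω i - y t ω i‖ ^ 2)) 0 := by
  have hτ := hr.τ_pos
  have hSp : (0 : ℝ) < S := Nat.cast_pos.2 hr.S_pos
  have hle := fun t => pastDual_le hr.run.sample_meas t
  have hu : ∀ t, Measurable[pastDual W t] fun ω => p.dualIter τ W x y t ω i - y t ω i := fun t =>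
    (hr.measurable_dual_block t i).2.sub ((hr.measurable_dual_block t i).1.mono le_sup_left le_rfl)
  have hub : ∀ t ω, ‖p.dualIter τ W x y t ω i - y t ω i‖ ≤ 2 * K := fun t ω =>
    hr.norm_sub_le_of_mem (hr.z_mem t ω i) (hr.y_mem t ω i)
  have hu2 : ∀ t, MemLp (fun ω => p.dualIter τ W x y t ω i - y t ω i) 2 μ := fun t =>
    MemLp.of_bound ((hu t).mono (hle t) le_rfl).aestronglyMeasurable (2 * K)
      (ae_of_all _ (hub t))
  set D : ℕ → Ω → Vec m := fun t ω =>
    samplingDev S (W t ω).1 i • (p.dualIter τ W x y t ω i - y t ω i)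
  have hDm : ∀ t k, k < t → Measurable[past W t] (D k) := by
    intro t k hk
    have hs : Measurable[past W t] fun ω => (W k ω).1 :=
      measurable_fst.comp (measurable_past W hk)
    have hd : Measurable[past W t] fun ω => samplingDev S (W k ω).1 i :=
      (Measurable.of_discrete (f := fun s : Finset (Fin n) => samplingDev S s i)).comp hs
    exact hd.smul ((hu k).mono (pastDual_le_past W hk) le_rfl)
  have hD : ∀ t, MemLp (D t) 2 μ := fun t =>
    MemLp.of_bound ((hDm (t + 1) t t.lt_succ_self).mono (past_le hr.run.sample_meas _)
      le_rfl).aestronglyMeasurable (2 * (2 * K)) (ae_of_all _ fun ω => by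
        rw [norm_smul]
        exact mul_le_mul (abs_samplingDev_le _ i) (hub t ω) (norm_nonneg _) zero_le_two)
  -- Earlier increments and the current dual step are both known before the blocks of time `t` are
  -- sampled, so only the centred weight is left to integrate.
  have horth : ∀ t, ∫ ω, ⟪D t ω, ∑ k ∈ Finset.range t, D k ω⟫ ∂μ = 0 := by
    intro t
    have hs : Measurable[pastDual W t] fun ω => ∑ k ∈ Finset.range t, D k ω :=
      Finset.measurable_fun_sum _ fun k hk =>
        (hDm t k (Finset.mem_range.1 hk)).mono le_sup_left le_rfl
    simp only [D, real_inner_smul_left]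
    exact hr.integral_samplingDev_mul i ((hu t).inner hs)
  have hMi := (memLp_finsetSum (Finset.range T) fun t _ => hD t).integrable_norm_pow two_ne_zero
  have hAi : ∀ t, Integrable (fun ω => ‖p.dualIter τ W x y t ω i - y t ω i‖ ^ 2) μ := fun t =>
    (hu2 t).integrable_norm_pow two_ne_zero
  have hAs : Integrable (fun ω => ∑ t ∈ Finset.range T,
      ‖p.dualIter τ W x y t ω i - y t ω i‖ ^ 2) μ := integrable_finsetSum _ fun t _ => hAi t
  have hsq : ∀ t, ∫ ω, ‖D t ω‖ ^ 2 ∂μ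
      ≤ 1 / n * (1 / S) * ∫ ω, ‖p.dualIter τ W x y t ω i - y t ω i‖ ^ 2 ∂μ := by
    intro t
    simp only [D, norm_smul, mul_pow, Real.norm_eq_abs, sq_abs]
    have hc : Continuous fun v : Vec m => ‖v‖ ^ 2 := by fun_prop
    exact hr.integral_samplingDev_sq_mul_le i (hc.measurable.comp (hu t)) fun ω => by positivity
  refine ⟨(hMi.const_mul _).sub ((hAs.const_mul _).const_mul _), ?_⟩
  rw [integral_sub (hMi.const_mul _) ((hAs.const_mul _).const_mul _), integral_const_mul,
    integral_const_mul, integral_const_mul, integral_norm_sum_range_sq hD horth,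
    integral_finsetSum _ fun t _ => hAi t, sub_nonpos]
  calc τ / (8 * (1 / (S : ℝ))) * ∑ t ∈ Finset.range T, ∫ ω, ‖D t ω‖ ^ 2 ∂μ
      ≤ τ / (8 * (1 / (S : ℝ))) * ∑ t ∈ Finset.range T,
        1 / n * (1 / S) * ∫ ω, ‖p.dualIter τ W x y t ω i - y t ω i‖ ^ 2 ∂μ := by
        gcongr with t
        exact hsq t
    _ = _ := by
        rw [← Finset.mul_sum]
        field_simp

/-- The constant `25` is `10 (1/2 + 2)`: the first share comes from the total noise, the second from
the single errors. The block noise contributes nothing. -/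
theorem integralLE_quadraticTerm (T : ℕ) :
    IntegralLE μ (fun ω => p.quadraticTerm S η τ (fun t => x t ω) (fun t => y t ω)
      (fun t => p.dualIter τ W x y t ω) (fun t => (W t ω).1)
      (fun t i => p.gExtra 1 i (x t ω) (x (t - 1) ω) ((W t ω).2.1 i))
      (fun t => p.gradEst S (W t ω).1 (x t ω) (y (t + 1) ω) (W t ω).2.2) T)
      (T * (4 * (K ^ 2 * s₁ ^ 2 + δ ^ 2) / (η * S) + 25 * s₀ ^ 2 / (B * τ))) := by
  have hτ := hr.τ_pos
  have hη := hr.η_pos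
  have hSp : (0 : ℝ) < S := Nat.cast_pos.2 hr.S_pos
  have hBp : (0 : ℝ) < B := Nat.cast_pos.2 hr.B_pos
  have hnp : (0 : ℝ) < n := Nat.cast_pos.2 (hr.S_pos.trans_le hr.S_le)
  have h1 : ∀ t, IntegralLE μ (fun ω => ‖p.gradErr S τ W x y t ω‖ ^ 2)
      (2 * (K ^ 2 * s₁ ^ 2 + δ ^ 2) / S) := fun t =>
    ⟨(hr.memLp_gradErr t).1.integrable_norm_pow two_ne_zero, (hr.memLp_gradErr t).2⟩
  have h2 : ∀ i t, IntegralLE μ (fun ω => ‖p.innerErr W x i t ω‖ ^ 2) (10 * s₀ ^ 2 / B) :=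
    fun i t => ⟨(hr.memLp_innerErr i t).1.integrable_norm_pow two_ne_zero,
      (hr.memLp_innerErr i t).2⟩
  have h4 := ((IntegralLE.sum fun t (_ : t ∈ Finset.range T) => h1 t).const_mul
      (show (0 : ℝ) ≤ 2 / η by positivity)).add
    (IntegralLE.sum fun i (_ : i ∈ Finset.univ) =>
      ((((hr.integralLE_norm_sum_innerErr_sq i T).const_mul
        (show (0 : ℝ) ≤ 1 / (2 * τ) by positivity)).const_mul
        (show (0 : ℝ) ≤ 1 / n by positivity)).add
      (((IntegralLE.sum fun t (_ : t ∈ Finset.range T) => h2 i t).const_mul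
        (show (0 : ℝ) ≤ 2 / τ by positivity)).const_mul
        (show (0 : ℝ) ≤ 1 / n by positivity))).add
      (hr.integralLE_block_noise i T))
  refine IntegralLE.mono h4 (le_of_eq ?_)
  simp only [Finset.sum_const, Finset.card_range, Finset.card_univ, Fintype.card_fin, nsmul_eq_mul]
  field_simp
  ring

end RegularRun

end Expectations

end ALEXR

namespace ALEXR

/-! ### The convergence bound -/

section Bound

variable {n d m : ℕ} {Z : Type*} [MeasurableSpace Z] {p : Problem n d m Z}
  {K G Λ s₀ s₁ δ : ℝ} {S B : ℕ} {η τ : ℝ} {x₀ : Vec d} {y₀ : Fin n → Vec m}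
  {Ω : Type*} [mΩ : MeasurableSpace Ω] {μ : Measure Ω} [IsProbabilityMeasure μ]
  {W : ℕ → Ω → Sample n B Z} {x : ℕ → Ω → Vec d} {y : ℕ → Ω → Fin n → Vec m}
  {yt : Ω → Fin n → Vec m}

theorem integralLE_const (c : ℝ) : IntegralLE μ (fun _ => c) c :=
  ⟨integrable_const c, by simp⟩

omit [IsProbabilityMeasure μ] in
theorem IntegralLE.lintegral_toENNReal_le {Φ : Ω → EReal} {R : Ω → ℝ} {c : ℝ}
    (hR : IntegralLE μ R c) (h : ∀ ω, ∃ a : ℝ, 0 ≤ a ∧ Φ ω = (a : EReal) ∧ a ≤ R ω) :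
    ∫⁻ ω, (Φ ω).toENNReal ∂μ ≤ ENNReal.ofReal c := by
  have hR0 : ∀ ω, 0 ≤ R ω := fun ω => by
    obtain ⟨a, ha, -, hle⟩ := h ω
    exact ha.trans hle
  calc ∫⁻ ω, (Φ ω).toENNReal ∂μ ≤ ∫⁻ ω, ENNReal.ofReal (R ω) ∂μ := by
        refine lintegral_mono fun ω => ?_
        obtain ⟨a, ha, haF, hle⟩ := h ω
        rw [haF, EReal.toENNReal_of_ne_top (EReal.coe_ne_top a), EReal.toReal_coe]
        exact ENNReal.ofReal_le_ofReal hle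
    _ = ENNReal.ofReal (∫ ω, R ω ∂μ) :=
        (ofReal_integral_eq_lintegral_ofReal hR.1 (ae_of_all _ hR0)).symm
    _ ≤ ENNReal.ofReal c := ENNReal.ofReal_le_ofReal hR.2

theorem radius_nonneg (μ : Measure Ω) (yt : Ω → Fin n → Vec m) (y₀ : Fin n → Vec m) :
    0 ≤ radius μ quad yt y₀ := by
  refine integral_nonneg fun ω => Finset.sum_nonneg fun i _ => ?_
  rw [bregman_quad]
  positivity

theorem RegularRun.integralLE_norm_sub_sq (hr : RegularRun p K G Λ s₀ s₁ δ S B η τ x₀ y₀ μ W x y)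
    (hm : Measurable yt) (hyt : ∀ ω i, yt ω i ∈ dualSet (p.f i)) :
    IntegralLE μ (fun ω => ∑ i, ‖yt ω i - y₀ i‖ ^ 2) (2 * radius μ quad yt y₀) := by
  have hi : ∀ i, MemLp (fun ω => yt ω i - y₀ i) 2 μ := fun i =>
    MemLp.of_bound (((measurable_pi_apply i).comp hm).sub_const (y₀ i)).aestronglyMeasurable
      (2 * K) (ae_of_all _ fun ω => hr.norm_sub_le_of_mem (hyt ω i) (hr.y₀_mem i))
  refine ⟨integrable_finsetSum _ fun i _ => (hi i).integrable_norm_pow two_ne_zero, le_of_eq ?_⟩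
  rw [radius, ← integral_const_mul]
  refine integral_congr_ae (ae_of_all _ fun ω => ?_)
  simp only [bregman_quad, ← Finset.mul_sum]
  ring

/-- The pathwise bound is applied with `w = yt ω` on each path and then integrated. The factor `6`
is `3 * 2`, as the radius carries the `1/2` of the Bregman divergence. -/
theorem RegularRun.lintegral_gap_le (hr : RegularRun p K G Λ s₀ s₁ δ S B η τ x₀ y₀ μ W x y)
    {xs : Vec d} (hxs : xs ∈ p.X) (hmin : IsMinOn p.F p.X xs) (hηΛ : 4 * K * Λ ≤ η)
    (hητ : 32 * G ^ 2 ≤ η * τ) {D : ℝ} (hD : ‖x₀ - xs‖ ≤ D) {T : ℕ} (hT : 0 < T)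
    (hyt : IsDualSelection p (average x T) yt) :
    ∫⁻ ω, (p.F (average x T ω) - p.F xs).toENNReal ∂μ
      ≤ ENNReal.ofReal (1 / T * (η / 2 * D ^ 2 + 8 * K ^ 2 * G ^ 2 / η
        + 6 * τ * (1 / S) * radius μ quad yt y₀
        + T * (4 * (K ^ 2 * s₁ ^ 2 + δ ^ 2) / (η * S) + 25 * s₀ ^ 2 / (B * τ)))) := by
  have hη := hr.η_pos
  have hτ := hr.τ_pos
  have hTp : (0 : ℝ) < T := Nat.cast_pos.2 hT
  -- The pathwise bound is stated for `T + 1` steps.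
  obtain ⟨T, rfl⟩ := Nat.exists_eq_succ_of_ne_zero hT.ne'
  have hR := (((((integralLE_const (μ := μ) (η / 2 * D ^ 2 + 8 * K ^ 2 * G ^ 2 / η)).add
    ((hr.integralLE_norm_sub_sq hyt.1 fun ω i => (hyt.2 ω i).1).const_mul
      (show 0 ≤ 3 * τ * (1 / (S : ℝ)) by positivity))).add
    (hr.integralLE_martingaleTerm hxs hmin (T + 1))).add
    (hr.integralLE_quadraticTerm (T + 1)))).const_mul
      (show (0 : ℝ) ≤ 1 / (T.succ : ℝ) by positivity)
  refine (hR.lintegral_toENNReal_le fun ω => ?_).trans_eq ?_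
  · have ht := hr.isTrajectory ω
    obtain ⟨a, ha, haF, hle⟩ := hr.regular.exists_gap_le hxs hmin hT
      (x := fun t => x (t + 1) ω) (fun t => (ht.primal_step t).1) (hyt.2 ω)
      (v := fun t => p.dualIter τ W x y t ω) (fun t i => (ht.dual_step t i).1)
    refine ⟨a, ha, haF, ?_⟩
    have h1 := hr.regular.sum_gap_le hr.S_pos hr.S_le hη hτ hηΛ hητ ht
      ⟨hxs, hr.regular.r_lt_top_of_isMinOn hmin⟩ (w := yt ω) (fun i =>
        (isMaxOn_sub_conj (ℓ := fun v => ⟪v, p.g i (average x T.succ ω)⟫) (hyt.2 ω i).1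
          (hyt.2 ω i).2).1) T
    simp only [hr.run.x_zero, hr.run.y_zero] at h1
    have h2 : η / 2 * ‖x₀ - xs‖ ^ 2 ≤ η / 2 * D ^ 2 := by gcongr
    have h3 := hle.trans h1
    rw [← le_div_iff₀' hTp] at h3
    refine h3.trans ?_
    rw [div_eq_inv_mul, ← one_div]
    refine mul_le_mul_of_nonneg_left ?_ (by positivity)
    linarith
  · congr 1
    push_cast
    ring

end Bound

/-- The choice of the step sizes. -/
theorem step_size_bound {K G s₀ s₁ δ Λ D K₀ C ε R η τ T : ℝ} {S B : ℕ} (hK : 0 ≤ K) (hG : 0 ≤ G)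
    (hΛ : 0 ≤ Λ) (hK₀ : K₀ = 1 + 20 * (K ^ 2 * s₁ ^ 2 + δ ^ 2) + 125 * s₀ ^ 2)
    (hC : C = 30 * K₀ + 5 / 2 * (K₀ * D ^ 2)) (hS : 1 ≤ S) (hB : 1 ≤ B) (hε : 0 < ε)
    (hεle : ε ≤ 1 / (1 + 4 * K * Λ * S + 6 * G * S * B + 2 * K * G * S))
    (hη : η = K₀ / (S * ε)) (hτ : τ = K₀ / (B * ε)) (hR : 0 ≤ R)
    (hT : C * max (1 / (S : ℝ)) (R / (B * S)) * (1 / ε ^ 2) ≤ T) :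
    4 * K * Λ ≤ η ∧ 32 * G ^ 2 ≤ η * τ ∧ 0 < T ∧
      1 / T * (η / 2 * D ^ 2 + 8 * K ^ 2 * G ^ 2 / η + 6 * τ * (1 / S) * R
        + T * (4 * (K ^ 2 * s₁ ^ 2 + δ ^ 2) / (η * S) + 25 * s₀ ^ 2 / (B * τ))) ≤ ε := by
  have hSp : (1 : ℝ) ≤ S := Nat.one_le_cast.2 hS
  have hBp : (1 : ℝ) ≤ B := Nat.one_le_cast.2 hB
  have hS0 : (0 : ℝ) < S := by linarith
  have hB0 : (0 : ℝ) < B := by linarith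
  have hV : 0 ≤ K ^ 2 * s₁ ^ 2 + δ ^ 2 := by positivity
  have hs := sq_nonneg s₀
  have hK1 : 1 ≤ K₀ := by linarith
  have hKp : 0 < K₀ := by linarith
  have hD2 : 0 ≤ K₀ * D ^ 2 := by positivity
  have hC30 : 30 * K₀ ≤ C := by linarith
  have hCp : 0 < C := by linarith
  have a1 : 0 ≤ 4 * K * Λ * S := by positivity
  have a2 : 0 ≤ 6 * G * S * B := by positivity
  have a3 : 0 ≤ 2 * K * G * S := by positivity
  have hden : ε * (1 + 4 * K * Λ * S + 6 * G * S * B + 2 * K * G * S) ≤ 1 := by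
    rwa [le_div_iff₀ (by linarith)] at hεle
  -- Each summand in the denominator of the accuracy threshold serves one purpose: `b1` gives `4 K Λ
  -- ≤ η`, `b2` gives `32 G² ≤ η τ`, and `b3` controls the boundary term `8 K² G² / η`.
  have b1 : 4 * K * Λ * S * ε ≤ 1 := by nlinarith
  have b2 : 6 * G * S * B * ε ≤ 1 := by nlinarith
  have b3 : 2 * K * G * S * ε ≤ 1 := by nlinarith
  have hT1 : C * (1 / S) * (1 / ε ^ 2) ≤ T := by
    refine le_trans ?_ hT
    gcongr
    exact le_max_left _ _
  have hT2 : C * (R / (B * S)) * (1 / ε ^ 2) ≤ T := by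
    refine le_trans ?_ hT
    gcongr
    exact le_max_right _ _
  have hTp : 0 < T := lt_of_lt_of_le (by positivity) hT1
  refine ⟨?_, ?_, hTp, ?_⟩
  · rw [hη, le_div_iff₀ (by positivity)]
    calc 4 * K * Λ * (S * ε) = 4 * K * Λ * S * ε := by ring
      _ ≤ 1 := b1
      _ ≤ K₀ := hK1
  · rw [hη, hτ, div_mul_div_comm, le_div_iff₀ (by positivity)]
    have c1 : (6 * G * S * B * ε) ^ 2 ≤ 1 := pow_le_one₀ (by positivity) b2
    have c2 : (1 : ℝ) ≤ S * B := one_le_mul_of_one_le_of_one_le hSp hBp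
    have c3 : 0 ≤ G ^ 2 * (S * B * ε ^ 2) := by positivity
    calc 32 * G ^ 2 * (S * ε * (B * ε)) ≤ 36 * (G ^ 2 * (S * B * ε ^ 2)) * (S * B) := by
          nlinarith
      _ = (6 * G * S * B * ε) ^ 2 := by ring
      _ ≤ 1 := c1
      _ ≤ K₀ * K₀ := one_le_mul_of_one_le_of_one_le hK1 hK1
  -- Five terms of size `ε/5`. The first two use the `1/S` branch of the lower bound on `T`, the
  -- third the radius branch; the last two do not decay in `T` and are small by the choice of `η`
  -- and `τ`.
  · have t1 : η / 2 * D ^ 2 ≤ ε / 5 * T := by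
      calc η / 2 * D ^ 2 = ε / 5 * (5 / 2 * (K₀ * D ^ 2) * (1 / S) * (1 / ε ^ 2)) := by
            rw [hη]
            field_simp
        _ ≤ ε / 5 * (C * (1 / S) * (1 / ε ^ 2)) := by
            gcongr
            linarith
        _ ≤ ε / 5 * T := by gcongr
    have t2 : 8 * K ^ 2 * G ^ 2 / η ≤ ε / 5 * T := by
      have c1 : (2 * K * G * S * ε) ^ 2 ≤ 1 := pow_le_one₀ (by positivity) b3
      calc 8 * K ^ 2 * G ^ 2 / η = (2 * K * G * S * ε) ^ 2 * (2 / (S * ε * K₀)) := by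
            rw [hη]
            field_simp
            ring
        _ ≤ 1 * (2 / (S * ε * 1)) := by gcongr
        _ = ε / 5 * (10 * (1 / S) * (1 / ε ^ 2)) := by
            field_simp
            norm_num
        _ ≤ ε / 5 * (C * (1 / S) * (1 / ε ^ 2)) := by
            gcongr
            linarith
        _ ≤ ε / 5 * T := by gcongr
    have t3 : 6 * τ * (1 / S) * R ≤ ε / 5 * T := by
      calc 6 * τ * (1 / S) * R = ε / 5 * (30 * K₀ * (R / (B * S)) * (1 / ε ^ 2)) := by
            rw [hτ]
            field_simp
            ring
        _ ≤ ε / 5 * (C * (R / (B * S)) * (1 / ε ^ 2)) := by gcongr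
        _ ≤ ε / 5 * T := by gcongr
    have t4 : 4 * (K ^ 2 * s₁ ^ 2 + δ ^ 2) / (η * S) ≤ ε / 5 := by
      rw [hη, show 4 * (K ^ 2 * s₁ ^ 2 + δ ^ 2) / (K₀ / (S * ε) * S)
        = ε / 5 * (20 * (K ^ 2 * s₁ ^ 2 + δ ^ 2) / K₀) by
          field_simp
          ring]
      refine mul_le_of_le_one_right (by positivity) (div_le_one_of_le₀ ?_ hKp.le)
      linarith
    have t5 : 25 * s₀ ^ 2 / (B * τ) ≤ ε / 5 := by
      rw [hτ, show 25 * s₀ ^ 2 / (B * (K₀ / (B * ε))) = ε / 5 * (125 * s₀ ^ 2 / K₀) by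
          field_simp
          ring]
      refine mul_le_of_le_one_right (by positivity) (div_le_one_of_le₀ ?_ hKp.le)
      linarith
    rw [one_div, inv_mul_le_iff₀ hTp]
    have t6 := mul_le_mul_of_nonneg_left (add_le_add t4 t5) hTp.le
    linarith

end ALEXR

end

/-! ### Complexity of the algorithm -/

theorem theorem3 (Cf Cg Lg σ₀ σ₁ δ D μψ Lψ : ℝ) (hCf : 0 < Cf) (hCg : 0 < Cg) (hLg : 0 < Lg)
    (hσ₀ : 0 ≤ σ₀) (hσ₁ : 0 ≤ σ₁) (hδ : 0 ≤ δ) (hD : 0 ≤ D) (hμψ : 0 < μψ) (hLψ : 0 < Lψ) :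
    -- the hidden constant depends on the constants above only
    ∃ C : ℝ, 0 < C ∧ ∀ S B : ℕ, 1 ≤ S → 1 ≤ B →
    -- the accuracy is small enough, and the step sizes depend on constants, batch sizes, accuracy
    ∃ ε₀ : ℝ, 0 < ε₀ ∧ ∀ ε : ℝ, 0 < ε → ε ≤ ε₀ →
    ∃ η τ : ℝ, 0 < η ∧ η ≤ C / ε ∧ 0 < τ ∧ τ ≤ C / (B * ε) ∧
    -- every problem, with a norm for which the quadratic is strongly convex and smooth
    ∀ (n d m : ℕ), S ≤ n → ∀ (Z : Type*) [MeasurableSpace Z] (p : ALEXR.Problem n d m Z)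
      (q : Seminorm ℝ (ALEXR.Vec m)),
      (∀ v, μψ * q v ^ 2 ≤ ‖v‖ ^ 2 ∧ ‖v‖ ^ 2 ≤ Lψ * q v ^ 2) →
      p.Assumptions q Cf Cg Lg σ₀ σ₁ δ →
    ∀ xs ∈ p.X, IsMinOn p.F p.X xs →
    ∀ x₀ ∈ p.X, ‖x₀ - xs‖ ≤ D →
    ∀ y₀ : Fin n → ALEXR.Vec m, (∀ i, y₀ i ∈ ALEXR.dualSet (p.f i)) →
    -- every run of the algorithm
    ∀ (Ω : Type*) [MeasurableSpace Ω] (μ : Measure Ω) [IsProbabilityMeasure μ]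
      (W : ℕ → Ω → ALEXR.Sample n B Z) (x : ℕ → Ω → ALEXR.Vec d)
      (y : ℕ → Ω → Fin n → ALEXR.Vec m),
      ALEXR.IsRun p S B ALEXR.quad 1 η τ x₀ y₀ μ W x y →
    -- the number of iterations
    ∀ (T : ℕ) (yt : Ω → Fin n → ALEXR.Vec m),
      ALEXR.IsDualSelection p (ALEXR.average x T) yt →
      C * max (1 / (S : ℝ)) (ALEXR.radius μ ALEXR.quad yt y₀ / (B * S)) * (1 / ε ^ 2) ≤ T →
      ∫⁻ ω, (p.F (ALEXR.average x T ω) - p.F xs).toENNReal ∂μ ≤ ENNReal.ofReal ε := by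
  set K := Cf * √Lψ with hK
  set G := Cg / √μψ with hG
  set Λ := Lg / √μψ with hΛ
  have hK0 : 0 ≤ K := by positivity
  have hG0 : 0 ≤ G := by positivity
  have hΛ0 : 0 ≤ Λ := by positivity
  -- The factors are `20 = 5 * 4` and `125 = 5 * 25`, so that each variance term is at most `ε/5`.
  -- The summand `1` keeps `K₀ ≥ 1` even without noise, as the step-size conditions require.
  set K₀ : ℝ := 1 + 20 * (K ^ 2 * (σ₁ / √μψ) ^ 2 + δ ^ 2) + 125 * (σ₀ / √μψ) ^ 2 with hK₀
  have hK₀p : 0 < K₀ := by positivity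
  refine ⟨30 * K₀ + 5 / 2 * (K₀ * D ^ 2), by positivity, fun S B hS hB =>
    ⟨1 / (1 + 4 * K * Λ * S + 6 * G * S * B + 2 * K * G * S), by positivity, fun ε hε hεle => ?_⟩⟩
  have hS1 : (1 : ℝ) ≤ S := Nat.one_le_cast.2 hS
  have hB1 : (1 : ℝ) ≤ B := Nat.one_le_cast.2 hB
  have hCle : K₀ ≤ 30 * K₀ + 5 / 2 * (K₀ * D ^ 2) := by
    have : 0 ≤ K₀ * D ^ 2 := by positivity
    linarith
  refine ⟨K₀ / (S * ε), K₀ / (B * ε), by positivity, ?_, by positivity, by gcongr, ?_⟩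
  · gcongr
    exact le_mul_of_one_le_left hε.le hS1
  intro n d m hSn Z _ p q hq hp xs hxs hmin x₀ hx₀ hD₀ y₀ hy₀ Ω _ μ _ W x y hrun T yt hyt hT
  have hreg := hp.regular hCf.le hCg.le hLg.le hμψ hLψ.le hq
  obtain ⟨h1, h2, h3, h4⟩ := ALEXR.step_size_bound hK0 hG0 hΛ0 hK₀ rfl hS hB hε hεle rfl rfl
    (ALEXR.radius_nonneg μ yt y₀) hT
  have hr : ALEXR.RegularRun p K G Λ (σ₀ / √μψ) (σ₁ / √μψ) δ S B (K₀ / (S * ε)) (K₀ / (B * ε))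
      x₀ y₀ μ W x y :=
    ⟨hreg, hrun, hS, hSn, hB, by positivity, by positivity, hx₀, hy₀⟩
  exact (hr.lintegral_gap_le hxs hmin h1 h2 hD₀ (Nat.cast_pos.1 h3) hyt).trans
    (ENNReal.ofReal_le_ofReal h4)
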